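/- Let $Q\subset\mathbb R^n$ be a bounded closed convex set with nonempty interior, $F$ a $\nu$-self-concordant barrier for $Q$ (with domain $\operatorname{int}Q$), $0\ne c\in\mathbb R^n$ and $\epsilon>0$. Write $\|v\|_x^*=\sqrt{v^T[F''(x)]^{-1}v}$, $\beta=1/9$, $\gamma=5/36$, and $\mathrm{tol}^{-1}=\bigl(\nu+\frac{(\beta+\sqrt\nu)\beta}{1-\beta}\bigr)\epsilon^{-1}$. **Short-step algorithm** for minimizing $c^Tx$ over $Q$. *Main phase*, from $x^{(0)}\in\operatorname{int}Q$ with $\|F'(x^{(0)})\|^*_{x^{(0)}}\le\beta$ and $t_0=0$: $t_{k+1}=t_k+\gamma/\|c\|^*_{x^{(k)}}$, $x^{(k+1)}=x^{(k)}-[F''(x^{(k)})]^{-1}(t_{k+1}c+F'(x^{(k)}))$, until $t_k\ge\mathrm{tol}^{-1}$. *Auxiliary phase*, from any $\hat x=x^{(0)}\in\operatorname{int}Q$ with $t_0=1$ and $G=-F'(\hat x)$: $t_{k+1}=t_k-\gamma/\|G\|^*_{x^{(k)}}$, $x^{(k+1)}=x^{(k)}-[F''(x^{(k)})]^{-1}(t_{k+1}G+F'(x^{(k)}))$,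 until $\|F'(x^{(k)})\|^*_{x^{(k)}}\le\frac{\sqrt\beta}{1+\sqrt\beta}$; its output is $\bar x=x^{(k)}-[F''(x^{(k)})]^{-1}F'(x^{(k)})$. The complete algorithm runs the auxiliary phase from $\hat x$ and then the main phase from $\bar x$. **Adaptive algorithm.** With $d=c$ (main phase) or $d=G$ (auxiliary phase), $x^{(k)}$ is *accepted* if $\|t_kd+F'(x^{(k)})\|^*_{x^{(k)}}\le\beta$, and otherwise is a *slow step*. Start with the same $t_0$ and with $\kappa_0=10$. If $x^{(k)}$ is accepted, put $\kappa_{k+1}=\min\{\kappa_0,\kappa_k^2\}$ if at most 2 slow steps immediately preceded it, $\kappa_{k+1}=\sqrt{\kappa_k}$ if at least 8 did, and $\kappa_{k+1}=\kappa_k$ otherwise; then put $t_{k+1}=\max\{\kappa_{k+1}t_k,\;t_k+\gamma/\|c\|^*_{x^{(k)}}\}$ in the main phase and $t_{k+1}=\min\{t_k/\kappa_{k+1},\;t_k-\gamma/\|G\|^*_{x^{(k)}}\}$ in the auxiliary phase. If $x^{(k)}$ is a slow step, put $t_{k+1}=t_k$ and $\kappa_{k+1}=\kappa_k$. In both cases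 $x^{(k+1)}=x^{(k)}-r_k[F''(x^{(k)})]^{-1}(t_{k+1}d+F'(x^{(k)}))$, where $r_k$ is the first of $1,\frac14,\frac1{16},\dots$ for which the new point lies in $\operatorname{int}Q$ and $f(x)=t_{k+1}d^Tx+F(x)$ decreases by at least $0.01\,r_k$ times the squared Newton decrement $(\|t_{k+1}d+F'(x^{(k)})\|^*_{x^{(k)}})^2$. Exception (*rejection*): if $x^{(k)}$ is the 15th slow step in a row, $(t_{k+1},x^{(k+1)})$ is instead the most recently accepted pair and $\kappa_{k+1}=\kappa_k^{1/4}$; from this restored pair the method continues with that value of $\kappa$ unchanged. The stopping criteria, the step to $\bar x$ and the two phases are those of the short-step algorithm. Let $N_S$ and $N_A$ be the numbers of Newton steps of the short-step and adaptive algorithms, all iterations of rejected trials included in $N_A$. Then both algorithms terminate and $$N_A\le 16\,[0.76+0.73\log(1+9\sqrt\nu)]\,N_S .$$ This holds for the main phase (both methods started from the same $x^{(0)}$), for the auxiliary phase (both started from the same $\hat x$), and for the complete algorithms (both started from the same $\hat x$, each main phase starting from its own $\bar x$, with the step to $\bar x$ counted). It also holds if the adaptive main phase is required to stop at an accepted step.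 Consequently the adaptive algorithm needs $\tilde O(\sqrt\nu)$ Newton steps: there is an absolute constant $K$ such that the complete adaptive algorithm from $\hat x$ satisfies, with $x_F^*$ the analytic center ($F'(x_F^*)=0$) and $\log^+u=\max(0,\log u)$ (with $\log^+0=0$), $$N_A\le K\sqrt\nu\,(1+\log\nu)\bigl(1+\log\nu+\log^+\|F'(\hat x)\|^*_{x_F^*}+\log^+\|c\|^*_{x_F^*}+\log^+(1/\epsilon)\bigr).$$ -/

import Mathlib

open scoped Gradient InnerProductSpace

noncomputable section

namespace Barrier

/-- The space `ℝⁿ` with its Euclidean structure. -/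
abbrev Vec (n : ℕ) : Type := EuclideanSpace ℝ (Fin n)

/-- `F` is a `ν`-self-concordant barrier for the closed convex set `Q`, with domain the interior
of `Q`: a convex `C³` function that tends to `+∞` at the boundary, is (standard) self-concordant,
`|D³F(x)[h,h,h]| ≤ 2 (D²F(x)[h,h])^{3/2}`, and satisfies
`sup_h {2 DF(x)[h] - D²F(x)[h,h]} ≤ ν`. The values of `F` outside the interior play no role. -/
structure IsSelfConcordantBarrier {n : ℕ} (Q : Set (Vec n)) (F : Vec n → ℝ) (ν : ℝ) : Prop where
  contDiffOn : ContDiffOn ℝ 3 F (interior Q)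
  convexOn : ConvexOn ℝ (interior Q) F
  tendsto_frontier : ∀ y ∈ frontier Q, Filter.Tendsto F (nhdsWithin y (interior Q)) Filter.atTop
  self_concordant : ∀ x ∈ interior Q, ∀ h : Vec n,
    |iteratedFDeriv ℝ 3 F x ![h, h, h]| ≤ 2 * Real.sqrt (iteratedFDeriv ℝ 2 F x ![h, h]) ^ 3
  barrier : ∀ x ∈ interior Q, ∀ h : Vec n,
    2 * fderiv ℝ F x h - iteratedFDeriv ℝ 2 F x ![h, h] ≤ ν

variable {n : ℕ}

/-- The Hessian `F''(x)`, as a linear map. -/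
def hess (F : Vec n → ℝ) (x : Vec n) : Vec n →L[ℝ] Vec n := fderiv ℝ (gradient F) x

/-- `[F''(x)]⁻¹ v`. -/
def hessInv (F : Vec n → ℝ) (x v : Vec n) : Vec n := (hess F x).inverse v

/-- The local dual norm `‖v‖*_x = √(vᵀ [F''(x)]⁻¹ v)`. -/
def dualNorm (F : Vec n → ℝ) (x v : Vec n) : ℝ := Real.sqrt ⟪v, hessInv F x v⟫_ℝ

/-- The centering tolerance `β = 1/9`. -/
def beta : ℝ := 1 / 9

/-- The step constant `γ = 5/36`. -/
def gamma : ℝ := 5 / 36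

/-- The initial (and largest) step size `κ₀ = 10` of the adaptive method. -/
def kappa0 : ℝ := 10

/-- `tol⁻¹ = (ν + (β + √ν) β / (1 - β)) / ε`. -/
def tolInv (ν ε : ℝ) : ℝ := (ν + (beta + Real.sqrt ν) * beta / (1 - beta)) * ε⁻¹

/-- The Newton direction `-[F''(x)]⁻¹ (t d + F'(x))` for `y ↦ t dᵀy + F(y)`. -/
def newtonDir (F : Vec n → ℝ) (d : Vec n) (t : ℝ) (x : Vec n) : Vec n :=
  -hessInv F x (t • d + gradient F x)

/-! ### Short-step path following -/

/-- Short-step path following in the direction `d`, with a rule `next t x` for the new barrier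
parameter, from `(t₀, x₀)`: the pairs `(t_k, x^{(k)})`. -/
def shortRun (F : Vec n → ℝ) (d : Vec n) (next : ℝ → Vec n → ℝ) (t₀ : ℝ) (x₀ : Vec n) :
    ℕ → ℝ × Vec n
  | 0 => (t₀, x₀)
  | k + 1 =>
    let s := shortRun F d next t₀ x₀ k
    let t' := next s.1 s.2
    (t', s.2 + newtonDir F d t' s.2)

/-- Short-step main scheme: `t₀ = 0`, `t_{k+1} = t_k + γ / ‖c‖*_{x^{(k)}}`. -/
def shortMain (F : Vec n → ℝ) (c x₀ : Vec n) : ℕ → ℝ × Vec n :=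
  shortRun F c (fun t x => t + gamma / dualNorm F x c) 0 x₀

/-- Short-step auxiliary scheme: `G = -F'(x₀)`, `t₀ = 1`,
`t_{k+1} = t_k - γ / ‖G‖*_{x^{(k)}}`. -/
def shortAux (F : Vec n → ℝ) (x₀ : Vec n) : ℕ → ℝ × Vec n :=
  shortRun F (-gradient F x₀) (fun t x => t - gamma / dualNorm F x (-gradient F x₀)) 1 x₀

/-! ### Adaptive path following -/

/-- Backtracking line search (constants `0.01` and `0.25`) for `f(y) = t dᵀy + F(y)` on the
interior of `Q`, from `x` in the Newton direction `Δ`: the first `r ∈ {1, 1/4, 1/16, …}` with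
`x + rΔ` in the domain and `f(x + rΔ) ≤ f(x) + 0.01 r f'(x)ᵀΔ`. -/
def lineSearch (Q : Set (Vec n)) (F : Vec n → ℝ) (d : Vec n) (t : ℝ) (x : Vec n) : ℝ :=
  let Δ := newtonDir F d t x
  (1 / 4 : ℝ) ^ sInf {j : ℕ |
    x + (1 / 4 : ℝ) ^ j • Δ ∈ interior Q ∧
    t * ⟪d, x + (1 / 4 : ℝ) ^ j • Δ⟫_ℝ + F (x + (1 / 4 : ℝ) ^ j • Δ) ≤
      t * ⟪d, x⟫_ℝ + F x + 0.01 * (1 / 4 : ℝ) ^ j * ⟪t • d + gradient F x, Δ⟫_ℝ}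

/-- One damped Newton step with barrier parameter `t`. -/
def dampedNewton (Q : Set (Vec n)) (F : Vec n → ℝ) (d : Vec n) (t : ℝ) (x : Vec n) : Vec n :=
  x + lineSearch Q F d t x • newtonDir F d t x

/-- The `k`-th state of the adaptive method. -/
structure AdaptiveState (n : ℕ) where
  /-- barrier parameter `t_k` -/
  t : ℝ
  /-- iterate `x^{(k)}` -/
  x : Vec n
  /-- step size `κ_k` -/
  kappa : ℝ
  /-- number of slow steps immediately before `x^{(k)}` -/
  slow : ℕ
  /-- barrier parameter of the most recently accepted step before `k` -/
  lastT : ℝ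
  /-- most recently accepted iterate before `k` -/
  lastX : Vec n
  /-- whether `x^{(k)}` was put back by a rejection -/
  restored : Prop

/-- `x^{(k)}` is accepted: `‖t_k d + F'(x^{(k)})‖*_{x^{(k)}} ≤ β`. Otherwise it is a slow step. -/
def Accepted (F : Vec n → ℝ) (d : Vec n) (s : AdaptiveState n) : Prop :=
  dualNorm F s.x (s.t • d + gradient F s.x) ≤ beta

open Classical in
/-- The step size `κ_{k+1}` chosen at an accepted step. A step put back by a rejection is not newly
accepted, so the step size that was set by the rejection is kept. -/
def acceptedKappa (s : AdaptiveState n) : ℝ :=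
  if s.restored then s.kappa
  else if s.slow ≤ 2 then min kappa0 (s.kappa ^ 2)
  else if 8 ≤ s.slow then Real.sqrt s.kappa
  else s.kappa

open Classical in
/-- One iteration of the adaptive method; `next κ t x` is the rule for the new barrier parameter at
an accepted step. If `x^{(k)}` is the 15th slow step in a row, the most recently accepted step is
put back and `κ_{k+1} = κ_k^{1/4}` (a rejection). -/
def adaptiveStep (Q : Set (Vec n)) (F : Vec n → ℝ) (d : Vec n) (next : ℝ → ℝ → Vec n → ℝ)
    (s : AdaptiveState n) : AdaptiveState n :=
  if Accepted F d s then
    let κ' := acceptedKappa s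
    let t' := next κ' s.t s.x
    { t := t', x := dampedNewton Q F d t' s.x, kappa := κ', slow := 0,
      lastT := s.t, lastX := s.x, restored := False }
  else if s.slow + 1 < 15 then
    { s with x := dampedNewton Q F d s.t s.x, slow := s.slow + 1, restored := False }
  else
    { s with t := s.lastT, x := s.lastX, kappa := s.kappa ^ (1 / 4 : ℝ), slow := 0,
             restored := True }

/-- The adaptive method from `(t₀, x₀)` and `κ₀ = 10`. -/
def adaptiveRun (Q : Set (Vec n)) (F : Vec n → ℝ) (d : Vec n) (next : ℝ → ℝ → Vec n → ℝ)
    (t₀ : ℝ) (x₀ : Vec n) : ℕ → AdaptiveState n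
  | 0 => { t := t₀, x := x₀, kappa := kappa0, slow := 0, lastT := t₀, lastX := x₀,
           restored := False }
  | k + 1 => adaptiveStep Q F d next (adaptiveRun Q F d next t₀ x₀ k)

/-- Adaptive main scheme: `t₀ = 0`, and
`t_{k+1} = max {κ_{k+1} t_k, t_k + γ / ‖c‖*_{x^{(k)}}}` at accepted steps. -/
def adaptiveMain (Q : Set (Vec n)) (F : Vec n → ℝ) (c x₀ : Vec n) : ℕ → AdaptiveState n :=
  adaptiveRun Q F c (fun κ t x => max (κ * t) (t + gamma / dualNorm F x c)) 0 x₀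

/-- Adaptive auxiliary scheme: `G = -F'(x₀)`, `t₀ = 1`, and
`t_{k+1} = min {t_k / κ_{k+1}, t_k - γ / ‖G‖*_{x^{(k)}}}` at accepted steps. -/
def adaptiveAux (Q : Set (Vec n)) (F : Vec n → ℝ) (x₀ : Vec n) : ℕ → AdaptiveState n :=
  adaptiveRun Q F (-gradient F x₀)
    (fun κ t x => min (t / κ) (t - gamma / dualNorm F x (-gradient F x₀))) 1 x₀

/-! ### Stopping criteria and numbers of Newton steps -/

/-- Stopping criterion of the auxiliary scheme: `‖F'(x)‖*_x ≤ √β / (1 + √β)`. -/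
def AuxStop (F : Vec n → ℝ) (x : Vec n) : Prop :=
  dualNorm F x (gradient F x) ≤ Real.sqrt beta / (1 + Real.sqrt beta)

/-- The iteration indices at which the short-step main scheme may stop: `t_k ≥ tol⁻¹`. -/
def shortMainStops (F : Vec n → ℝ) (c : Vec n) (ν ε : ℝ) (x₀ : Vec n) : Set ℕ :=
  {k | tolInv ν ε ≤ (shortMain F c x₀ k).1}

/-- The iteration indices with `t_k ≥ tol⁻¹` in the adaptive main scheme. -/
def adaptiveMainStops (Q : Set (Vec n)) (F : Vec n → ℝ) (c : Vec n) (ν ε : ℝ) (x₀ : Vec n) :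
    Set ℕ :=
  {k | tolInv ν ε ≤ (adaptiveMain Q F c x₀ k).t}

/-- The iteration indices with `t_k ≥ tol⁻¹` and `x^{(k)}` accepted in the adaptive main scheme. -/
def adaptiveMainAcceptedStops (Q : Set (Vec n)) (F : Vec n → ℝ) (c : Vec n) (ν ε : ℝ)
    (x₀ : Vec n) : Set ℕ :=
  {k | tolInv ν ε ≤ (adaptiveMain Q F c x₀ k).t ∧ Accepted F c (adaptiveMain Q F c x₀ k)}

/-- The iteration indices at which the short-step auxiliary scheme may stop. -/
def shortAuxStops (F : Vec n → ℝ) (x₀ : Vec n) : Set ℕ :=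
  {k | AuxStop F (shortAux F x₀ k).2}

/-- The iteration indices at which the adaptive auxiliary scheme may stop. -/
def adaptiveAuxStops (Q : Set (Vec n)) (F : Vec n → ℝ) (x₀ : Vec n) : Set ℕ :=
  {k | AuxStop F (adaptiveAux Q F x₀ k).x}

/-- `N_S` for the main phase started at `x₀`. -/
def shortMainSteps (F : Vec n → ℝ) (c : Vec n) (ν ε : ℝ) (x₀ : Vec n) : ℕ :=
  sInf (shortMainStops F c ν ε x₀)

/-- `N_A` for the main phase started at `x₀`, stopped as soon as `t_k ≥ tol⁻¹`. All iterations are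
counted, those of rejected trials included. -/
def adaptiveMainSteps (Q : Set (Vec n)) (F : Vec n → ℝ) (c : Vec n) (ν ε : ℝ) (x₀ : Vec n) : ℕ :=
  sInf (adaptiveMainStops Q F c ν ε x₀)

/-- `N_A` for the main phase started at `x₀`, stopped as soon as `t_k ≥ tol⁻¹` at an accepted
step. -/
def adaptiveMainAcceptedSteps (Q : Set (Vec n)) (F : Vec n → ℝ) (c : Vec n) (ν ε : ℝ)
    (x₀ : Vec n) : ℕ :=
  sInf (adaptiveMainAcceptedStops Q F c ν ε x₀)

/-- `N_S` for the auxiliary phase started at `x₀`. -/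
def shortAuxSteps (F : Vec n → ℝ) (x₀ : Vec n) : ℕ := sInf (shortAuxStops F x₀)

/-- `N_A` for the auxiliary phase started at `x₀`. -/
def adaptiveAuxSteps (Q : Set (Vec n)) (F : Vec n → ℝ) (x₀ : Vec n) : ℕ :=
  sInf (adaptiveAuxStops Q F x₀)

/-- The output `x̄ = x - [F''(x)]⁻¹ F'(x)` of an auxiliary phase that stops at `x`. -/
def auxFinal (F : Vec n → ℝ) (x : Vec n) : Vec n := x - hessInv F x (gradient F x)

/-- `x̄` for the short-step method. -/
def shortAuxOutput (F : Vec n → ℝ) (x₀ : Vec n) : Vec n :=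
  auxFinal F (shortAux F x₀ (shortAuxSteps F x₀)).2

/-- `x̄` for the adaptive method. -/
def adaptiveAuxOutput (Q : Set (Vec n)) (F : Vec n → ℝ) (x₀ : Vec n) : Vec n :=
  auxFinal F (adaptiveAux Q F x₀ (adaptiveAuxSteps Q F x₀)).x

/-- `N_S` for the complete short-step algorithm: auxiliary phase, the step to `x̄`, and main phase
from `x̄`. -/
def shortTotal (F : Vec n → ℝ) (c : Vec n) (ν ε : ℝ) (x₀ : Vec n) : ℕ :=
  shortAuxSteps F x₀ + 1 + shortMainSteps F c ν ε (shortAuxOutput F x₀)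

/-- `N_A` for the complete adaptive algorithm, stopped as soon as `t_k ≥ tol⁻¹`. -/
def adaptiveTotal (Q : Set (Vec n)) (F : Vec n → ℝ) (c : Vec n) (ν ε : ℝ) (x₀ : Vec n) : ℕ :=
  adaptiveAuxSteps Q F x₀ + 1 + adaptiveMainSteps Q F c ν ε (adaptiveAuxOutput Q F x₀)

/-- `N_A` for the complete adaptive algorithm, stopped as soon as `t_k ≥ tol⁻¹` at an accepted
step. -/
def adaptiveAcceptedTotal (Q : Set (Vec n)) (F : Vec n → ℝ) (c : Vec n) (ν ε : ℝ) (x₀ : Vec n) :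
    ℕ :=
  adaptiveAuxSteps Q F x₀ + 1 + adaptiveMainAcceptedSteps Q F c ν ε (adaptiveAuxOutput Q F x₀)

/-- The factor `16 [0.76 + 0.73 log(1 + 9√ν)]`. -/
def adaptiveFactor (ν : ℝ) : ℝ := 16 * (0.76 + 0.73 * Real.log (1 + 9 * Real.sqrt ν))

end Barrier

end

/-!
The proof has three layers.

*Self-concordance.* On the interior of a bounded convex set the Hessian of the barrier defines the
local norms `lnorm` and their duals `dualNorm`. The diagonal bound on the third derivative gives
the mixed bound `|D³F(x)[u, h, h]| ≤ 2 ‖u‖ₓ ‖h‖ₓ²` by interpolating a binary cubic form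
(`Barrier.cubic_mixed_le`). Integrated along segments it yields the nondegeneracy of the Hessian,
the Dikin ellipsoid, and the comparison of the norms at neighbouring points. It follows that a
full Newton step takes a decrement `δ` to at most `(δ / (1 - δ))²` (`newton_decrement`), that the
line search accepts `r` as soon as `r δ ≤ 0.36` (`armijo`), and that a point of decrement `δ` is
within `δ / (1 - δ)` of the center (`lnorm_center_sub_le`). A similar argument along a
ray that leaves the domain gives `ν ≥ 1` (`one_le_nu`).

*Counting adaptive iterations.* The step sizes of the adaptive method are `kap m = 10^{1/2^m}`.
Call a success the passage from one newly accepted point to the next one, with the rejections in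
between. In the potential `8 m` a rejection is free: it costs 16 iterations and raises `m` by two.
A trial that succeeds takes at most 3, 8 or 15 iterations while `m` changes by `-1`, `0` or `1`,
so a success costs at most 11 in amortized terms. The potential stays below about `8 log₂ B`,
where `B` is a multiple of `W = 1 + 9 √ν`: for `2^m ≥ B` the change of `t` keeps the decrement
below `0.36`, and then at most two slow steps follow. This is `successful_trial`, and it bounds
the iterations of `S` successes by `11 (S - 1) + 19 + 8 log₂ B`.

*Covering short steps.* Near the central path, `‖d‖*_y ≤ 2 ‖d‖*_x` as long as the parameters of
`x` and `y` differ by at most `γ / ‖d‖*_x` (`dualNorm_le_two_mul`). So an adaptive success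
advances at least half a short step, and two successes cover one short step. In the main phase
this suffices, since there the stopping rule concerns `t` alone. In the auxiliary phase it brings
`t` below the last short-step parameter, and a few further trials reach the stopping rule, because
`t ‖G‖*` is then already small (`aux_end_half`, `aux_end_small_kap`, `aux_end_large_kap`). The
logarithmic factor in the bound has room for all of these constants.

For the complexity, a short step changes `t` by a factor of at least `1 + 1.25 / W`
(`mul_le_gamma_div`), and `‖v‖*_x ≤ 8 ν ‖v‖*_{x_F}` (`dualNorm_le_analyticCenter`) turns the
initial and final values of `t` into the quantities at the analytic center.
-/

namespace Barrier

/-! ### Calculus along line segments -/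

theorem le_of_hasDerivAt_nonneg {f f' : ℝ → ℝ} {a b : ℝ} (hab : a ≤ b)
    (hf : ∀ t ∈ Set.Icc a b, HasDerivAt f (f' t) t) (h0 : ∀ t ∈ Set.Icc a b, 0 ≤ f' t) :
    f a ≤ f b := by
  have hmono : MonotoneOn f (Set.Icc a b) := by
    refine monotoneOn_of_deriv_nonneg (convex_Icc a b)
      (fun t ht => (hf t ht).continuousAt.continuousWithinAt)
      (fun t ht => ((hf t (interior_subset ht)).differentiableAt).differentiableWithinAt) ?_
    intro t ht
    rw [(hf t (interior_subset ht)).deriv]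
    exact h0 t (interior_subset ht)
  exact hmono (Set.left_mem_Icc.2 hab) (Set.right_mem_Icc.2 hab) hab

theorem sub_le_sub_of_hasDerivAt_le {f g f' g' : ℝ → ℝ} {a b : ℝ} (hab : a ≤ b)
    (hf : ∀ t ∈ Set.Icc a b, HasDerivAt f (f' t) t)
    (hg : ∀ t ∈ Set.Icc a b, HasDerivAt g (g' t) t) (h : ∀ t ∈ Set.Icc a b, f' t ≤ g' t) :
    f b - f a ≤ g b - g a := by
  have := le_of_hasDerivAt_nonneg (f := fun t => g t - f t) (f' := fun t => g' t - f' t) hab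
    (fun t ht => (hg t ht).sub (hf t ht)) (fun t ht => sub_nonneg.2 (h t ht))
  linarith

variable {n : ℕ}

/-- The third derivative `D³F(x)[u, h, k]`. -/
noncomputable def third (F : Vec n → ℝ) (x u h k : Vec n) : ℝ :=
  fderiv ℝ (fderiv ℝ (fderiv ℝ F)) x u h k

/-- The local norm `‖h‖_x = √(hᵀ F''(x) h)`. -/
noncomputable def lnorm (F : Vec n → ℝ) (x h : Vec n) : ℝ := Real.sqrt ⟪hess F x h, h⟫_ℝ

theorem inner_gradient (F : Vec n → ℝ) (x h : Vec n) : ⟪gradient F x, h⟫_ℝ = fderiv ℝ F x h :=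
  inner_gradient_left

theorem inner_hess (F : Vec n → ℝ) (x u v : Vec n) :
    ⟪hess F x u, v⟫_ℝ = fderiv ℝ (fderiv ℝ F) x u v := by
  -- the Riesz isomorphism, as a linear (rather than conjugate-linear) equivalence
  let e : Vec n ≃L[ℝ] (Vec n →L[ℝ] ℝ) := LinearEquiv.toContinuousLinearEquiv
    { (InnerProductSpace.toDual ℝ (Vec n)).toLinearEquiv with
      map_smul' := fun r v => by simp }
  have h1 : fderiv ℝ F = e ∘ gradient F := (toDual_comp_gradient (𝕜 := ℝ)).symm
  have h2 : fderiv ℝ (fderiv ℝ F) x = (e : Vec n →L[ℝ] _).comp (hess F x) := by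
    conv_lhs => rw [h1]
    exact e.comp_fderiv
  rw [h2]
  rfl

theorem inner_hess_eq_iteratedFDeriv (F : Vec n → ℝ) (x u v : Vec n) :
    ⟪hess F x u, v⟫_ℝ = iteratedFDeriv ℝ 2 F x ![u, v] := by
  rw [inner_hess, iteratedFDeriv_two_apply]; rfl

theorem third_eq_iteratedFDeriv (F : Vec n → ℝ) (x h : Vec n) :
    third F x h h h = iteratedFDeriv ℝ 3 F x ![h, h, h] := by
  rw [iteratedFDeriv_succ_apply_right, iteratedFDeriv_two_apply]
  rfl

section Smooth

variable {F : Vec n → ℝ} {x : Vec n}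

theorem hess_symm (hF : ContDiffAt ℝ 3 F x) (u v : Vec n) :
    ⟪hess F x u, v⟫_ℝ = ⟪hess F x v, u⟫_ℝ := by
  rw [inner_hess, inner_hess]
  exact (hF.isSymmSndFDerivAt (by simp; norm_num)) u v

theorem third_symm_right (hF : ContDiffAt ℝ 3 F x) (u h k : Vec n) :
    third F x u h k = third F x u k h := by
  have h2 : ContDiffAt ℝ 2 (fderiv ℝ F) x := hF.fderiv_right (by norm_num)
  have hd : DifferentiableAt ℝ (fderiv ℝ (fderiv ℝ F)) x :=
    (h2.fderiv_right (m := 1) (by norm_num)).differentiableAt (by norm_num)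
  have e1 : ∀ h k : Vec n, third F x u h k =
      fderiv ℝ (fun y => fderiv ℝ (fderiv ℝ F) y h k) x u := by
    intro h k
    have := ((hd.hasFDerivAt.clm_apply (hasFDerivAt_const h x)).clm_apply
      (hasFDerivAt_const k x)).fderiv
    rw [this]
    simp [third]
  have hev : (fun y => fderiv ℝ (fderiv ℝ F) y h k) =ᶠ[nhds x]
      (fun y => fderiv ℝ (fderiv ℝ F) y k h) := by
    filter_upwards [hF.eventually (by simp)] with y hy
    exact (hy.isSymmSndFDerivAt (by simp; norm_num)) h k
  rw [e1, e1, hev.fderiv_eq]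

theorem third_symm_left (hF : ContDiffAt ℝ 3 F x) (u h k : Vec n) :
    third F x u h k = third F x h u k := by
  have h2 : ContDiffAt ℝ 2 (fderiv ℝ F) x := hF.fderiv_right (by norm_num)
  have := (h2.isSymmSndFDerivAt (by simp)) u h
  unfold third
  rw [this]

theorem hasDerivAt_add_smul (x u : Vec n) (t : ℝ) :
    HasDerivAt (fun t : ℝ => x + t • u) u t := by
  simpa using ((hasDerivAt_id t).smul_const u).const_add x

theorem hasDerivAt_line {u : Vec n} {t : ℝ} (hF : ContDiffAt ℝ 3 F (x + t • u)) :
    HasDerivAt (fun t : ℝ => F (x + t • u)) ⟪gradient F (x + t • u), u⟫_ℝ t := by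
  rw [inner_gradient]
  exact (hF.differentiableAt (by norm_num)).hasFDerivAt.comp_hasDerivAt t
    (hasDerivAt_add_smul x u t)

theorem hasDerivAt_gradient_line {u : Vec n} {t : ℝ} (hF : ContDiffAt ℝ 3 F (x + t • u))
    (h : Vec n) : HasDerivAt (fun t : ℝ => ⟪gradient F (x + t • u), h⟫_ℝ)
      ⟪hess F (x + t • u) u, h⟫_ℝ t := by
  simp only [inner_gradient, inner_hess]
  have h2 : ContDiffAt ℝ 2 (fderiv ℝ F) (x + t • u) := hF.fderiv_right (by norm_num)
  have := (h2.differentiableAt (by norm_num)).hasFDerivAt.comp_hasDerivAt t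
    (hasDerivAt_add_smul x u t)
  simpa using this.clm_apply (hasDerivAt_const t h)

theorem hasDerivAt_hess_line {u : Vec n} {t : ℝ} (hF : ContDiffAt ℝ 3 F (x + t • u))
    (h k : Vec n) : HasDerivAt (fun t : ℝ => ⟪hess F (x + t • u) h, k⟫_ℝ)
      (third F (x + t • u) u h k) t := by
  simp only [inner_hess]
  have h2 : ContDiffAt ℝ 2 (fderiv ℝ F) (x + t • u) := hF.fderiv_right (by norm_num)
  have h3 : ContDiffAt ℝ 1 (fderiv ℝ (fderiv ℝ F)) (x + t • u) := h2.fderiv_right (by norm_num)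
  have := (h3.differentiableAt (by norm_num)).hasFDerivAt.comp_hasDerivAt t
    (hasDerivAt_add_smul x u t)
  simpa [third] using (this.clm_apply (hasDerivAt_const t h)).clm_apply (hasDerivAt_const t k)

end Smooth

/-! ### Cubic forms -/

/-- A binary cubic form bounded by `1` on the unit circle: if `v`, `e` are orthonormal, its
coefficients are `T(v,v,v)`, `T(e,v,v)`, `T(e,e,v)`, `T(e,e,e)`. The bound for `T(u,v,v)`, where
`u` makes the angle `3α` with `v`, is an interpolation formula at the angles
`α`, `α + π/3`, `α + 2π/3`, whose weights `(3 - 4 sin²)²/9` add up to `1`. -/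
theorem cubic_mixed_le {a b d e : ℝ}
    (h : ∀ X Y : ℝ, X ^ 2 + Y ^ 2 = 1 →
      |X ^ 3 * a + 3 * X ^ 2 * Y * b + 3 * X * Y ^ 2 * d + Y ^ 3 * e| ≤ 1)
    {X Y : ℝ} (hXY : X ^ 2 + Y ^ 2 = 1) : X * a + Y * b ≤ 1 := by
  obtain ⟨α, hX, hY⟩ : ∃ α : ℝ, X = Real.cos (3 * α) ∧ Y = Real.sin (3 * α) := by
    have hn : ‖(⟨X, Y⟩ : ℂ)‖ = 1 := by
      rw [Complex.norm_def, Complex.normSq_mk]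
      rw [show X * X + Y * Y = 1 by nlinarith, Real.sqrt_one]
    refine ⟨Complex.arg ⟨X, Y⟩ / 3, ?_, ?_⟩
    · rw [show 3 * (Complex.arg ⟨X, Y⟩ / 3) = Complex.arg ⟨X, Y⟩ by ring]
      have := Complex.norm_mul_cos_arg (⟨X, Y⟩ : ℂ)
      rw [hn, one_mul] at this
      exact this.symm
    · rw [show 3 * (Complex.arg ⟨X, Y⟩ / 3) = Complex.arg ⟨X, Y⟩ by ring]
      have := Complex.norm_mul_sin_arg (⟨X, Y⟩ : ℂ)
      rw [hn, one_mul] at this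
      exact this.symm
  rw [Real.cos_three_mul] at hX
  rw [Real.sin_three_mul] at hY
  set C := Real.cos α
  set S := Real.sin α
  have hCS : C ^ 2 = 1 - S ^ 2 := by
    have := Real.sin_sq_add_cos_sq α
    linarith
  obtain ⟨q, hq⟩ : ∃ q : ℝ, q ^ 2 = 3 := ⟨Real.sqrt 3, by norm_num⟩
  obtain ⟨C1, hC1⟩ : ∃ C1, C1 = (C - q * S) / 2 := ⟨_, rfl⟩
  obtain ⟨S1, hS1⟩ : ∃ S1, S1 = (S + q * C) / 2 := ⟨_, rfl⟩
  obtain ⟨C2, hC2⟩ : ∃ C2, C2 = (-C - q * S) / 2 := ⟨_, rfl⟩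
  obtain ⟨S2, hS2⟩ : ∃ S2, S2 = (-S + q * C) / 2 := ⟨_, rfl⟩
  have h0 := abs_le.1 (h C S (by linarith))
  have h1 := abs_le.1 (h C1 S1 (by rw [hC1, hS1]; grind))
  have h2 := abs_le.1 (h C2 S2 (by rw [hC2, hS2]; grind))
  have key : X * a + Y * b =
      (3 - 4 * S ^ 2) ^ 2 / 9 *
        (C ^ 3 * a + 3 * C ^ 2 * S * b + 3 * C * S ^ 2 * d + S ^ 3 * e) -
      (3 - 4 * S1 ^ 2) ^ 2 / 9 *
        (C1 ^ 3 * a + 3 * C1 ^ 2 * S1 * b + 3 * C1 * S1 ^ 2 * d + S1 ^ 3 * e) +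
      (3 - 4 * S2 ^ 2) ^ 2 / 9 *
        (C2 ^ 3 * a + 3 * C2 ^ 2 * S2 * b + 3 * C2 * S2 ^ 2 * d + S2 ^ 3 * e) := by
    have ea : X = (3 - 4 * S ^ 2) ^ 2 / 9 * C ^ 3 - (3 - 4 * S1 ^ 2) ^ 2 / 9 * C1 ^ 3 +
        (3 - 4 * S2 ^ 2) ^ 2 / 9 * C2 ^ 3 := by
      grind
    have eb : Y = (3 - 4 * S ^ 2) ^ 2 / 9 * (3 * C ^ 2 * S) -
        (3 - 4 * S1 ^ 2) ^ 2 / 9 * (3 * C1 ^ 2 * S1) +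
        (3 - 4 * S2 ^ 2) ^ 2 / 9 * (3 * C2 ^ 2 * S2) := by
      grind
    have ed : 0 = (3 - 4 * S ^ 2) ^ 2 / 9 * (C * S ^ 2) -
        (3 - 4 * S1 ^ 2) ^ 2 / 9 * (C1 * S1 ^ 2) + (3 - 4 * S2 ^ 2) ^ 2 / 9 * (C2 * S2 ^ 2) := by
      grind
    have ee : 0 = (3 - 4 * S ^ 2) ^ 2 / 9 * S ^ 3 - (3 - 4 * S1 ^ 2) ^ 2 / 9 * S1 ^ 3 +
        (3 - 4 * S2 ^ 2) ^ 2 / 9 * S2 ^ 3 := by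
      grind
    linear_combination a * ea + b * eb + 3 * d * ed + e * ee
  have hw : (3 - 4 * S ^ 2) ^ 2 / 9 + (3 - 4 * S1 ^ 2) ^ 2 / 9 + (3 - 4 * S2 ^ 2) ^ 2 / 9 = 1 := by
    grind
  rw [key]
  have w0 : 0 ≤ (3 - 4 * S ^ 2) ^ 2 / 9 := by positivity
  have w1 : 0 ≤ (3 - 4 * S1 ^ 2) ^ 2 / 9 := by positivity
  have w2 : 0 ≤ (3 - 4 * S2 ^ 2) ^ 2 / 9 := by positivity
  have b0 := mul_le_mul_of_nonneg_left h0.2 w0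
  have b1 := mul_le_mul_of_nonneg_left h1.1 w1
  have b2 := mul_le_mul_of_nonneg_left h2.2 w2
  linarith

end Barrier

namespace Barrier

/-! ### The Hessian of a barrier on a bounded set -/

/-- A self-concordant barrier for a bounded convex set. -/
structure BoundedBarrier {n : ℕ} (Q : Set (Vec n)) (F : Vec n → ℝ) (ν : ℝ) : Prop
    extends IsSelfConcordantBarrier Q F ν where
  convex : Convex ℝ Q
  bounded : Bornology.IsBounded Q

variable {n : ℕ}

section Linear

variable (F : Vec n → ℝ) (x : Vec n)

theorem lnorm_nonneg (h : Vec n) : 0 ≤ lnorm F x h := Real.sqrt_nonneg _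

theorem hess_smul_self (a : ℝ) (h : Vec n) :
    ⟪hess F x (a • h), a • h⟫_ℝ = a ^ 2 * ⟪hess F x h, h⟫_ℝ := by
  rw [map_smul, inner_smul_left, inner_smul_right]; simp; ring

theorem lnorm_smul (a : ℝ) (h : Vec n) : lnorm F x (a • h) = |a| * lnorm F x h := by
  unfold lnorm
  rw [hess_smul_self, Real.sqrt_mul (sq_nonneg a), Real.sqrt_sq_eq_abs]

theorem dualNorm_nonneg (v : Vec n) : 0 ≤ dualNorm F x v := Real.sqrt_nonneg _

theorem dualNorm_smul (a : ℝ) (v : Vec n) : dualNorm F x (a • v) = |a| * dualNorm F x v := by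
  unfold dualNorm hessInv
  rw [map_smul, inner_smul_left, inner_smul_right, conj_trivial, ← mul_assoc,
    Real.sqrt_mul (mul_self_nonneg a), Real.sqrt_mul_self_eq_abs]

theorem dualNorm_zero : dualNorm F x 0 = 0 := by simp [dualNorm]

end Linear

/-- A ray that leaves an open set does so at a first point, which is a frontier point. -/
theorem exists_exit {U : Set (Vec n)} (hU : IsOpen U) {x u : Vec n} (hx : x ∈ U) {b : ℝ}
    (hb : 0 ≤ b) (hxb : x + b • u ∉ U) :
    ∃ T, 0 < T ∧ T ≤ b ∧ x + T • u ∉ U ∧ ∀ t, 0 ≤ t → t < T → x + t • u ∈ U := by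
  have hcont : Continuous (fun t : ℝ => x + t • u) := by fun_prop
  let S : Set ℝ := {t | 0 ≤ t ∧ x + t • u ∉ U}
  have hS : IsClosed S :=
    isClosed_Ici.inter ((hU.isClosed_compl).preimage hcont)
  have hSne : S.Nonempty := ⟨b, hb, hxb⟩
  have hbd : BddBelow S := ⟨0, fun t ht => ht.1⟩
  have hT : sInf S ∈ S := hS.csInf_mem hSne hbd
  refine ⟨sInf S, lt_of_le_of_ne hT.1 ?_, csInf_le hbd ⟨hb, hxb⟩, hT.2, ?_⟩
  · intro h0
    apply hT.2
    rw [← h0]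
    simpa using hx
  · intro t ht htT
    by_contra hcon
    exact absurd (csInf_le hbd ⟨ht, hcon⟩) (not_le.2 htT)

namespace BoundedBarrier

variable {Q : Set (Vec n)} {F : Vec n → ℝ} {ν : ℝ} (hB : BoundedBarrier Q F ν)
include hB

theorem contDiffAt {x : Vec n} (hx : x ∈ interior Q) : ContDiffAt ℝ 3 F x :=
  hB.contDiffOn.contDiffAt (isOpen_interior.mem_nhds hx)

/-- `D²F(x)[h,h] ≥ 0` and `DF(x)[h]² ≤ ν D²F(x)[h,h]`, by scaling `h` in the barrier inequality. -/
theorem quad_nonneg_and_sq_le {x : Vec n} (hx : x ∈ interior Q) (h : Vec n) :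
    0 ≤ ⟪hess F x h, h⟫_ℝ ∧ ⟪gradient F x, h⟫_ℝ ^ 2 ≤ ν * ⟪hess F x h, h⟫_ℝ := by
  have key : ∀ τ : ℝ, 0 ≤ ⟪hess F x h, h⟫_ℝ * (τ * τ) + (-2 * ⟪gradient F x, h⟫_ℝ) * τ + ν := by
    intro τ
    have := hB.barrier x hx (τ • h)
    rw [← inner_hess_eq_iteratedFDeriv, hess_smul_self, ← inner_gradient, inner_smul_right] at this
    nlinarith
  have h1 := discrim_le_zero key
  rw [discrim] at h1
  refine ⟨?_, by nlinarith⟩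
  by_contra hneg
  push Not at hneg
  have hν : 0 ≤ ν := by simpa using key 0
  set q := ⟪hess F x h, h⟫_ℝ
  have k1 := key ((ν + 1) / (-q) + 1)
  have k2 := key (-((ν + 1) / (-q) + 1))
  have hd : 0 ≤ (ν + 1) / (-q) := div_nonneg (by linarith) (by linarith)
  have hm : q * ((ν + 1) / (-q)) = -(ν + 1) := by
    have := hneg.ne
    field_simp
  nlinarith [mul_nonneg hd (neg_nonneg.2 hneg.le)]

theorem quad_nonneg {x : Vec n} (hx : x ∈ interior Q) (h : Vec n) : 0 ≤ ⟪hess F x h, h⟫_ℝ :=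
  (hB.quad_nonneg_and_sq_le hx h).1

theorem lnorm_sq {x : Vec n} (hx : x ∈ interior Q) (h : Vec n) :
    lnorm F x h ^ 2 = ⟪hess F x h, h⟫_ℝ := Real.sq_sqrt (hB.quad_nonneg hx h)

theorem nu_nonneg {x : Vec n} (hx : x ∈ interior Q) : 0 ≤ ν := by
  have := hB.barrier x hx 0
  rw [← inner_hess_eq_iteratedFDeriv] at this
  simpa using this

theorem abs_third_le {x : Vec n} (hx : x ∈ interior Q) (h : Vec n) :
    |third F x h h h| ≤ 2 * lnorm F x h ^ 3 := by
  rw [third_eq_iteratedFDeriv, lnorm, inner_hess_eq_iteratedFDeriv]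
  exact hB.self_concordant x hx h

/-- `F` is unbounded along a ray up to its exit from the interior. -/
theorem not_bounded_on_ray {x u : Vec n} {T : ℝ} (hT : 0 < T)
    (hin : ∀ t, 0 ≤ t → t < T → x + t • u ∈ interior Q) (hout : x + T • u ∉ interior Q) (M : ℝ) :
    ∃ t, 0 ≤ t ∧ t < T ∧ M < F (x + t • u) := by
  have hcont : Continuous (fun t : ℝ => x + t • u) := by fun_prop
  have htend : Filter.Tendsto (fun t : ℝ => x + t • u) (nhdsWithin T (Set.Ico 0 T))
      (nhdsWithin (x + T • u) (interior Q)) := by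
    refine tendsto_nhdsWithin_iff.2 ⟨hcont.continuousAt.tendsto.mono_left nhdsWithin_le_nhds, ?_⟩
    filter_upwards [self_mem_nhdsWithin] with t ht using hin t ht.1 ht.2
  have hne : (nhdsWithin T (Set.Ico 0 T)).NeBot := by
    rw [← mem_closure_iff_nhdsWithin_neBot, closure_Ico hT.ne]
    exact ⟨hT.le, le_rfl⟩
  have hfr : x + T • u ∈ frontier Q := by
    refine ⟨?_, hout⟩
    have : x + T • u ∈ closure (interior Q) := by
      rw [mem_closure_iff_nhdsWithin_neBot]
      exact htend.neBot
    exact closure_mono interior_subset this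
  have := ((hB.tendsto_frontier _ hfr).comp htend).eventually_gt_atTop M
  obtain ⟨t, ht, ht'⟩ := (this.and self_mem_nhdsWithin).exists
  exact ⟨t, ht'.1, ht'.2, ht⟩

theorem exists_notMem_ray (x : Vec n) {u : Vec n} (hu : u ≠ 0) :
    ∃ b : ℝ, 0 ≤ b ∧ x + b • u ∉ interior Q := by
  obtain ⟨R, hR⟩ := hB.bounded.subset_closedBall x
  have hu' : 0 < ‖u‖ := norm_pos_iff.2 hu
  refine ⟨(|R| + 1) / ‖u‖, by positivity, fun hmem => ?_⟩
  have := hR (interior_subset hmem)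
  rw [Metric.mem_closedBall, dist_eq_norm, add_sub_cancel_left, norm_smul, Real.norm_eq_abs,
    abs_of_nonneg (by positivity), div_mul_cancel₀ _ hu'.ne'] at this
  linarith [le_abs_self R]

/-- The Hessian is nondegenerate: a direction of zero curvature would stay one along its whole
ray, and `F` would be constant up to the boundary. -/
theorem quad_pos {x : Vec n} (hx : x ∈ interior Q) {u : Vec n} (hu : u ≠ 0) :
    0 < ⟪hess F x u, u⟫_ℝ := by
  refine lt_of_le_of_ne (hB.quad_nonneg hx u) fun h0 => ?_
  obtain ⟨b, hb, hxb⟩ := hB.exists_notMem_ray x hu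
  obtain ⟨T, hT, -, hout, hin⟩ := exists_exit isOpen_interior hx hb hxb
  have hzero : ∀ s, 0 ≤ s → s < T → ⟪hess F (x + s • u) u, u⟫_ℝ = 0 := by
    intro s hs hsT
    have hmem : ∀ t ∈ Set.Icc 0 s, x + t • u ∈ interior Q :=
      fun t ht => hin t ht.1 (lt_of_le_of_lt ht.2 hsT)
    have hd : ∀ t ∈ Set.Icc 0 s, HasDerivAt (fun t : ℝ => ⟪hess F (x + t • u) u, u⟫_ℝ)
        (third F (x + t • u) u u u) t :=
      fun t ht => hasDerivAt_hess_line (hB.contDiffAt (hmem t ht)) u u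
    obtain ⟨M, hM⟩ := (isCompact_Icc (a := (0 : ℝ)) (b := s)).bddAbove_image
      (f := fun t : ℝ => lnorm F (x + t • u) u)
      (fun t ht => ((hd t ht).continuousAt.sqrt).continuousWithinAt)
    -- on a compact piece `|q'| ≤ 2 M q`, so that `q exp(-2 M t)` decreases from `0`
    have := le_of_hasDerivAt_nonneg
      (f := fun t => -(⟪hess F (x + t • u) u, u⟫_ℝ * Real.exp (-(2 * M) * t)))
      (f' := fun t => -(third F (x + t • u) u u u * Real.exp (-(2 * M) * t) +
        ⟪hess F (x + t • u) u, u⟫_ℝ * (Real.exp (-(2 * M) * t) * (-(2 * M))))) hs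
      (fun t ht => ((hd t ht).mul
        (by simpa using ((hasDerivAt_id t).const_mul (-(2 * M))).exp)).neg)
      (fun t ht => by
        have h1 := (abs_le.1 (hB.abs_third_le (hmem t ht) u)).2
        have h2 : lnorm F (x + t • u) u ≤ M := hM (Set.mem_image_of_mem _ ht)
        have h3 := lnorm_nonneg F (x + t • u) u
        have h4 := hB.lnorm_sq (hmem t ht) u
        have h5 : lnorm F (x + t • u) u ^ 3 ≤ M * ⟪hess F (x + t • u) u, u⟫_ℝ := by
          rw [← h4, pow_succ, mul_comm]
          exact mul_le_mul_of_nonneg_right h2 (sq_nonneg _)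
        have h6 := Real.exp_pos (-(2 * M) * t)
        have h7 : third F (x + t • u) u u u ≤ 2 * (M * ⟪hess F (x + t • u) u, u⟫_ℝ) := by linarith
        nlinarith [mul_le_mul_of_nonneg_right h7 h6.le])
    simp only [zero_smul, add_zero, ← h0, zero_mul, neg_zero] at this
    have hpos := hB.quad_nonneg (hmem s ⟨hs, le_rfl⟩) u
    have hexp := Real.exp_pos (-(2 * M) * s)
    by_contra hne
    have : 0 < ⟪hess F (x + s • u) u, u⟫_ℝ := lt_of_le_of_ne hpos (Ne.symm hne)
    have := mul_pos this hexp
    linarith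
  -- zero curvature forces `DF[u] = 0`, because `DF[u]² ≤ ν D²F[u,u]`
  have hconst : ∀ s, 0 ≤ s → s < T → F (x + s • u) ≤ F x := by
    intro s hs hsT
    have := le_of_hasDerivAt_nonneg (f := fun t => -F (x + t • u)) (f' := fun _ => 0) hs
      (fun t ht => by
        have hmem := hin t ht.1 (lt_of_le_of_lt ht.2 hsT)
        have h1 := (hB.quad_nonneg_and_sq_le hmem u).2
        rw [hzero t ht.1 (lt_of_le_of_lt ht.2 hsT), mul_zero] at h1
        have h2 : ⟪gradient F (x + t • u), u⟫_ℝ = 0 := by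
          exact pow_eq_zero_iff (two_ne_zero) |>.1 (le_antisymm h1 (sq_nonneg _))
        have := (hasDerivAt_line (hB.contDiffAt hmem)).neg
        rwa [h2, neg_zero] at this) (fun _ _ => le_rfl)
    simpa using this
  obtain ⟨t, ht, htT, hlt⟩ := hB.not_bounded_on_ray hT hin hout (F x)
  exact absurd (hconst t ht htT) (not_le.2 hlt)

theorem lnorm_pos {x : Vec n} (hx : x ∈ interior Q) {u : Vec n} (hu : u ≠ 0) :
    0 < lnorm F x u := Real.sqrt_pos.2 (hB.quad_pos hx hu)

theorem hess_inner_sq_le {x : Vec n} (hx : x ∈ interior Q) (u v : Vec n) :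
    ⟪hess F x u, v⟫_ℝ ^ 2 ≤ ⟪hess F x u, u⟫_ℝ * ⟪hess F x v, v⟫_ℝ := by
  have key : ∀ τ : ℝ, 0 ≤ ⟪hess F x u, u⟫_ℝ * (τ * τ) + (2 * ⟪hess F x u, v⟫_ℝ) * τ +
      ⟪hess F x v, v⟫_ℝ := by
    intro τ
    have := hB.quad_nonneg hx (τ • u + v)
    rw [map_add, map_smul, inner_add_left, inner_add_right, inner_add_right, inner_smul_left,
      inner_smul_left, inner_smul_right, inner_smul_right,
      hess_symm (hB.contDiffAt hx) v u] at this
    simp only [conj_trivial] at this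
    linarith
  have := discrim_le_zero key
  rw [discrim] at this
  linarith

/-- The Cauchy-Schwarz inequality for the local inner product. -/
theorem hess_inner_le {x : Vec n} (hx : x ∈ interior Q) (u v : Vec n) :
    |⟪hess F x u, v⟫_ℝ| ≤ lnorm F x u * lnorm F x v := by
  refine abs_le_of_sq_le_sq ?_ (mul_nonneg (lnorm_nonneg _ _ _) (lnorm_nonneg _ _ _))
  rw [mul_pow, hB.lnorm_sq hx, hB.lnorm_sq hx]
  exact hB.hess_inner_sq_le hx u v

/-- `cubic_mixed_le` in the plane of two unit vectors of the local norm. -/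
theorem third_le_of_unit {x : Vec n} (hx : x ∈ interior Q) {u v : Vec n}
    (hu : ⟪hess F x u, u⟫_ℝ = 1) (hv : ⟪hess F x v, v⟫_ℝ = 1) : third F x u v v ≤ 2 := by
  have hC := hB.contDiffAt hx
  set c := ⟪hess F x u, v⟫_ℝ with hc
  have hcv : ⟪hess F x v, u⟫_ℝ = c := hess_symm hC v u
  have hquad : ∀ a b : ℝ, ⟪hess F x (a • u + b • v), a • u + b • v⟫_ℝ =
      a ^ 2 + 2 * a * b * c + b ^ 2 := by
    intro a b
    simp only [map_add, map_smul, inner_add_left, inner_add_right, inner_smul_left,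
      inner_smul_right, conj_trivial, hu, hv, hcv, ← hc]
    ring
  have hone : ∀ w : Vec n, ⟪hess F x w, w⟫_ℝ = 1 → |third F x w w w| ≤ 2 := by
    intro w hw
    have := hB.abs_third_le hx w
    rwa [lnorm, hw, Real.sqrt_one, one_pow, mul_one] at this
  have hc1 : c ^ 2 ≤ 1 := by
    have := hB.hess_inner_sq_le hx u v
    rwa [hu, hv, one_mul] at this
  -- equality in the Cauchy-Schwarz inequality: `u` and `v` are parallel
  rcases eq_or_lt_of_le hc1 with hceq | hclt
  · have huv : u = c • v := by
      by_contra hne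
      have hp := hB.quad_pos hx (sub_ne_zero.2 hne)
      have := hquad 1 (-c)
      rw [one_smul, neg_smul, ← sub_eq_add_neg] at this
      rw [this] at hp
      nlinarith
    have h1 : third F x u v v = c * third F x v v v := by
      rw [huv]; simp [third]
    have h2 : |third F x u v v| ≤ 2 := by
      rw [h1, abs_mul, show |c| = 1 by
        rw [← sq_eq_sq₀ (abs_nonneg c) zero_le_one, sq_abs, hceq, one_pow], one_mul]
      exact hone v hv
    exact (abs_le.1 h2).2
  · set s := Real.sqrt (1 - c ^ 2) with hs
    have hs0 : 0 < s := Real.sqrt_pos.2 (by linarith)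
    have hs2 : s ^ 2 = 1 - c ^ 2 := Real.sq_sqrt (by linarith)
    -- `e` completes `v` to an orthonormal basis of the plane of `u` and `v`
    set e : Vec n := s⁻¹ • u + (-(c * s⁻¹)) • v with he
    have hue : u = c • v + s • e := by
      rw [he, smul_add, smul_smul, smul_smul, mul_inv_cancel₀ hs0.ne', one_smul,
        show s * (-(c * s⁻¹)) = -c by field_simp, neg_smul]
      abel
    have hmain := cubic_mixed_le (a := third F x v v v / 2) (b := third F x e v v / 2)
      (d := third F x e e v / 2) (e := third F x e e e / 2) ?_ (X := c) (Y := s) (by linarith)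
    · have : third F x u v v = c * third F x v v v + s * third F x e v v := by
        conv_lhs => rw [hue]
        simp [third]
      linarith
    · intro X Y hXY
      have hw : ⟪hess F x (X • v + Y • e), X • v + Y • e⟫_ℝ = 1 := by
        have : X • v + Y • e = (Y * s⁻¹) • u + (X - Y * c * s⁻¹) • v := by
          rw [he, smul_add, smul_smul, smul_smul, sub_smul,
            show Y * -(c * s⁻¹) = -(Y * c * s⁻¹) by ring, neg_smul]
          abel
        rw [this, hquad]
        have h1 : s⁻¹ ^ 2 * (1 - c ^ 2) = 1 := by
          rw [← hs2]; field_simp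
        linear_combination Y ^ 2 * h1 + hXY
      have h3 := hone _ hw
      have hexp : third F x (X • v + Y • e) (X • v + Y • e) (X • v + Y • e) =
          X ^ 3 * third F x v v v + 3 * X ^ 2 * Y * third F x e v v +
            3 * X * Y ^ 2 * third F x e e v + Y ^ 3 * third F x e e e := by
        have s1 : third F x v e v = third F x e v v := third_symm_left hC v e v
        have s2 : third F x v v e = third F x e v v := by
          rw [third_symm_right hC, s1]
        have s3 : third F x e v e = third F x e e v := third_symm_right hC e v e
        have s4 : third F x v e e = third F x e e v := by
          rw [third_symm_left hC, s3]
        simp only [third] at s1 s2 s3 s4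
        simp only [third, map_add, map_smul, add_apply,
          smul_apply, smul_eq_mul, s1, s2, s3, s4]
        ring
      rw [hexp] at h3
      rw [abs_le] at h3 ⊢
      constructor <;> linarith [h3.1, h3.2]

/-- Polarized self-concordance: `|D³F(x)[u,h,h]| ≤ 2 ‖u‖_x ‖h‖_x²`. -/
theorem abs_third_mixed_le {x : Vec n} (hx : x ∈ interior Q) (u h : Vec n) :
    |third F x u h h| ≤ 2 * lnorm F x u * ⟪hess F x h, h⟫_ℝ := by
  have main : ∀ u : Vec n, third F x u h h ≤ 2 * lnorm F x u * ⟪hess F x h, h⟫_ℝ := by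
    intro u
    rcases eq_or_ne u 0 with rfl | hu
    · simp [third, lnorm]
    rcases eq_or_ne h 0 with rfl | hh
    · simp [third]
    have hpu := hB.lnorm_pos hx hu
    have hph := hB.lnorm_pos hx hh
    have hun : ∀ w : Vec n, 0 < lnorm F x w →
        ⟪hess F x ((lnorm F x w)⁻¹ • w), (lnorm F x w)⁻¹ • w⟫_ℝ = 1 := by
      intro w hw
      rw [hess_smul_self, ← hB.lnorm_sq hx, inv_pow, inv_mul_cancel₀ (by positivity)]
    have := hB.third_le_of_unit hx (hun u hpu) (hun h hph)
    have e1 : third F x ((lnorm F x u)⁻¹ • u) ((lnorm F x h)⁻¹ • h) ((lnorm F x h)⁻¹ • h) =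
        (lnorm F x u)⁻¹ * (lnorm F x h)⁻¹ ^ 2 * third F x u h h := by
      simp [third]; ring
    rw [e1] at this
    rw [← hB.lnorm_sq hx h]
    have h2 : third F x u h h = lnorm F x u * lnorm F x h ^ 2 *
        ((lnorm F x u)⁻¹ * (lnorm F x h)⁻¹ ^ 2 * third F x u h h) := by
      field_simp
    rw [h2]
    nlinarith [mul_pos hpu (pow_pos hph 2)]
  rw [abs_le]
  refine ⟨?_, main u⟩
  have := main (-u)
  have e1 : third F x (-u) h h = -third F x u h h := by simp [third]
  have e2 : lnorm F x (-u) = lnorm F x u := by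
    rw [← neg_one_smul ℝ u, lnorm_smul]; simp
  rw [e1, e2] at this
  linarith

end BoundedBarrier

end Barrier

namespace Barrier
namespace BoundedBarrier

variable {n : ℕ} {Q : Set (Vec n)} {F : Vec n → ℝ} {ν : ℝ} (hB : BoundedBarrier Q F ν)
include hB

/-! ### Local norms at neighbouring points -/

theorem convex_interior : Convex ℝ (interior Q) := hB.convex.interior

theorem add_smul_mem {x u : Vec n} (hx : x ∈ interior Q) (hxu : x + u ∈ interior Q) {t : ℝ}
    (ht0 : 0 ≤ t) (ht1 : t ≤ 1) : x + t • u ∈ interior Q :=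
  hB.convex_interior.add_smul_mem hx hxu ⟨ht0, ht1⟩

theorem exists_hasDerivAt_inv_lnorm {x u : Vec n} (hu : u ≠ 0) {t : ℝ}
    (hm : x + t • u ∈ interior Q) :
    ∃ f' : ℝ, HasDerivAt (fun t : ℝ => (lnorm F (x + t • u) u)⁻¹) f' t ∧ |f'| ≤ 1 := by
  refine ⟨_, ((hasDerivAt_hess_line (hB.contDiffAt hm) u u).sqrt (hB.quad_pos hm hu).ne').inv
    (hB.lnorm_pos hm hu).ne', ?_⟩
  change |-(third F (x + t • u) u u u / (2 * lnorm F (x + t • u) u)) /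
    lnorm F (x + t • u) u ^ 2| ≤ 1
  have h1 := hB.abs_third_le hm u
  have h2 := hB.lnorm_pos hm hu
  rw [abs_div, abs_neg, abs_div, abs_of_pos (by positivity : (0 : ℝ) < lnorm F (x + t • u) u ^ 2),
    abs_of_pos (by positivity : (0 : ℝ) < 2 * lnorm F (x + t • u) u), div_div,
    div_le_one (by positivity)]
  linarith

/-- Along a segment, `1/‖u‖_{x+tu}` is `1`-Lipschitz in `t`. -/
theorem abs_inv_lnorm_sub_le {x u : Vec n} (hu : u ≠ 0) {b : ℝ} (hb : 0 ≤ b)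
    (hin : ∀ t, 0 ≤ t → t ≤ b → x + t • u ∈ interior Q) :
    |(lnorm F (x + b • u) u)⁻¹ - (lnorm F x u)⁻¹| ≤ b := by
  choose! f' hd hb' using fun (t : ℝ) (ht : t ∈ Set.Icc 0 b) =>
    hB.exists_hasDerivAt_inv_lnorm (x := x) hu (hin t ht.1 ht.2)
  have h1 := sub_le_sub_of_hasDerivAt_le (g := fun t => t) (g' := fun _ => 1) hb hd
    (fun t _ => hasDerivAt_id t) (fun t ht => (abs_le.1 (hb' t ht)).2)
  have h2 := sub_le_sub_of_hasDerivAt_le (f := fun t => -t) (f' := fun _ => -1) hb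
    (fun t _ => (hasDerivAt_id t).neg) hd (fun t ht => (abs_le.1 (hb' t ht)).1)
  simp only [zero_smul, add_zero] at h1 h2
  rw [abs_le]
  constructor <;> linarith

theorem lnorm_line_le {x u : Vec n} {b : ℝ} (hb : 0 ≤ b)
    (hin : ∀ t, 0 ≤ t → t ≤ b → x + t • u ∈ interior Q) (hr : b * lnorm F x u < 1) :
    lnorm F (x + b • u) u ≤ lnorm F x u / (1 - b * lnorm F x u) := by
  rcases eq_or_ne u 0 with rfl | hu
  · simp [lnorm]
  have h := (abs_le.1 (hB.abs_inv_lnorm_sub_le hu hb hin)).1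
  have hx : x ∈ interior Q := by simpa using hin 0 le_rfl hb
  have p1 := hB.lnorm_pos (hin b hb le_rfl) hu
  have p0 := hB.lnorm_pos hx hu
  set r := lnorm F x u
  set s := lnorm F (x + b • u) u
  rw [le_div_iff₀ (by linarith)]
  have e1 : s * s⁻¹ = 1 := mul_inv_cancel₀ p1.ne'
  have e2 : r * r⁻¹ = 1 := mul_inv_cancel₀ p0.ne'
  have := mul_le_mul_of_nonneg_left h (mul_pos p0 p1).le
  have e3 : r * s * (s⁻¹ - r⁻¹) = r - s := by field_simp
  nlinarith

theorem le_lnorm_line {x u : Vec n} {b : ℝ} (hb : 0 ≤ b)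
    (hin : ∀ t, 0 ≤ t → t ≤ b → x + t • u ∈ interior Q) :
    lnorm F x u / (1 + b * lnorm F x u) ≤ lnorm F (x + b • u) u := by
  rcases eq_or_ne u 0 with rfl | hu
  · simp [lnorm]
  have h := (abs_le.1 (hB.abs_inv_lnorm_sub_le hu hb hin)).2
  have hx : x ∈ interior Q := by simpa using hin 0 le_rfl hb
  have p1 := hB.lnorm_pos (hin b hb le_rfl) hu
  have p0 := hB.lnorm_pos hx hu
  set r := lnorm F x u
  set s := lnorm F (x + b • u) u
  rw [div_le_iff₀ (by positivity)]
  have := mul_le_mul_of_nonneg_left h (mul_pos p0 p1).le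
  have e3 : r * s * (s⁻¹ - r⁻¹) = r - s := by field_simp
  nlinarith

/-- The Dikin ellipsoid lies in the domain: within it `F` cannot blow up. -/
theorem dikin {x u : Vec n} (hx : x ∈ interior Q) (hr : lnorm F x u < 1) :
    x + u ∈ interior Q := by
  by_contra hcon
  obtain ⟨T, hT, hT1, hout, hin⟩ := exists_exit (u := u) isOpen_interior hx zero_le_one
    (by simpa using hcon)
  set r := lnorm F x u with hrdef
  have r0 : 0 ≤ r := lnorm_nonneg _ _ _
  have hbound : ∀ s, 0 ≤ s → s < T →
      F (x + s • u) ≤ F x + (|⟪gradient F x, u⟫_ℝ| + (r / (1 - r)) ^ 2) := by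
    intro s hs hsT
    have hmem : ∀ t, 0 ≤ t → t ≤ s → x + t • u ∈ interior Q :=
      fun t h0 h1 => hin t h0 (lt_of_le_of_lt h1 hsT)
    have hq : ∀ t, 0 ≤ t → t ≤ s → ⟪hess F (x + t • u) u, u⟫_ℝ ≤ (r / (1 - r)) ^ 2 := by
      intro t h0 h1
      have htr : t * r ≤ r := by nlinarith
      have := hB.lnorm_line_le h0 (fun τ a b => hmem τ a (b.trans h1))
        (lt_of_le_of_lt htr hr)
      rw [← hB.lnorm_sq (hmem t h0 h1)]
      refine pow_le_pow_left₀ (lnorm_nonneg _ _ _) (this.trans ?_) 2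
      exact div_le_div_of_nonneg_left r0 (by linarith) (by linarith)
    have hg : ∀ t, 0 ≤ t → t ≤ s →
        ⟪gradient F (x + t • u), u⟫_ℝ ≤ |⟪gradient F x, u⟫_ℝ| + (r / (1 - r)) ^ 2 := by
      intro t h0 h1
      have := sub_le_sub_of_hasDerivAt_le (g := fun τ => (r / (1 - r)) ^ 2 * τ)
        (g' := fun _ => (r / (1 - r)) ^ 2) h0
        (fun τ hτ => hasDerivAt_gradient_line (hB.contDiffAt (hmem τ hτ.1 (hτ.2.trans h1))) u)
        (fun τ _ => by simpa using (hasDerivAt_id τ).const_mul ((r / (1 - r)) ^ 2))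
        (fun τ hτ => hq τ hτ.1 (hτ.2.trans h1))
      simp only [zero_smul, add_zero, mul_zero, sub_zero] at this
      have h3 := le_abs_self ⟪gradient F x, u⟫_ℝ
      have h4 : (r / (1 - r)) ^ 2 * t ≤ (r / (1 - r)) ^ 2 * 1 :=
        mul_le_mul_of_nonneg_left (by linarith) (sq_nonneg _)
      linarith
    set C := |⟪gradient F x, u⟫_ℝ| + (r / (1 - r)) ^ 2
    have hC : 0 ≤ C := by positivity
    have := sub_le_sub_of_hasDerivAt_le (g := fun τ => C * τ) (g' := fun _ => C) hs
      (fun τ hτ => hasDerivAt_line (hB.contDiffAt (hmem τ hτ.1 hτ.2)))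
      (fun τ _ => by simpa using (hasDerivAt_id τ).const_mul C)
      (fun τ hτ => hg τ hτ.1 hτ.2)
    simp only [zero_smul, add_zero, mul_zero, sub_zero] at this
    nlinarith
  obtain ⟨t, ht, htT, hlt⟩ := hB.not_bounded_on_ray hT hin hout
    (F x + (|⟪gradient F x, u⟫_ℝ| + (r / (1 - r)) ^ 2))
  exact absurd (hbound t ht htT) (not_le.2 hlt)

/-- Two-sided comparison of the quadratic forms of the Hessians at `x` and `x + t u`. -/
theorem quad_line {x u : Vec n} (hx : x ∈ interior Q) (hr : lnorm F x u < 1) (h : Vec n) {t : ℝ}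
    (ht0 : 0 ≤ t) (ht1 : t ≤ 1) :
    ⟪hess F (x + t • u) h, h⟫_ℝ * (1 - t * lnorm F x u) ^ 2 ≤ ⟪hess F x h, h⟫_ℝ ∧
    ⟪hess F x h, h⟫_ℝ * (1 - t * lnorm F x u) ^ 2 ≤ ⟪hess F (x + t • u) h, h⟫_ℝ := by
  set r := lnorm F x u with hrdef
  have r0 : 0 ≤ r := lnorm_nonneg _ _ _
  have hin : ∀ τ, 0 ≤ τ → τ ≤ t → x + τ • u ∈ interior Q :=
    fun τ h0 h1 => hB.add_smul_mem hx (hB.dikin hx hr) h0 (h1.trans ht1)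
  have hpos : ∀ τ ∈ Set.Icc 0 t, 0 < 1 - τ * r := by
    intro τ hτ
    have : τ * r ≤ r := by nlinarith [hτ.1, hτ.2]
    linarith
  have hd : ∀ τ ∈ Set.Icc 0 t, HasDerivAt (fun t : ℝ => ⟪hess F (x + t • u) h, h⟫_ℝ)
      (third F (x + τ • u) u h h) τ :=
    fun τ hτ => hasDerivAt_hess_line (hB.contDiffAt (hin τ hτ.1 hτ.2)) h h
  have hlin : ∀ τ : ℝ, HasDerivAt (fun τ => 1 - τ * r) (-r) τ := by
    intro τ
    simpa using ((hasDerivAt_id τ).mul_const r).const_sub 1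
  have hthird : ∀ τ ∈ Set.Icc 0 t, |third F (x + τ • u) u h h| * (1 - τ * r) ≤
      2 * r * ⟪hess F (x + τ • u) h, h⟫_ℝ := by
    intro τ hτ
    have hm := hin τ hτ.1 hτ.2
    have h1 := hB.abs_third_mixed_le hm u h
    have h2 := hB.lnorm_line_le hτ.1 (fun s a b => hin s a (b.trans hτ.2))
      (by linarith [hpos τ hτ])
    rw [le_div_iff₀ (hpos τ hτ)] at h2
    have h3 := hB.quad_nonneg hm h
    calc _ ≤ 2 * lnorm F (x + τ • u) u * ⟪hess F (x + τ • u) h, h⟫_ℝ * (1 - τ * r) :=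
          mul_le_mul_of_nonneg_right h1 (hpos τ hτ).le
      _ = 2 * (lnorm F (x + τ • u) u * (1 - τ * r)) * ⟪hess F (x + τ • u) h, h⟫_ℝ := by ring
      _ ≤ _ := by gcongr
  -- by `hthird`, `q(τ) (1 - τ r)²` decreases and `q(τ) / (1 - τ r)²` increases
  constructor
  · have := le_of_hasDerivAt_nonneg
      (f := fun τ => -(⟪hess F (x + τ • u) h, h⟫_ℝ * (1 - τ * r) ^ 2)) ht0
      (fun τ hτ => ((hd τ hτ).mul ((hlin τ).pow 2)).neg)
      (fun τ hτ => by
        have h1 := hthird τ hτ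
        have h2 := hpos τ hτ
        have h3 := le_abs_self (third F (x + τ • u) u h h)
        have h4 : third F (x + τ • u) u h h * (1 - τ * r) ≤
          2 * r * ⟪hess F (x + τ • u) h, h⟫_ℝ := le_trans (by gcongr) h1
        simp only [Nat.cast_ofNat, Nat.reduceSub, pow_one, Left.nonneg_neg_iff, Pi.pow_apply]
        nlinarith [mul_le_mul_of_nonneg_right h4 h2.le])
    simp only [zero_smul, add_zero, zero_mul, sub_zero, one_pow, mul_one] at this
    linarith
  · have := le_of_hasDerivAt_nonneg
      (f := fun τ => ⟪hess F (x + τ • u) h, h⟫_ℝ / (1 - τ * r) ^ 2) ht0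
      (fun τ hτ => ((hd τ hτ).div ((hlin τ).pow 2) (pow_pos (hpos τ hτ) 2).ne'))
      (fun τ hτ => by
        have h1 := hthird τ hτ
        have h2 := hpos τ hτ
        have h3 := neg_abs_le (third F (x + τ • u) u h h)
        have h4 : -(third F (x + τ • u) u h h) * (1 - τ * r) ≤
          2 * r * ⟪hess F (x + τ • u) h, h⟫_ℝ := le_trans (by gcongr; linarith) h1
        simp only [Nat.cast_ofNat, Nat.reduceSub, pow_one, Pi.pow_apply]
        refine div_nonneg ?_ (by positivity)
        nlinarith [mul_le_mul_of_nonneg_right h4 h2.le])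
    simp only [zero_smul, add_zero, zero_mul, sub_zero, one_pow, div_one] at this
    rwa [le_div_iff₀ (pow_pos (hpos t ⟨ht0, le_rfl⟩) 2)] at this

theorem lnorm_add_le {x u : Vec n} (hx : x ∈ interior Q) (hr : lnorm F x u < 1) (h : Vec n) :
    lnorm F (x + u) h * (1 - lnorm F x u) ≤ lnorm F x h := by
  have h1 := (hB.quad_line hx hr h zero_le_one le_rfl).1
  rw [one_smul, one_mul] at h1
  have h0 : 0 ≤ 1 - lnorm F x u := by linarith
  refine (abs_le_of_sq_le_sq' ?_ (lnorm_nonneg _ _ _)).2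
  rw [mul_pow, hB.lnorm_sq hx, hB.lnorm_sq (hB.dikin hx hr)]
  exact h1

theorem le_lnorm_add {x u : Vec n} (hx : x ∈ interior Q) (hr : lnorm F x u < 1) (h : Vec n) :
    lnorm F x h * (1 - lnorm F x u) ≤ lnorm F (x + u) h := by
  have h1 := (hB.quad_line hx hr h zero_le_one le_rfl).2
  rw [one_smul, one_mul] at h1
  refine (abs_le_of_sq_le_sq' ?_ (lnorm_nonneg _ _ _)).2
  rw [mul_pow, hB.lnorm_sq hx, hB.lnorm_sq (hB.dikin hx hr)]
  exact h1

/-! ### Dual local norms -/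

theorem hess_isInvertible {x : Vec n} (hx : x ∈ interior Q) : (hess F x).IsInvertible := by
  have hinj : Function.Injective (hess F x).toLinearMap := by
    rw [← LinearMap.ker_eq_bot, LinearMap.ker_eq_bot']
    intro u hu
    by_contra hne
    have := hB.quad_pos hx hne
    rw [show hess F x u = 0 from hu, inner_zero_left] at this
    exact lt_irrefl _ this
  refine ⟨(LinearEquiv.ofInjectiveEndo _ hinj).toContinuousLinearEquiv, ?_⟩
  ext u
  rfl

theorem hess_hessInv {x : Vec n} (hx : x ∈ interior Q) (v : Vec n) :
    hess F x (hessInv F x v) = v :=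
  ((hB.hess_isInvertible hx).inverse_apply_eq.1 rfl).symm

theorem lnorm_hessInv {x : Vec n} (hx : x ∈ interior Q) (v : Vec n) :
    lnorm F x (hessInv F x v) = dualNorm F x v := by
  rw [lnorm, dualNorm, hB.hess_hessInv hx]

theorem dualNorm_sq {x : Vec n} (hx : x ∈ interior Q) (v : Vec n) :
    dualNorm F x v ^ 2 = ⟪v, hessInv F x v⟫_ℝ := by
  rw [← hB.lnorm_hessInv hx, hB.lnorm_sq hx, hB.hess_hessInv hx]

theorem inner_le_dualNorm {x : Vec n} (hx : x ∈ interior Q) (v h : Vec n) :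
    |⟪v, h⟫_ℝ| ≤ dualNorm F x v * lnorm F x h := by
  have := hB.hess_inner_le hx (hessInv F x v) h
  rwa [hB.hess_hessInv hx, hB.lnorm_hessInv hx] at this

theorem dualNorm_le_of_inner_le {x : Vec n} (hx : x ∈ interior Q) {v : Vec n} {K : ℝ}
    (hK : 0 ≤ K) (h : ∀ h, ⟪v, h⟫_ℝ ≤ K * lnorm F x h) : dualNorm F x v ≤ K := by
  have h1 := h (hessInv F x v)
  rw [← hB.dualNorm_sq hx, hB.lnorm_hessInv hx] at h1
  have h0 := dualNorm_nonneg F x v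
  by_contra hcon
  push Not at hcon
  nlinarith

theorem dualNorm_add_le {x : Vec n} (hx : x ∈ interior Q) (v w : Vec n) :
    dualNorm F x (v + w) ≤ dualNorm F x v + dualNorm F x w := by
  refine hB.dualNorm_le_of_inner_le hx
    (add_nonneg (dualNorm_nonneg F x v) (dualNorm_nonneg F x w)) fun h => ?_
  rw [inner_add_left, add_mul]
  exact add_le_add ((le_abs_self _).trans (hB.inner_le_dualNorm hx v h))
    ((le_abs_self _).trans (hB.inner_le_dualNorm hx w h))

theorem dualNorm_pos {x : Vec n} (hx : x ∈ interior Q) {v : Vec n} (hv : v ≠ 0) :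
    0 < dualNorm F x v := by
  refine lt_of_le_of_ne (dualNorm_nonneg F x v) fun h0 => hv ?_
  have := hB.inner_le_dualNorm hx v v
  rw [← h0, zero_mul] at this
  exact inner_self_eq_zero.1 (abs_nonpos_iff.1 this)

theorem dualNorm_le_of_lnorm_le {x y : Vec n} (hx : x ∈ interior Q) (hy : y ∈ interior Q) {K : ℝ}
    (hK : 0 ≤ K) (h : ∀ h, lnorm F y h ≤ K * lnorm F x h) (v : Vec n) :
    dualNorm F x v ≤ K * dualNorm F y v := by
  have h0 := dualNorm_nonneg F y v
  refine hB.dualNorm_le_of_inner_le hx (mul_nonneg hK h0) fun k => ?_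
  calc ⟪v, k⟫_ℝ ≤ dualNorm F y v * lnorm F y k :=
        (le_abs_self _).trans (hB.inner_le_dualNorm hy v k)
    _ ≤ dualNorm F y v * (K * lnorm F x k) := by gcongr; exact h k
    _ = _ := by ring

theorem dualNorm_le_add {x u : Vec n} (hx : x ∈ interior Q) (hr : lnorm F x u < 1) (v : Vec n) :
    dualNorm F x v * (1 - lnorm F x u) ≤ dualNorm F (x + u) v := by
  have h0 : 0 < 1 - lnorm F x u := by linarith
  have := hB.dualNorm_le_of_lnorm_le hx (hB.dikin hx hr) (K := (1 - lnorm F x u)⁻¹)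
    (by positivity) (fun h => by
      rw [inv_mul_eq_div, le_div_iff₀ h0]; exact hB.lnorm_add_le hx hr h) v
  rwa [inv_mul_eq_div, le_div_iff₀ h0] at this

theorem dualNorm_add_point_le {x u : Vec n} (hx : x ∈ interior Q) (hr : lnorm F x u < 1)
    (v : Vec n) : dualNorm F (x + u) v * (1 - lnorm F x u) ≤ dualNorm F x v := by
  have h0 : 0 < 1 - lnorm F x u := by linarith
  have := hB.dualNorm_le_of_lnorm_le (hB.dikin hx hr) hx (K := (1 - lnorm F x u)⁻¹)
    (by positivity) (fun h => by
      rw [inv_mul_eq_div, le_div_iff₀ h0]; exact hB.le_lnorm_add hx hr h) v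
  rwa [inv_mul_eq_div, le_div_iff₀ h0] at this

theorem dualNorm_gradient_le {x : Vec n} (hx : x ∈ interior Q) :
    dualNorm F x (gradient F x) ≤ Real.sqrt ν := by
  have h1 := (hB.quad_nonneg_and_sq_le hx (hessInv F x (gradient F x))).2
  rw [hB.hess_hessInv hx, ← hB.dualNorm_sq hx] at h1
  have h0 := dualNorm_nonneg F x (gradient F x)
  refine Real.le_sqrt_of_sq_le ?_
  by_contra hcon
  push Not at hcon
  have : 0 ≤ ν := hB.nu_nonneg hx
  nlinarith

end BoundedBarrier
end Barrier

namespace Barrier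
namespace BoundedBarrier

variable {n : ℕ} {Q : Set (Vec n)} {F : Vec n → ℝ} {ν : ℝ} (hB : BoundedBarrier Q F ν)
include hB

/-! ### Newton steps -/

theorem hess_newtonDir {x : Vec n} (hx : x ∈ interior Q) (d : Vec n) (t : ℝ) :
    hess F x (newtonDir F d t x) = -(t • d + gradient F x) := by
  rw [newtonDir, map_neg, hB.hess_hessInv hx]

theorem lnorm_newtonDir {x : Vec n} (hx : x ∈ interior Q) (d : Vec n) (t : ℝ) :
    lnorm F x (newtonDir F d t x) = dualNorm F x (t • d + gradient F x) := by
  rw [newtonDir, ← neg_one_smul ℝ, lnorm_smul, hB.lnorm_hessInv hx]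
  simp

theorem inner_newtonDir {x : Vec n} (hx : x ∈ interior Q) (d : Vec n) (t : ℝ) :
    ⟪t • d + gradient F x, newtonDir F d t x⟫_ℝ =
      -dualNorm F x (t • d + gradient F x) ^ 2 := by
  rw [hB.dualNorm_sq hx, newtonDir, inner_neg_right]

/-- The Hessian changes by the relative amount `1/(1-t‖u‖_x)² - 1` at most. -/
theorem abs_hess_sub_le {x u : Vec n} (hx : x ∈ interior Q) (hr : lnorm F x u < 1) {t : ℝ}
    (ht0 : 0 ≤ t) (ht1 : t ≤ 1) (v h : Vec n) :
    |⟪hess F (x + t • u) v, h⟫_ℝ - ⟪hess F x v, h⟫_ℝ| ≤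
      (((1 - t * lnorm F x u) ^ 2)⁻¹ - 1) * (lnorm F x v * lnorm F x h) := by
  set r := lnorm F x u
  have r0 : 0 ≤ r := lnorm_nonneg _ _ _
  have htr0 : 0 ≤ t * r := mul_nonneg ht0 r0
  have htr : t * r < 1 := by nlinarith
  set p := (1 - t * r) ^ 2 with hp
  have hp0 : 0 < p := pow_pos (by linarith) 2
  have hp1 : p ≤ 1 := by rw [hp]; nlinarith
  have hK : 0 ≤ p⁻¹ - 1 := by
    have := (one_le_inv₀ hp0).2 hp1
    linarith
  have hmem := hB.add_smul_mem hx (hB.dikin hx hr) ht0 ht1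
  have diag : ∀ w : Vec n, |⟪hess F (x + t • u) w, w⟫_ℝ - ⟪hess F x w, w⟫_ℝ| ≤
      (p⁻¹ - 1) * ⟪hess F x w, w⟫_ℝ := by
    intro w
    obtain ⟨h1, h2⟩ := hB.quad_line hx hr w ht0 ht1
    rw [← le_div_iff₀ hp0, div_eq_mul_inv] at h1
    have h0 := hB.quad_nonneg hx w
    have h3 : 2 - p ≤ p⁻¹ := by
      rw [← one_div, le_div_iff₀ hp0]; nlinarith [sq_nonneg (1 - p)]
    rw [abs_le]
    constructor <;> nlinarith
  -- polarization, optimized over the scaling of `v`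
  have key : ∀ τ : ℝ, 0 ≤ ((p⁻¹ - 1) * ⟪hess F x v, v⟫_ℝ) * (τ * τ) +
      (2 * (⟪hess F (x + t • u) v, h⟫_ℝ - ⟪hess F x v, h⟫_ℝ)) * τ +
      (p⁻¹ - 1) * ⟪hess F x h, h⟫_ℝ := by
    intro τ
    have e : ∀ (y : Vec n), y ∈ interior Q → ∀ a : ℝ, ⟪hess F y (a • v + h), a • v + h⟫_ℝ =
        a ^ 2 * ⟪hess F y v, v⟫_ℝ + 2 * a * ⟪hess F y v, h⟫_ℝ + ⟪hess F y h, h⟫_ℝ := by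
      intro y hy a
      rw [map_add, map_smul, inner_add_left, inner_add_right, inner_add_right, inner_smul_left,
        inner_smul_left, inner_smul_right, inner_smul_right,
        hess_symm (hB.contDiffAt hy) h v, conj_trivial]
      ring
    have d1 := diag (τ • v + h)
    have d2 := diag ((-τ) • v + h)
    rw [e _ hmem, e _ hx] at d1 d2
    nlinarith [(abs_le.1 d1).1, (abs_le.1 d2).2]
  have hd := discrim_le_zero key
  rw [discrim] at hd
  refine abs_le_of_sq_le_sq ?_
    (mul_nonneg hK (mul_nonneg (lnorm_nonneg _ _ _) (lnorm_nonneg _ _ _)))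
  rw [mul_pow, mul_pow, hB.lnorm_sq hx, hB.lnorm_sq hx]
  linarith

/-- Quadratic convergence of Newton's method: a full step from Newton decrement `δ < 1` leads to
decrement at most `(δ / (1 - δ))²`. -/
theorem newton_decrement {x : Vec n} (hx : x ∈ interior Q) {d : Vec n} {t : ℝ}
    (hδ : dualNorm F x (t • d + gradient F x) < 1) :
    dualNorm F (x + newtonDir F d t x) (t • d + gradient F (x + newtonDir F d t x)) ≤
      (dualNorm F x (t • d + gradient F x) / (1 - dualNorm F x (t • d + gradient F x))) ^ 2 := by
  have hu := hB.lnorm_newtonDir hx d t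
  set u := newtonDir F d t x with hudef
  rw [← hu] at hδ ⊢
  set δ := lnorm F x u with hδdef
  have δ0 : 0 ≤ δ := lnorm_nonneg _ _ _
  have h1δ : 0 < 1 - δ := by linarith
  have hmem : x + u ∈ interior Q := hB.dikin hx hδ
  refine hB.dualNorm_le_of_inner_le hmem (sq_nonneg _) fun h => ?_
  have hN := lnorm_nonneg F x h
  have hcmp := hB.le_lnorm_add hx hδ h
  have hpos : ∀ τ ∈ Set.Icc (0 : ℝ) 1, 0 < 1 - τ * δ := by
    intro τ hτ
    nlinarith [hτ.1, hτ.2]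
  have hlin : ∀ τ : ℝ, HasDerivAt (fun τ => 1 - τ * δ) (-δ) τ := by
    intro τ
    simpa using ((hasDerivAt_id τ).mul_const δ).const_sub 1
  -- the gradient minus its linearization at `x` grows at most like `δ² τ² / (1 - τ δ)`
  have main := sub_le_sub_of_hasDerivAt_le
    (f := fun τ : ℝ => ⟪gradient F (x + τ • u), h⟫_ℝ)
    (g := fun τ => τ * ⟪hess F x u, h⟫_ℝ + lnorm F x h * δ ^ 2 * (τ ^ 2 / (1 - τ * δ)))
    (g' := fun τ => ⟪hess F x u, h⟫_ℝ + lnorm F x h * δ ^ 2 *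
      ((2 * τ * (1 - τ * δ) - τ ^ 2 * (-δ)) / (1 - τ * δ) ^ 2))
    zero_le_one
    (fun τ hτ => hasDerivAt_gradient_line
      (hB.contDiffAt (hB.add_smul_mem hx hmem hτ.1 hτ.2)) h)
    (fun τ hτ => by
      have h1 : HasDerivAt (fun τ : ℝ => τ * ⟪hess F x u, h⟫_ℝ) ⟪hess F x u, h⟫_ℝ τ := by
        simpa using (hasDerivAt_id τ).mul_const ⟪hess F x u, h⟫_ℝ
      have h2 : HasDerivAt (fun τ : ℝ => τ ^ 2) (2 * τ) τ := by simpa using hasDerivAt_pow 2 τ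
      exact h1.add ((h2.div (hlin τ) (hpos τ hτ).ne').const_mul (lnorm F x h * δ ^ 2)))
    (fun τ hτ => by
      have h1 := (abs_le.1 (hB.abs_hess_sub_le hx hδ hτ.1 hτ.2 u h)).2
      have hp := hpos τ hτ
      have e : (((1 - τ * δ) ^ 2)⁻¹ - 1) * (δ * lnorm F x h) =
          lnorm F x h * δ ^ 2 *
            ((2 * τ * (1 - τ * δ) - τ ^ 2 * (-δ)) / (1 - τ * δ) ^ 2) := by
        have := hp.ne'
        field_simp
        ring
      rw [← hδdef] at h1
      rw [← e]
      linarith)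
  simp only [one_smul, zero_smul, add_zero, one_mul, one_pow, zero_mul, ne_eq, OfNat.ofNat_ne_zero,
    not_false_eq_true, zero_pow, sub_zero, div_one, mul_zero] at main
  rw [hB.hess_newtonDir hx, inner_neg_left, inner_add_left] at main
  rw [inner_add_left]
  have h2 : lnorm F x h ≤ lnorm F (x + u) h / (1 - δ) := by
    rw [le_div_iff₀ h1δ]; exact hcmp
  calc ⟪t • d, h⟫_ℝ + ⟪gradient F (x + u), h⟫_ℝ ≤ lnorm F x h * δ ^ 2 * (1 / (1 - δ)) := by
        linarith
    _ ≤ lnorm F (x + u) h / (1 - δ) * δ ^ 2 * (1 / (1 - δ)) := by gcongr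
    _ = (δ / (1 - δ)) ^ 2 * lnorm F (x + u) h := by field_simp

/-! ### The line search -/

/-- A step of length `r δ ≤ 0.36` in the local norm passes the test of the line search. On such a
step the curvature integrates to at most `δ² r² / (2 · 0.64)`, so at least `0.21` of the predicted
decrease `r δ²` remains. -/
theorem armijo {x : Vec n} (hx : x ∈ interior Q) {d : Vec n} {t r : ℝ} (hr0 : 0 ≤ r) (hr1 : r ≤ 1)
    (hδ : r * dualNorm F x (t • d + gradient F x) ≤ 0.36) :
    x + r • newtonDir F d t x ∈ interior Q ∧
    t * ⟪d, x + r • newtonDir F d t x⟫_ℝ + F (x + r • newtonDir F d t x) ≤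
      t * ⟪d, x⟫_ℝ + F x + 0.01 * r * ⟪t • d + gradient F x, newtonDir F d t x⟫_ℝ := by
  rw [hB.inner_newtonDir hx]
  have hg : ⟪t • d + gradient F x, newtonDir F d t x⟫_ℝ = _ := hB.inner_newtonDir hx d t
  have hu := hB.lnorm_newtonDir hx d t
  set u := newtonDir F d t x
  set δ := dualNorm F x (t • d + gradient F x)
  have δ0 : 0 ≤ δ := dualNorm_nonneg _ _ _
  have hmem : ∀ τ, 0 ≤ τ → τ ≤ r → x + τ • u ∈ interior Q := by
    intro τ h0 h1
    refine hB.dikin hx ?_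
    rw [lnorm_smul, hu, abs_of_nonneg h0]
    nlinarith
  refine ⟨hmem r hr0 le_rfl, ?_⟩
  have hlin : ∀ τ : ℝ, HasDerivAt (fun τ => 1 - τ * δ) (-δ) τ := by
    intro τ
    simpa using ((hasDerivAt_id τ).mul_const δ).const_sub 1
  have hpos : ∀ τ, τ ≤ r → 0.64 ≤ 1 - τ * δ := by
    intro τ h1
    nlinarith
  have hgrad : ∀ τ, 0 ≤ τ → τ ≤ r →
      ⟪gradient F (x + τ • u), u⟫_ℝ ≤ ⟪gradient F x, u⟫_ℝ + δ ^ 2 / 0.64 * τ := by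
    intro τ h0 h1
    have := sub_le_sub_of_hasDerivAt_le
      (f := fun s : ℝ => ⟪gradient F (x + s • u), u⟫_ℝ)
      (g := fun s => δ ^ 2 * (s / (1 - s * δ)))
      (g' := fun s => δ ^ 2 * ((1 * (1 - s * δ) - s * (-δ)) / (1 - s * δ) ^ 2)) h0
      (fun s hs => hasDerivAt_gradient_line
        (hB.contDiffAt (hmem s hs.1 (hs.2.trans h1))) u)
      (fun s hs => ((hasDerivAt_id s).div (hlin s)
        (by linarith [hpos s (hs.2.trans h1)] : (0 : ℝ) < 1 - s * δ).ne').const_mul _)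
      (fun s hs => by
        have hp := hpos s (hs.2.trans h1)
        have h2 := hB.lnorm_line_le hs.1 (fun τ a b => hmem τ a (b.trans (hs.2.trans h1)))
          (by rw [hu]; linarith)
        rw [← hB.lnorm_sq (hmem s hs.1 (hs.2.trans h1))]
        rw [hu] at h2
        refine (pow_le_pow_left₀ (lnorm_nonneg _ _ _) h2 2).trans (le_of_eq ?_)
        rw [div_pow, show 1 * (1 - s * δ) - s * (-δ) = 1 by ring, mul_one_div])
    simp only [zero_smul, add_zero, zero_mul, sub_zero, zero_div, mul_zero] at this
    have h3 : τ / (1 - τ * δ) ≤ τ / 0.64 :=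
      div_le_div_of_nonneg_left h0 (by norm_num) (hpos τ h1)
    have h4 := mul_le_mul_of_nonneg_left h3 (sq_nonneg δ)
    have h5 : δ ^ 2 * (τ / 0.64) = δ ^ 2 / 0.64 * τ := by ring
    linarith
  have main := sub_le_sub_of_hasDerivAt_le
    (f := fun s : ℝ => F (x + s • u))
    (g := fun s => s * ⟪gradient F x, u⟫_ℝ + δ ^ 2 / 0.64 / 2 * s ^ 2)
    (g' := fun s => ⟪gradient F x, u⟫_ℝ + δ ^ 2 / 0.64 / 2 * (2 * s)) hr0
    (fun s hs => hasDerivAt_line (hB.contDiffAt (hmem s hs.1 hs.2)))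
    (fun s _ => by
      have h1 : HasDerivAt (fun s : ℝ => s * ⟪gradient F x, u⟫_ℝ) ⟪gradient F x, u⟫_ℝ s := by
        simpa using (hasDerivAt_id s).mul_const ⟪gradient F x, u⟫_ℝ
      have h2 : HasDerivAt (fun s : ℝ => s ^ 2) (2 * s) s := by simpa using hasDerivAt_pow 2 s
      exact h1.add (h2.const_mul _))
    (fun s hs => by
      have := hgrad s hs.1 hs.2
      linarith)
  simp only [zero_smul, add_zero, zero_mul, sub_zero, ne_eq, OfNat.ofNat_ne_zero,
    not_false_eq_true, zero_pow, mul_zero] at main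
  rw [inner_add_left, inner_smul_left, conj_trivial] at hg
  rw [inner_add_right, inner_smul_right]
  have hr2 : r ^ 2 * δ ^ 2 ≤ r * δ ^ 2 := by
    have : r ^ 2 ≤ r := by nlinarith
    exact mul_le_mul_of_nonneg_right this (sq_nonneg _)
  have hrd : 0 ≤ r * δ ^ 2 := by positivity
  have e1 : r * (t * ⟪d, u⟫_ℝ + ⟪gradient F x, u⟫_ℝ) = -(r * δ ^ 2) := by rw [hg]; ring
  have e2 : δ ^ 2 / 0.64 / 2 * r ^ 2 = 0.78125 * (r ^ 2 * δ ^ 2) := by ring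
  rw [e2] at main
  linarith

/-- The line search succeeds, so a damped Newton step stays in the domain. -/
theorem dampedNewton_mem {x : Vec n} (hx : x ∈ interior Q) (d : Vec n) (t : ℝ) :
    dampedNewton Q F d t x ∈ interior Q := by
  obtain ⟨j, hj⟩ : ∃ j : ℕ, (1 / 4 : ℝ) ^ j * dualNorm F x (t • d + gradient F x) ≤ 0.36 := by
    obtain ⟨j, hj⟩ := exists_pow_lt_of_lt_one
      (show 0 < 0.36 / (dualNorm F x (t • d + gradient F x) + 1) by
        have := dualNorm_nonneg F x (t • d + gradient F x)
        positivity) (show (1 / 4 : ℝ) < 1 by norm_num)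
    refine ⟨j, ?_⟩
    have h0 := dualNorm_nonneg F x (t • d + gradient F x)
    rw [lt_div_iff₀ (by linarith)] at hj
    have : 0 < (1 / 4 : ℝ) ^ j := by positivity
    nlinarith
  have hne : {j : ℕ | x + (1 / 4 : ℝ) ^ j • newtonDir F d t x ∈ interior Q ∧
      t * ⟪d, x + (1 / 4 : ℝ) ^ j • newtonDir F d t x⟫_ℝ +
        F (x + (1 / 4 : ℝ) ^ j • newtonDir F d t x) ≤
      t * ⟪d, x⟫_ℝ + F x +
        0.01 * (1 / 4 : ℝ) ^ j * ⟪t • d + gradient F x, newtonDir F d t x⟫_ℝ}.Nonempty :=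
    ⟨j, hB.armijo hx (by positivity) (pow_le_one₀ (by norm_num) (by norm_num)) hj⟩
  exact (Nat.sInf_mem hne).1

/-- For a decrement of at most `0.36` the line search takes the full Newton step. -/
theorem dampedNewton_eq {x : Vec n} (hx : x ∈ interior Q) {d : Vec n} {t : ℝ}
    (hδ : dualNorm F x (t • d + gradient F x) ≤ 0.36) :
    dampedNewton Q F d t x = x + newtonDir F d t x := by
  have h0 := hB.armijo hx zero_le_one le_rfl (by rwa [one_mul])
  have hr : lineSearch Q F d t x = 1 := by
    unfold lineSearch
    simp only
    rw [Nat.sInf_eq_zero.2 (Or.inl ?_), pow_zero]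
    simpa using h0
  rw [dampedNewton, hr, one_smul]

/-! ### Centers -/

/-- The penalized barrier `t dᵀx + F(x)` has a stationary point: a minimizer, which exists because
`F` tends to infinity at the frontier of the bounded set `Q`. -/
theorem exists_center (hne : (interior Q).Nonempty) (d : Vec n) (t : ℝ) :
    ∃ z ∈ interior Q, t • d + gradient F z = 0 := by
  obtain ⟨x₀, hx₀⟩ := hne
  set f : Vec n → ℝ := fun x => ⟪t • d, x⟫_ℝ + F x with hf
  have hfc : ∀ x ∈ interior Q, ContinuousAt f x := fun x hx =>
    (continuous_const.inner continuous_id).continuousAt.add (hB.contDiffAt hx).continuousAt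
  let S : Set (Vec n) := {x | x ∈ interior Q ∧ f x ≤ f x₀}
  have hSc : IsClosed S := by
    refine isClosed_of_closure_subset fun y hy => ?_
    have hyQ : y ∈ closure Q :=
      closure_mono (fun x hx => interior_subset hx.1) hy
    have hnb : (nhdsWithin y S).NeBot := mem_closure_iff_nhdsWithin_neBot.1 hy
    by_cases hyi : y ∈ interior Q
    · refine ⟨hyi, ?_⟩
      have ht : Filter.Tendsto f (nhdsWithin y S) (nhds (f y)) :=
        (hfc y hyi).tendsto.mono_left nhdsWithin_le_nhds
      exact le_of_tendsto ht (by filter_upwards [self_mem_nhdsWithin] with x hx using hx.2)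
    · exfalso
      have hle : nhdsWithin y S ≤ nhdsWithin y (interior Q) :=
        nhdsWithin_mono y fun x hx => hx.1
      have h1 : Filter.Tendsto f (nhdsWithin y S) Filter.atTop := by
        have hlin : Filter.Tendsto (fun x : Vec n => ⟪t • d, x⟫_ℝ) (nhdsWithin y S)
            (nhds ⟪t • d, y⟫_ℝ) :=
          ((continuous_const.inner continuous_id).tendsto y).mono_left nhdsWithin_le_nhds
        exact hlin.add_atTop ((hB.tendsto_frontier y ⟨hyQ, hyi⟩).mono_left hle)
      obtain ⟨x, hx, hxS⟩ := ((h1.eventually_gt_atTop (f x₀)).and self_mem_nhdsWithin).exists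
      exact absurd hxS.2 (not_le.2 hx)
  have hScomp : IsCompact S := Metric.isCompact_of_isClosed_isBounded hSc
    (hB.bounded.subset fun x hx => interior_subset hx.1)
  obtain ⟨z, hzS, hz⟩ := hScomp.exists_isMinOn ⟨x₀, hx₀, le_rfl⟩
    (fun x hx => (hfc x hx.1).continuousWithinAt)
  refine ⟨z, hzS.1, ?_⟩
  have hmin : IsLocalMin f z := by
    filter_upwards [isOpen_interior.mem_nhds hzS.1] with x hx
    by_cases hxS : f x ≤ f x₀
    · exact hz ⟨hx, hxS⟩
    · exact hzS.2.trans (not_le.1 hxS).le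
  have hdF := ((hB.contDiffAt hzS.1).differentiableAt (by norm_num)).hasFDerivAt
  have hd : HasFDerivAt f (innerSL ℝ (t • d) + fderiv ℝ F z) z :=
    ((innerSL ℝ (t • d)).hasFDerivAt).add hdF
  have h0 := hmin.hasFDerivAt_eq_zero hd
  refine ext_inner_right ℝ fun h => ?_
  rw [inner_add_left, inner_gradient, inner_zero_left]
  have := congrArg (fun L : Vec n →L[ℝ] ℝ => L h) h0
  simpa [inner_smul_left] using this

/-- Strong monotonicity of the gradient, from `1/‖u‖_{x+tu} ≤ 1/‖u‖_x + t`. -/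
theorem le_gradient_line_sub {x u : Vec n} (hx : x ∈ interior Q) (hxu : x + u ∈ interior Q) {s : ℝ}
    (hs0 : 0 ≤ s) (hs1 : s ≤ 1) :
    lnorm F x u ^ 2 * (s / (1 + s * lnorm F x u)) ≤
      ⟪gradient F (x + s • u), u⟫_ℝ - ⟪gradient F x, u⟫_ℝ := by
  set r := lnorm F x u with hr
  have r0 : 0 ≤ r := lnorm_nonneg _ _ _
  have hmem : ∀ τ : ℝ, 0 ≤ τ → τ ≤ s → x + τ • u ∈ interior Q :=
    fun τ h0 h1 => hB.add_smul_mem hx hxu h0 (h1.trans hs1)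
  have hlin : ∀ τ : ℝ, HasDerivAt (fun τ => 1 + τ * r) r τ := by
    intro τ
    simpa using ((hasDerivAt_id τ).mul_const r).const_add 1
  have hpos : ∀ τ : ℝ, 0 ≤ τ → 0 < 1 + τ * r := fun τ h => by positivity
  have main := sub_le_sub_of_hasDerivAt_le
    (g := fun s : ℝ => ⟪gradient F (x + s • u), u⟫_ℝ)
    (f := fun s => r ^ 2 * (s / (1 + s * r)))
    (f' := fun s => r ^ 2 * ((1 * (1 + s * r) - s * r) / (1 + s * r) ^ 2)) hs0
    (fun s hs => ((hasDerivAt_id s).div (hlin s) (hpos s hs.1).ne').const_mul _)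
    (fun s hs => hasDerivAt_gradient_line (hB.contDiffAt (hmem s hs.1 hs.2)) u)
    (fun s hs => by
      have h2 := hB.le_lnorm_line (u := u) hs.1 (fun τ a b => hmem τ a (b.trans hs.2))
      rw [← hB.lnorm_sq (hmem s hs.1 hs.2)]
      refine le_trans (le_of_eq ?_)
        (pow_le_pow_left₀ (div_nonneg r0 (hpos s hs.1).le) h2 2)
      rw [div_pow, show 1 * (1 + s * r) - s * r = 1 by ring, mul_one_div])
  simpa using main

/-- A point with Newton decrement `δ` is at local distance at most `δ / (1 - δ)` of the center. -/
theorem lnorm_center_sub_le {x z : Vec n} (hx : x ∈ interior Q) (hz : z ∈ interior Q) {d : Vec n}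
    {t : ℝ} (hc : t • d + gradient F z = 0)
    (hδ : dualNorm F x (t • d + gradient F x) < 1) :
    lnorm F x (z - x) ≤
      dualNorm F x (t • d + gradient F x) / (1 - dualNorm F x (t • d + gradient F x)) := by
  set u := z - x with hu
  have hz' : x + u = z := by rw [hu]; abel
  set δ := dualNorm F x (t • d + gradient F x)
  set r := lnorm F x u with hr
  have δ0 : 0 ≤ δ := dualNorm_nonneg _ _ _
  have r0 : 0 ≤ r := lnorm_nonneg _ _ _
  have main := hB.le_gradient_line_sub (u := u) hx (by rwa [hz']) zero_le_one le_rfl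
  rw [one_mul, one_smul, hz', ← hr] at main
  have h1 : ⟪t • d + gradient F z, u⟫_ℝ = 0 := by rw [hc, inner_zero_left]
  have h2 := (abs_le.1 (hB.inner_le_dualNorm hx (t • d + gradient F x) u)).1
  rw [inner_add_left] at h1 h2
  have h3 : r ^ 2 * (1 / (1 + r)) ≤ δ * r := by linarith
  rw [mul_one_div, div_le_iff₀ (by linarith)] at h3
  rw [le_div_iff₀ (by linarith)]
  rcases eq_or_lt_of_le r0 with h | h
  · rw [← h]; linarith
  · nlinarith

/-- Comparison of dual local norms at two approximate centers for the same parameter. -/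
theorem dualNorm_le_of_decrement {x y : Vec n} (hx : x ∈ interior Q) (hy : y ∈ interior Q)
    {d : Vec n} {t a b : ℝ} (ha : dualNorm F x (t • d + gradient F x) ≤ a)
    (hb : dualNorm F y (t • d + gradient F y) ≤ b) (ha1 : a < 1 / 2) (hb1 : b < 1 / 2)
    (v : Vec n) :
    dualNorm F y v ≤ (1 - a) / (1 - 2 * a) * ((1 - b) / (1 - 2 * b)) * dualNorm F x v := by
  obtain ⟨z, hz, hc⟩ := hB.exists_center ⟨x, hx⟩ d t
  have aux : ∀ {w : Vec n} {c : ℝ}, w ∈ interior Q →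
      dualNorm F w (t • d + gradient F w) ≤ c → c < 1 / 2 →
      lnorm F w (z - w) < 1 ∧ (1 - 2 * c) / (1 - c) ≤ 1 - lnorm F w (z - w) := by
    intro w c hw h1 h2
    have h3 := hB.lnorm_center_sub_le hw hz hc (by linarith)
    have h0 := dualNorm_nonneg F w (t • d + gradient F w)
    set δ := dualNorm F w (t • d + gradient F w)
    have h4 : δ / (1 - δ) ≤ c / (1 - c) := by
      rw [div_le_div_iff₀ (by linarith) (by linarith)]; nlinarith
    have h5 : c / (1 - c) < 1 := by rw [div_lt_one (by linarith)]; linarith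
    have h6 : (1 - 2 * c) / (1 - c) = 1 - c / (1 - c) := by
      have : (1 : ℝ) - c ≠ 0 := by linarith
      field_simp
      ring
    rw [h6]
    exact ⟨by linarith, by linarith⟩
  obtain ⟨r1, s1⟩ := aux hx ha ha1
  obtain ⟨r2, s2⟩ := aux hy hb hb1
  have e1 := hB.dualNorm_add_point_le hx r1 v
  have e2 := hB.dualNorm_le_add hy r2 v
  rw [add_sub_cancel] at e1 e2
  have n1 := dualNorm_nonneg F z v
  have n2 := dualNorm_nonneg F y v
  have f1 : dualNorm F z v * ((1 - 2 * a) / (1 - a)) ≤ dualNorm F x v :=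
    (mul_le_mul_of_nonneg_left s1 n1).trans e1
  have f2 : dualNorm F y v * ((1 - 2 * b) / (1 - b)) ≤ dualNorm F z v :=
    (mul_le_mul_of_nonneg_left s2 n2).trans e2
  have pa : 0 < (1 - a) / (1 - 2 * a) := div_pos (by linarith) (by linarith)
  have pb : 0 < (1 - b) / (1 - 2 * b) := div_pos (by linarith) (by linarith)
  have ia : (1 - 2 * a) / (1 - a) = ((1 - a) / (1 - 2 * a))⁻¹ := (inv_div _ _).symm
  have ib : (1 - 2 * b) / (1 - b) = ((1 - b) / (1 - 2 * b))⁻¹ := (inv_div _ _).symm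
  rw [ia, ← div_eq_mul_inv, div_le_iff₀ pa] at f1
  rw [ib, ← div_eq_mul_inv, div_le_iff₀ pb] at f2
  calc dualNorm F y v ≤ dualNorm F z v * ((1 - b) / (1 - 2 * b)) := f2
    _ ≤ dualNorm F x v * ((1 - a) / (1 - 2 * a)) * ((1 - b) / (1 - 2 * b)) := by gcongr
    _ = _ := by ring

end BoundedBarrier
end Barrier

namespace Barrier
namespace BoundedBarrier

variable {n : ℕ} {Q : Set (Vec n)} {F : Vec n → ℝ} {ν : ℝ} (hB : BoundedBarrier Q F ν)
include hB

/-! ### The barrier parameter -/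

theorem abs_inner_gradient_le {x : Vec n} (hx : x ∈ interior Q) (h : Vec n) :
    |⟪gradient F x, h⟫_ℝ| ≤ Real.sqrt ν * lnorm F x h :=
  (hB.inner_le_dualNorm hx _ h).trans
    (mul_le_mul_of_nonneg_right (hB.dualNorm_gradient_le hx) (lnorm_nonneg _ _ _))

/-- The parameter of a barrier for a bounded set is at least `1`: otherwise
`⟨F', u⟩ / ‖u‖ - (1 - √ν) F` would increase along a ray with direction `u`, and bound `F` up to
the frontier. -/
theorem one_le_nu {x u : Vec n} (hx : x ∈ interior Q) (hu : u ≠ 0) : 1 ≤ ν := by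
  by_contra hcon
  push Not at hcon
  have hν0 := hB.nu_nonneg hx
  set σ := Real.sqrt ν with hσ
  have hσ0 : 0 ≤ σ := Real.sqrt_nonneg _
  have hσ1 : σ < 1 := by
    rw [hσ, Real.sqrt_lt' one_pos]; simpa using hcon
  obtain ⟨b, hb, hxb⟩ := hB.exists_notMem_ray x hu
  obtain ⟨T, hT, -, hout, hin⟩ := exists_exit isOpen_interior hx hb hxb
  have hw : ∀ t, 0 ≤ t → t < T →
      |⟪gradient F (x + t • u), u⟫_ℝ * (lnorm F (x + t • u) u)⁻¹| ≤ σ := by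
    intro t h0 h1
    have hp := hB.lnorm_pos (hin t h0 h1) hu
    rw [abs_mul, abs_of_pos (inv_pos.2 hp), ← div_eq_mul_inv, div_le_iff₀ hp]
    exact hB.abs_inner_gradient_le (hin t h0 h1) u
  have hbound : ∀ s, 0 ≤ s → s < T → (1 - σ) * F (x + s • u) ≤ (1 - σ) * F x + 2 * σ := by
    intro s hs hsT
    have hm : ∀ t ∈ Set.Icc 0 s, x + t • u ∈ interior Q :=
      fun t ht => hin t ht.1 (lt_of_le_of_lt ht.2 hsT)
    choose! f' hd hb' using fun (t : ℝ) (ht : t ∈ Set.Icc 0 s) =>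
      hB.exists_hasDerivAt_inv_lnorm (x := x) hu (hm t ht)
    have main := sub_le_sub_of_hasDerivAt_le
      (f := fun t => (1 - σ) * F (x + t • u))
      (g := fun t => ⟪gradient F (x + t • u), u⟫_ℝ * (lnorm F (x + t • u) u)⁻¹) hs
      (fun t ht => (hasDerivAt_line (hB.contDiffAt (hm t ht))).const_mul (1 - σ))
      (fun t ht => (hasDerivAt_gradient_line (hB.contDiffAt (hm t ht)) u).mul (hd t ht))
      (fun t ht => by
        have hp := hB.lnorm_pos (hm t ht) hu
        have h1 := hB.abs_inner_gradient_le (hm t ht) u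
        rw [← hB.lnorm_sq (hm t ht), pow_two, mul_assoc, mul_inv_cancel₀ hp.ne', mul_one]
        have h2 : |⟪gradient F (x + t • u), u⟫_ℝ * f' t| ≤ σ * lnorm F (x + t • u) u := by
          rw [abs_mul]
          exact (mul_le_of_le_one_right (abs_nonneg _) (hb' t ht)).trans h1
        have h3 := (abs_le.1 h2).1
        have h4 := (abs_le.1 h1).2
        have h5 : ⟪gradient F (x + t • u), u⟫_ℝ ≤ lnorm F (x + t • u) u := by nlinarith
        nlinarith)
    have w1 := (abs_le.1 (hw s hs hsT)).2
    have w0 := (abs_le.1 (hw 0 le_rfl hT)).1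
    simp only [zero_smul, add_zero] at main w0
    linarith
  obtain ⟨t, ht, htT, hlt⟩ := hB.not_bounded_on_ray hT hin hout (F x + 2 * σ / (1 - σ))
  have h1 := hbound t ht htT
  have h2 : (1 - σ) * (F x + 2 * σ / (1 - σ)) = (1 - σ) * F x + 2 * σ := by
    have : (1 : ℝ) - σ ≠ 0 := by linarith
    field_simp
  nlinarith [mul_lt_mul_of_pos_left hlt (show (0 : ℝ) < 1 - σ by linarith)]

/-- If `g(t) = ⟨F'(x + t (y - x)), y - x⟩` exceeded `ν` at `0`, then `g² ≤ ν g'` would make `1/g`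
reach `0` before `t = 1`. -/
theorem inner_gradient_sub_le {x y : Vec n} (hx : x ∈ interior Q) (hy : y ∈ interior Q)
    (hν : 1 ≤ ν) : ⟪gradient F x, y - x⟫_ℝ ≤ ν := by
  set u := y - x with hu
  have hxy : x + u = y := by rw [hu]; abel
  by_contra hcon
  push Not at hcon
  set g : ℝ → ℝ := fun t => ⟪gradient F (x + t • u), u⟫_ℝ with hg
  have hm : ∀ t ∈ Set.Icc (0 : ℝ) 1, x + t • u ∈ interior Q :=
    fun t ht => hB.add_smul_mem (u := u) hx (by rwa [hxy]) ht.1 ht.2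
  have hd : ∀ t ∈ Set.Icc (0 : ℝ) 1, HasDerivAt g ⟪hess F (x + t • u) u, u⟫_ℝ t :=
    fun t ht => hasDerivAt_gradient_line (hB.contDiffAt (hm t ht)) u
  have g0 : g 0 = ⟪gradient F x, u⟫_ℝ := by simp [hg]
  have hmono : ∀ t ∈ Set.Icc (0 : ℝ) 1, ν < g t := by
    intro t ht
    have := le_of_hasDerivAt_nonneg ht.1 (fun s hs => hd s ⟨hs.1, hs.2.trans ht.2⟩)
      (fun s hs => hB.quad_nonneg (hm s ⟨hs.1, hs.2.trans ht.2⟩) u)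
    rw [g0] at this
    linarith
  have main := sub_le_sub_of_hasDerivAt_le
    (f := fun t => (g t)⁻¹) (g := fun t => t * (-ν⁻¹)) (g' := fun _ => -ν⁻¹) zero_le_one
    (fun t ht => (hd t ht).inv (by linarith [hmono t ht] : (0 : ℝ) < g t).ne')
    (fun t _ => by simpa using (hasDerivAt_id t).mul_const (-ν⁻¹))
    (fun t ht => by
      have hp : 0 < g t := by linarith [hmono t ht]
      have := (hB.quad_nonneg_and_sq_le (hm t ht) u).2
      rw [neg_div, neg_le_neg_iff, le_div_iff₀ (by positivity), inv_mul_le_iff₀ (by linarith)]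
      exact this)
  have h1 : 0 < (g 1)⁻¹ := inv_pos.2 (by linarith [hmono 1 (by simp)])
  have h2 : (g 0)⁻¹ < ν⁻¹ := inv_strictAnti₀ (by linarith) (hmono 0 (by simp))
  simp only [one_mul, zero_mul, sub_zero] at main
  linarith

/-- The domain lies in the local ball of radius `4ν` around the analytic center. -/
theorem lnorm_sub_analyticCenter_le {z y : Vec n} (hz : z ∈ interior Q) (hc : gradient F z = 0)
    (hy : y ∈ interior Q) (hν : 1 ≤ ν) : lnorm F z (y - z) ≤ 4 * ν := by
  set u := y - z with hu
  have hzy : z + u = y := by rw [hu]; abel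
  have hmid : z + (1 / 2 : ℝ) • u ∈ interior Q :=
    hB.add_smul_mem (u := u) hz (by rwa [hzy]) (by norm_num) (by norm_num)
  have h1 := hB.le_gradient_line_sub (u := u) hz (by rwa [hzy]) (s := 1 / 2) (by norm_num)
    (by norm_num)
  rw [hc, inner_zero_left, sub_zero] at h1
  have h2 := hB.inner_gradient_sub_le hmid hy hν
  have h3 : y - (z + (1 / 2 : ℝ) • u) = (1 / 2 : ℝ) • u := by
    rw [← hzy]
    module
  rw [h3, inner_smul_right] at h2
  set r := lnorm F z u
  have r0 : 0 ≤ r := lnorm_nonneg _ _ _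
  have h4 : r ^ 2 * (1 / 2 / (1 + 1 / 2 * r)) ≤ 2 * ν := by linarith
  rw [← mul_div_assoc, div_le_iff₀ (by positivity)] at h4
  by_contra hcon
  push Not at hcon
  nlinarith

theorem lnorm_add_le_add {x : Vec n} (hx : x ∈ interior Q) (u v : Vec n) :
    lnorm F x (u + v) ≤ lnorm F x u + lnorm F x v := by
  have hu := lnorm_nonneg F x u
  have hv := lnorm_nonneg F x v
  refine (abs_le_of_sq_le_sq' ?_ (by positivity)).2
  have h := (abs_le.1 (hB.hess_inner_le hx u v)).2
  rw [hB.lnorm_sq hx, map_add, inner_add_left, inner_add_right, inner_add_right,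
    hess_symm (hB.contDiffAt hx) v u, ← hB.lnorm_sq hx, ← hB.lnorm_sq hx]
  nlinarith

/-- The Dikin ellipsoid at `x` lies in the domain, hence in the local ball of radius `4ν` around the
analytic center `z`; so `‖h‖_z ≤ 8 ν ‖h‖_x`, and the dual norms compare the other way. -/
theorem dualNorm_le_analyticCenter {x z : Vec n} (hx : x ∈ interior Q) (hz : z ∈ interior Q)
    (hc : gradient F z = 0) (hν : 1 ≤ ν) (v : Vec n) :
    dualNorm F x v ≤ 8 * ν * dualNorm F z v := by
  refine hB.dualNorm_le_of_lnorm_le hx hz (by positivity) (fun h => ?_) v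
  rcases eq_or_ne h 0 with rfl | hh
  · simp [lnorm]
  -- the points `x ± k` of the Dikin ellipsoid at `x` are close to the analytic center
  have hp := hB.lnorm_pos hx hh
  set a : ℝ := (2 * lnorm F x h)⁻¹ with ha
  have ha0 : 0 < a := by positivity
  have hk : ∀ σ : ℝ, |σ| = a → x + σ • h ∈ interior Q := by
    intro σ hσ
    refine hB.dikin hx ?_
    rw [lnorm_smul, hσ, ha, mul_inv, mul_assoc, inv_mul_cancel₀ hp.ne']
    norm_num
  have h1 := hB.lnorm_sub_analyticCenter_le hz hc (hk a (abs_of_pos ha0)) hν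
  have h2 := hB.lnorm_sub_analyticCenter_le hz hc (hk (-a) (by rw [abs_neg, abs_of_pos ha0])) hν
  have h3 := hB.lnorm_add_le_add hz (x + a • h - z) ((-1 : ℝ) • (x + (-a) • h - z))
  rw [show x + a • h - z + (-1 : ℝ) • (x + (-a) • h - z) = (2 * a) • h by module, lnorm_smul,
    lnorm_smul, abs_of_pos (by positivity : 0 < 2 * a)] at h3
  simp only [abs_neg, abs_one, one_mul] at h3
  have h4 : 2 * a * lnorm F z h ≤ 8 * ν := by linarith
  have h5 : 2 * a = (lnorm F x h)⁻¹ := by rw [ha]; field_simp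
  rwa [h5, inv_mul_le_iff₀ hp, mul_comm] at h4

/-! ### Following the central path -/

theorem decrement_le_add {x : Vec n} (hx : x ∈ interior Q) (d : Vec n) (t t' : ℝ) :
    dualNorm F x (t' • d + gradient F x) ≤
      dualNorm F x (t • d + gradient F x) + |t' - t| * dualNorm F x d := by
  have := hB.dualNorm_add_le hx (t • d + gradient F x) ((t' - t) • d)
  rw [dualNorm_smul] at this
  convert this using 2
  module

/-- A full Newton step from a decrement of at most `1/4 = β + γ`, as it occurs after a short step of
the parameter, restores the centrality `β`. -/
theorem short_step {x : Vec n} (hx : x ∈ interior Q) {d : Vec n} {t' : ℝ}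
    (h : dualNorm F x (t' • d + gradient F x) ≤ 1 / 4) :
    x + newtonDir F d t' x ∈ interior Q ∧
      dualNorm F (x + newtonDir F d t' x)
        (t' • d + gradient F (x + newtonDir F d t' x)) ≤ 1 / 9 := by
  have h0 := dualNorm_nonneg F x (t' • d + gradient F x)
  refine ⟨hB.dikin hx (by rw [hB.lnorm_newtonDir hx]; linarith), ?_⟩
  refine (hB.newton_decrement hx (by linarith)).trans ?_
  have : dualNorm F x (t' • d + gradient F x) / (1 - dualNorm F x (t' • d + gradient F x)) ≤
      1 / 3 := by
    rw [div_le_iff₀ (by linarith)]; linarith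
  have h1 : 0 ≤ dualNorm F x (t' • d + gradient F x) /
      (1 - dualNorm F x (t' • d + gradient F x)) := div_nonneg h0 (by linarith)
  nlinarith

theorem shortRun_center {d : Vec n} {next : ℝ → Vec n → ℝ} {t₀ : ℝ} {x₀ : Vec n}
    (hnext : ∀ t, ∀ x ∈ interior Q, |next t x - t| * dualNorm F x d ≤ gamma)
    (hx₀ : x₀ ∈ interior Q) (h₀ : dualNorm F x₀ (t₀ • d + gradient F x₀) ≤ beta) (k : ℕ) :
    (shortRun F d next t₀ x₀ k).2 ∈ interior Q ∧
      dualNorm F (shortRun F d next t₀ x₀ k).2 ((shortRun F d next t₀ x₀ k).1 • d +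
        gradient F (shortRun F d next t₀ x₀ k).2) ≤ beta := by
  induction k with
  | zero => exact ⟨hx₀, h₀⟩
  | succ k ih =>
    have h1 := hnext (shortRun F d next t₀ x₀ k).1 _ ih.1
    have h2 := hB.decrement_le_add ih.1 d (shortRun F d next t₀ x₀ k).1
      (next (shortRun F d next t₀ x₀ k).1 (shortRun F d next t₀ x₀ k).2)
    have h3 := hB.short_step ih.1 (d := d)
      (t' := next (shortRun F d next t₀ x₀ k).1 (shortRun F d next t₀ x₀ k).2)
      (by have := ih.2; unfold beta gamma at *; linarith)
    exact ⟨h3.1, h3.2.trans (by unfold beta; norm_num)⟩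

/-- If the parameters of two `β`-approximate centers differ by at most one short step, then their
dual local norms differ by a factor of `2` at most. -/
theorem dualNorm_le_two_mul {x y : Vec n} (hx : x ∈ interior Q) (hy : y ∈ interior Q) {d : Vec n}
    {t s : ℝ} (hxt : dualNorm F x (t • d + gradient F x) ≤ beta)
    (hys : dualNorm F y (s • d + gradient F y) ≤ beta) (hts : |s - t| * dualNorm F x d ≤ gamma) :
    dualNorm F y d ≤ 2 * dualNorm F x d := by
  have h1 := hB.decrement_le_add hx d t s
  have h2 := hB.dualNorm_le_of_decrement hx hy (a := 1 / 4) (b := 1 / 9) (t := s) (d := d)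
    (by unfold beta gamma at *; linarith) (by unfold beta at *; linarith) (by norm_num)
    (by norm_num) d
  have h0 := dualNorm_nonneg F x d
  refine h2.trans ?_
  norm_num
  linarith

/-- Near the central path `|t| ‖d‖*_x` is bounded, since `‖F'(x)‖*_x ≤ √ν`. This limits the change
of the decrement when `t` is multiplied by a constant. -/
theorem abs_mul_dualNorm_le {x : Vec n} (hx : x ∈ interior Q) {d : Vec n} {t : ℝ}
    (h : dualNorm F x (t • d + gradient F x) ≤ beta) :
    |t| * dualNorm F x d ≤ beta + Real.sqrt ν := by
  have h1 := hB.dualNorm_add_le hx (t • d + gradient F x) ((-1 : ℝ) • gradient F x)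
  rw [dualNorm_smul, show t • d + gradient F x + (-1 : ℝ) • gradient F x = t • d by module,
    dualNorm_smul] at h1
  simp only [abs_neg, abs_one, one_mul] at h1
  linarith [hB.dualNorm_gradient_le hx]

end BoundedBarrier
end Barrier

namespace Barrier

/-! ### Trials of the adaptive method -/

/-- The step sizes that occur in the adaptive method: `κ = 10^{1/2^m}`. Squaring, taking a square
root, and taking a fourth root change `m` by `-1`, `1` and `2`. -/
noncomputable def kap (m : ℕ) : ℝ := (10 : ℝ) ^ ((1 / 2 : ℝ) ^ m)

theorem kap_zero : kap 0 = 10 := by simp [kap]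

theorem kap_pos (m : ℕ) : 0 < kap m := Real.rpow_pos_of_pos (by norm_num) _

theorem one_lt_kap (m : ℕ) : 1 < kap m := Real.one_lt_rpow (by norm_num) (by positivity)

theorem kap_anti {m m' : ℕ} (h : m ≤ m') : kap m' ≤ kap m :=
  Real.rpow_le_rpow_of_exponent_le (by norm_num)
    (pow_le_pow_of_le_one (by norm_num) (by norm_num) h)

theorem kap_le_ten (m : ℕ) : kap m ≤ 10 := kap_zero ▸ kap_anti (Nat.zero_le m)

theorem kap_succ_sq (m : ℕ) : kap (m + 1) ^ 2 = kap m := by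
  unfold kap
  rw [← Real.rpow_natCast, ← Real.rpow_mul (by norm_num)]
  congr 1
  rw [pow_succ]; push_cast; ring

theorem sqrt_kap (m : ℕ) : Real.sqrt (kap m) = kap (m + 1) := by
  rw [← kap_succ_sq m, Real.sqrt_sq (kap_pos _).le]

theorem kap_rpow_quarter (m : ℕ) : kap m ^ (1 / 4 : ℝ) = kap (m + 2) := by
  unfold kap
  rw [← Real.rpow_mul (by norm_num)]
  congr 1
  rw [pow_add]; ring

theorem log_kap (m : ℕ) : Real.log (kap m) = Real.log 10 / 2 ^ m := by
  unfold kap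
  rw [Real.log_rpow (by norm_num), one_div, inv_pow, inv_mul_eq_div]

theorem min_kap_sq (m : ℕ) : min kappa0 (kap m ^ 2) = kap (m - 1) := by
  cases m with
  | zero => rw [kap_zero, kappa0]; norm_num [kap_zero]
  | succ m =>
    rw [kap_succ_sq, Nat.add_sub_cancel, kappa0]
    exact min_eq_right (kap_le_ten m)

variable {n : ℕ}

/-- In the adaptive method, the state of index `k` is an accepted pair `(s, y)`, and the step size
that it chooses is `κ = 10^{1/2^m}`. -/
structure AcceptedAt (Q : Set (Vec n)) (F : Vec n → ℝ) (d : Vec n) (next : ℝ → ℝ → Vec n → ℝ)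
    (t₀ : ℝ) (x₀ : Vec n) (k : ℕ) (s : ℝ) (y : Vec n) (m : ℕ) : Prop where
  t_eq : (adaptiveRun Q F d next t₀ x₀ k).t = s
  x_eq : (adaptiveRun Q F d next t₀ x₀ k).x = y
  accepted : dualNorm F y (s • d + gradient F y) ≤ beta
  mem : y ∈ interior Q
  kappa_eq : acceptedKappa (adaptiveRun Q F d next t₀ x₀ k) = kap m

theorem acceptedAt_zero {Q : Set (Vec n)} {F : Vec n → ℝ} {d : Vec n}
    {next : ℝ → ℝ → Vec n → ℝ} {t₀ : ℝ} {x₀ : Vec n} (hx₀ : x₀ ∈ interior Q)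
    (h : dualNorm F x₀ (t₀ • d + gradient F x₀) ≤ beta) :
    AcceptedAt Q F d next t₀ x₀ 0 t₀ x₀ 0 where
  t_eq := rfl
  x_eq := rfl
  accepted := h
  mem := hx₀
  kappa_eq := by simp [acceptedKappa, adaptiveRun, kappa0, kap_zero]; norm_num

/-- The states during a trial: `i` slow steps after the first iterate with the new parameter. -/
theorem adaptiveRun_trial {Q : Set (Vec n)} {F : Vec n → ℝ} {d : Vec n}
    {next : ℝ → ℝ → Vec n → ℝ} {t₀ : ℝ} {x₀ : Vec n} {k : ℕ} {s : ℝ} {y : Vec n} {m : ℕ}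
    (h : AcceptedAt Q F d next t₀ x₀ k s y m) {i : ℕ} (hi : i ≤ 14)
    (hslow : ∀ l, l < i → ¬ dualNorm F ((dampedNewton Q F d (next (kap m) s y))^[l + 1] y)
      (next (kap m) s y • d + gradient F ((dampedNewton Q F d (next (kap m) s y))^[l + 1] y)) ≤
        beta) :
    adaptiveRun Q F d next t₀ x₀ (k + 1 + i) =
      { t := next (kap m) s y, x := (dampedNewton Q F d (next (kap m) s y))^[i + 1] y,
        kappa := kap m, slow := i, lastT := s, lastX := y, restored := False } := by
  induction i with
  | zero =>
    have hacc : Accepted F d (adaptiveRun Q F d next t₀ x₀ k) := by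
      unfold Accepted
      rw [h.t_eq, h.x_eq]
      exact h.accepted
    rw [add_zero, adaptiveRun, adaptiveStep, if_pos hacc, h.kappa_eq, h.t_eq, h.x_eq]
    rfl
  | succ i ih =>
    have hprev := ih (by omega) (fun l hl => hslow l (by omega))
    have hnot : ¬ Accepted F d (adaptiveRun Q F d next t₀ x₀ (k + 1 + i)) := by
      rw [hprev]
      exact hslow i (by omega)
    rw [← add_assoc, adaptiveRun, adaptiveStep, if_neg hnot, hprev, if_pos (by simp; omega),
      Function.iterate_succ_apply' _ (i + 1)]

namespace BoundedBarrier

variable {Q : Set (Vec n)} {F : Vec n → ℝ} {ν : ℝ} (hB : BoundedBarrier Q F ν)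
include hB

/-- The quadratic convergence in the range where the line search takes full steps. -/
theorem dampedNewton_decrement_le {x : Vec n} (hx : x ∈ interior Q) {d : Vec n} {t a : ℝ}
    (ha : a ≤ 0.36) (h : dualNorm F x (t • d + gradient F x) ≤ a) :
    dualNorm F (dampedNewton Q F d t x) (t • d + gradient F (dampedNewton Q F d t x)) ≤
      (a / (1 - a)) ^ 2 := by
  have h0 := dualNorm_nonneg F x (t • d + gradient F x)
  rw [hB.dampedNewton_eq hx (h.trans ha)]
  refine (hB.newton_decrement hx (by linarith)).trans ?_
  refine pow_le_pow_left₀ (div_nonneg h0 (by linarith)) ?_ 2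
  rw [div_le_div_iff₀ (by linarith) (by linarith)]
  nlinarith

/-- The outcome of a trial from an accepted pair. Either it succeeds after at most `14` slow steps,
and the exponent `m` of the step size changes accordingly, or it is rejected, which takes `16`
iterations. Newton's method converges quadratically, so there is no slow step if the first Newton
decrement is at most `1/4`, and at most two if it is at most `0.36`. -/
theorem trial {d : Vec n} {next : ℝ → ℝ → Vec n → ℝ} {t₀ : ℝ} {x₀ : Vec n} {k : ℕ}
    {s : ℝ} {y : Vec n} {m : ℕ} (h : AcceptedAt Q F d next t₀ x₀ k s y m) :
    (∃ j y' m', AcceptedAt Q F d next t₀ x₀ (k + 1 + j) (next (kap m) s y) y' m' ∧ j ≤ 14 ∧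
      ((m' = m - 1 ∧ j ≤ 2) ∨ (m' = m ∧ j ≤ 7) ∨ m' = m + 1) ∧ (j ≤ 2 → m' = m - 1) ∧
      (dualNorm F y (next (kap m) s y • d + gradient F y) ≤ 1 / 4 → j = 0) ∧
      (dualNorm F y (next (kap m) s y • d + gradient F y) ≤ 0.36 → j ≤ 2)) ∨
    (AcceptedAt Q F d next t₀ x₀ (k + 16) s y (m + 2) ∧
      0.36 < dualNorm F y (next (kap m) s y • d + gradient F y)) := by
  set t' := next (kap m) s y with ht'
  set z : ℕ → Vec n := fun i => (dampedNewton Q F d t')^[i] y with hz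
  have hz0 : z 0 = y := rfl
  have hzs : ∀ i, z (i + 1) = dampedNewton Q F d t' (z i) :=
    fun i => Function.iterate_succ_apply' _ i y
  have hmem : ∀ i, z i ∈ interior Q := by
    intro i
    induction i with
    | zero => exact h.mem
    | succ i ih => rw [hzs]; exact hB.dampedNewton_mem ih d t'
  set D : ℕ → ℝ := fun i => dualNorm F (z i) (t' • d + gradient F (z i)) with hD
  have hDs : ∀ i a, a ≤ 0.36 → D i ≤ a → D (i + 1) ≤ (a / (1 - a)) ^ 2 := by
    intro i a ha hi
    simp only [D]
    rw [hzs]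
    exact hB.dampedNewton_decrement_le (hmem i) ha hi
  have hD1 : D 0 ≤ 1 / 4 → D 1 ≤ beta := fun h0 =>
    (hDs 0 (1 / 4) (by norm_num) h0).trans (by unfold beta; norm_num)
  have hD3 : D 0 ≤ 0.36 → D 3 ≤ beta := by
    intro h0
    have h1 : D 1 ≤ 0.317 := (hDs 0 0.36 le_rfl h0).trans (by norm_num)
    have h2 : D 2 ≤ 0.216 := (hDs 1 0.317 (by norm_num) h1).trans (by norm_num)
    exact (hDs 2 0.216 (by norm_num) h2).trans (by unfold beta; norm_num)
  by_cases hex : ∃ j, j < 15 ∧ D (j + 1) ≤ beta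
  · left
    classical
    obtain ⟨hj15, hjacc⟩ := Nat.find_spec hex
    have hmin : ∀ l, l < Nat.find hex → ¬ D (l + 1) ≤ beta := by
      intro l hl hacc
      exact Nat.find_min hex hl ⟨by omega, hacc⟩
    have hle : ∀ l, l < 15 → D (l + 1) ≤ beta → Nat.find hex ≤ l :=
      fun l hl hacc => Nat.find_min' hex ⟨hl, hacc⟩
    set j := Nat.find hex
    have hrun := adaptiveRun_trial h (i := j) (by omega) hmin
    have hacc : ∀ m', acceptedKappa (adaptiveRun Q F d next t₀ x₀ (k + 1 + j)) = kap m' →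
        AcceptedAt Q F d next t₀ x₀ (k + 1 + j) t' (z (j + 1)) m' := by
      intro m' hm'
      exact ⟨by rw [hrun], by rw [hrun], hjacc, hmem _, hm'⟩
    have hfast : (D 0 ≤ 1 / 4 → j = 0) ∧ (D 0 ≤ 0.36 → j ≤ 2) :=
      ⟨fun h0 => Nat.le_zero.1 (hle 0 (by norm_num) (hD1 h0)),
        fun h0 => hle 2 (by norm_num) (hD3 h0)⟩
    rcases le_or_gt j 2 with hj | hj
    · refine ⟨j, z (j + 1), m - 1, hacc _ ?_, by omega, Or.inl ⟨rfl, hj⟩, fun _ => rfl, hfast⟩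
      rw [hrun]
      simp only [acceptedKappa, if_false, if_pos hj]
      exact min_kap_sq m
    rcases le_or_gt 8 j with hj8 | hj8
    · refine ⟨j, z (j + 1), m + 1, hacc _ ?_, by omega, Or.inr (Or.inr rfl), by omega, hfast⟩
      rw [hrun]
      simp only [acceptedKappa, if_false, if_neg (not_le.2 hj), if_pos hj8]
      exact sqrt_kap m
    · refine ⟨j, z (j + 1), m, hacc _ ?_, by omega, Or.inr (Or.inl ⟨rfl, by omega⟩), by omega,
        hfast⟩
      rw [hrun]
      simp only [acceptedKappa, if_false, if_neg (not_le.2 hj), if_neg (not_le.2 hj8)]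
  · right
    push Not at hex
    refine ⟨?_, ?_⟩
    · have hrun := adaptiveRun_trial h (i := 14) le_rfl
        (fun l hl => not_le.2 (hex l (by omega)))
      have hnot : ¬ Accepted F d (adaptiveRun Q F d next t₀ x₀ (k + 1 + 14)) := by
        rw [hrun]
        exact not_le.2 (hex 14 (by norm_num))
      have hrun16 : adaptiveRun Q F d next t₀ x₀ (k + 16) =
          { t := s, x := y, kappa := kap m ^ (1 / 4 : ℝ), slow := 0, lastT := s, lastX := y,
            restored := True } := by
        rw [show k + 16 = (k + 1 + 14) + 1 by ring, adaptiveRun, adaptiveStep, if_neg hnot, hrun,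
          if_neg (by simp)]
      refine ⟨by rw [hrun16], by rw [hrun16], h.accepted, h.mem, ?_⟩
      rw [hrun16]
      simp only [acceptedKappa, if_true]
      exact kap_rpow_quarter m
    · by_contra hcon
      push Not at hcon
      exact absurd (hD3 hcon) (not_le.2 (hex 2 (by norm_num)))

/-- Amortized cost of a successful trial together with the rejected trials before it. The potential
is `8 m`: a rejection costs `16` iterations and increases `m` by `2`, and a success costs at most
`3`, `8` or `15` iterations when `m` changes by `-1`, `0` or `1`. A trial that needs more than two
slow steps requires `2^m < B`; so the last trial costs little or starts with a small `m`. -/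
theorem successful_trial {d : Vec n} {next : ℝ → ℝ → Vec n → ℝ} {t₀ : ℝ} {x₀ : Vec n} {B : ℝ}
    (hB1 : 1 ≤ 4 * B)
    (hsmall : ∀ s y m, y ∈ interior Q → dualNorm F y (s • d + gradient F y) ≤ beta →
      B ≤ 2 ^ m → dualNorm F y (next (kap m) s y • d + gradient F y) ≤ 0.36)
    {a k : ℕ} {s : ℝ} {y : Vec n} {m : ℕ} (h : AcceptedAt Q F d next t₀ x₀ k s y m)
    (hk : k ≤ a + 8 * m) (hm : (2 : ℝ) ^ m ≤ 4 * B) :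
    ∃ k' m' y' m₀, AcceptedAt Q F d next t₀ x₀ k' (next (kap m₀) s y) y' m' ∧ k < k' ∧ m ≤ m₀ ∧
      k' ≤ a + 11 + 8 * m' ∧ (2 : ℝ) ^ m' ≤ 4 * B ∧
      (k' : ℝ) ≤ a + 19 + 8 * (Real.log B / Real.log 2) := by
  obtain ⟨N, hN⟩ := pow_unbounded_of_one_lt B (show (1 : ℝ) < 2 by norm_num)
  have hBpos : 0 < B := by linarith
  have hlog2 : 0 < Real.log 2 := Real.log_pos (by norm_num)
  -- every rejection raises `m`, and `2 ^ m < B` at each of them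
  induction hp : N - m using Nat.strong_induction_on generalizing k m with
  | _ p ih =>
  have hbig : 0.36 < dualNorm F y (next (kap m) s y • d + gradient F y) → (2 : ℝ) ^ m < B := by
    intro hlt
    by_contra hcon
    exact absurd (hsmall s y m h.mem h.accepted (not_lt.1 hcon)) (not_le.2 hlt)
  have hlogm : ∀ C : ℝ, 0 < C → (2 : ℝ) ^ m ≤ C → (m : ℝ) ≤ Real.log C / Real.log 2 := by
    intro C hC hmC
    rw [le_div_iff₀ hlog2, ← Real.log_pow]
    exact Real.log_le_log (by positivity) hmC
  have hlog4 : Real.log (4 * B) / Real.log 2 = 2 + Real.log B / Real.log 2 := by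
    rw [Real.log_mul (by norm_num) hBpos.ne', show (4 : ℝ) = 2 ^ 2 by norm_num, Real.log_pow]
    push_cast
    field_simp
  rcases hB.trial h with ⟨j, y', m', hacc, hj, hcase, hj2, -, hfast⟩ | ⟨hacc, hlt⟩
  · have hmB : 3 ≤ j → (2 : ℝ) ^ m < B := fun h3 => hbig (by
      by_contra hcon
      exact absurd (hfast (not_lt.1 hcon)) (by omega))
    refine ⟨k + 1 + j, m', y', m, hacc, by omega, le_rfl, ?_, ?_, ?_⟩
    · rcases hcase with ⟨rfl, _⟩ | ⟨rfl, _⟩ | rfl <;> omega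
    · rcases le_or_gt j 2 with hj' | hj'
      · rw [hj2 hj']
        exact (pow_le_pow_right₀ (by norm_num) (Nat.sub_le m 1)).trans hm
      · have h1 : (2 : ℝ) ^ m' ≤ 2 ^ (m + 1) := pow_le_pow_right₀ (by norm_num) (by omega)
        have h2 := hmB hj'
        rw [pow_succ] at h1
        linarith
    · have hkr : (k : ℝ) ≤ a + 8 * m := by exact_mod_cast hk
      push_cast
      rcases le_or_gt j 2 with hj' | hj'
      · have h1 := hlogm _ (by linarith) hm
        rw [hlog4] at h1
        have h2 : (j : ℝ) ≤ 2 := by exact_mod_cast hj'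
        linarith
      · have h1 := hlogm _ hBpos (hmB hj').le
        have h2 : (j : ℝ) ≤ 14 := by exact_mod_cast hj
        linarith
  · have h2 := hbig hlt
    have hmN : m < N := by
      by_contra hcon
      have := pow_le_pow_right₀ (show (1 : ℝ) ≤ 2 by norm_num) (not_lt.1 hcon)
      linarith
    obtain ⟨k', m', y', m₀, h1, h3, h4, h5⟩ :=
      ih (N - (m + 2)) (by omega) hacc (by omega)
        (by rw [pow_add]; linarith) rfl
    exact ⟨k', m', y', m₀, h1, by omega, by omega, h5⟩

end BoundedBarrier
end Barrier

namespace Barrier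

/-! ### Numerical constants -/

theorem log_ten_bounds : 3.3 * Real.log 2 < Real.log 10 ∧ Real.log 10 < 10 / 3 * Real.log 2 := by
  have h1 : Real.log ((2 : ℝ) ^ 33) < Real.log ((10 : ℝ) ^ 10) :=
    Real.log_lt_log (by norm_num) (by norm_num)
  have h2 : Real.log ((10 : ℝ) ^ 3) < Real.log ((2 : ℝ) ^ 10) :=
    Real.log_lt_log (by norm_num) (by norm_num)
  rw [Real.log_pow, Real.log_pow] at h1 h2
  push_cast at h1 h2
  constructor <;> linarith

theorem log_ten_lt : Real.log 10 < 2.3105 := by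
  have := log_ten_bounds.2
  have := Real.log_two_lt_d9
  linarith

theorem ten_le_one_add_nine_sqrt {ν : ℝ} (hν : 1 ≤ ν) : 10 ≤ 1 + 9 * Real.sqrt ν := by
  have : 1 ≤ Real.sqrt ν := Real.one_le_sqrt.2 hν
  linarith

theorem le_log_one_add_nine_sqrt {ν : ℝ} (hν : 1 ≤ ν) :
    2.287 ≤ Real.log (1 + 9 * Real.sqrt ν) := by
  have h1 := Real.log_le_log (by norm_num) (ten_le_one_add_nine_sqrt hν)
  have := log_ten_bounds.1
  have := Real.log_two_gt_d9
  linarith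

theorem mul_log_div_log_two_le {a W : ℝ} (ha : 1 ≤ a) (hW : 10 ≤ W) :
    8 * (Real.log (a * W) / Real.log 2) ≤ 11.5417 * (a - 1 + Real.log W) := by
  have h2 := Real.log_two_gt_d9
  have h3 : 0 < Real.log W := Real.log_pos (by linarith)
  rw [Real.log_mul (by linarith) (by linarith), ← mul_div_assoc, div_le_iff₀ (by linarith)]
  have h4 := Real.log_le_sub_one_of_pos (show 0 < a by linarith)
  nlinarith

/-- The exponents for which the factor `kap m` moves the decrement in the main phase by at most
`2.24 / 9 ≤ 0.36 - β`, given `t ‖c‖* ≤ W / 9` with `W = 9 (β + √ν)`. -/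
theorem kap_sub_one_le {W : ℝ} (hW : 10 ≤ W) {m : ℕ} (hm : 1.27 * W ≤ 2 ^ m) :
    (kap m - 1) * W ≤ 2.24 := by
  have h1 : Real.log (kap m) ≤ Real.log (1 + 2.24 / W) := by
    refine le_trans ?_ (Real.one_sub_inv_le_log_of_pos (by positivity))
    have h3 : 1 - (1 + 2.24 / W)⁻¹ = 2.24 / (W + 2.24) := by
      field_simp
      ring
    rw [h3, log_kap, div_le_div_iff₀ (by positivity) (by positivity)]
    have := log_ten_lt
    nlinarith
  have h2 := (Real.log_le_log_iff (kap_pos m) (by positivity)).1 h1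
  have h3 : 2.24 / W * W = 2.24 := by field_simp
  nlinarith

/-- The counterpart of `kap_sub_one_le` for the factor `1 / kap m` of the auxiliary phase. -/
theorem one_sub_inv_kap_le {W : ℝ} (hW : 10 ≤ W) {m : ℕ} (hm : 1.035 * W ≤ 2 ^ m) :
    (1 - (kap m)⁻¹) * W ≤ 2.24 := by
  have h1 := Real.one_sub_inv_le_log_of_pos (kap_pos m)
  rw [log_kap] at h1
  have h2 : Real.log 10 / 2 ^ m ≤ 2.24 / W := by
    rw [div_le_div_iff₀ (by positivity) (by positivity)]
    have := log_ten_lt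
    nlinarith
  have h3 : 2.24 / W * W = 2.24 := by field_simp
  nlinarith

variable {n : ℕ}

/-- The rule of the adaptive main scheme for the new barrier parameter at an accepted pair. -/
noncomputable def mainRule (F : Vec n → ℝ) (c : Vec n) (κ t : ℝ) (x : Vec n) : ℝ :=
  max (κ * t) (t + gamma / dualNorm F x c)

theorem accepted_of_acceptedAt {Q : Set (Vec n)} {F : Vec n → ℝ} {c y₀ : Vec n} {k : ℕ} {s : ℝ}
    {y : Vec n} {m : ℕ}
    (h : AcceptedAt Q F c (mainRule F c) 0 y₀ k s y m) :
    (adaptiveMain Q F c y₀ k).t = s ∧ Accepted F c (adaptiveMain Q F c y₀ k) := by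
  refine ⟨h.t_eq, ?_⟩
  have := h.accepted
  rw [← h.t_eq, ← h.x_eq] at this
  exact this

namespace BoundedBarrier

variable {Q : Set (Vec n)} {F : Vec n → ℝ} {ν : ℝ} (hB : BoundedBarrier Q F ν)
include hB

/-! ### The main phase -/

theorem shortMain_center {c x₀ : Vec n} (hx₀ : x₀ ∈ interior Q)
    (h₀ : dualNorm F x₀ (gradient F x₀) ≤ beta) (k : ℕ) :
    (shortMain F c x₀ k).2 ∈ interior Q ∧
      dualNorm F (shortMain F c x₀ k).2 ((shortMain F c x₀ k).1 • c +
        gradient F (shortMain F c x₀ k).2) ≤ beta := by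
  refine hB.shortRun_center (fun t x hx => ?_) hx₀ (by simpa using h₀) k
  rw [add_sub_cancel_left]
  rcases eq_or_ne c 0 with rfl | hc
  · rw [dualNorm_zero, mul_zero]; unfold gamma; norm_num
  · have := hB.dualNorm_pos hx hc
    rw [abs_of_nonneg (by unfold gamma; positivity), div_mul_cancel₀ _ this.ne']

/-- From a `β`-approximate center `y` for `s ≥ t`, a short step gets beyond the short step from
`(t, x)`, or it is at least half as long. -/
theorem half_step {c x y : Vec n} (hc : c ≠ 0) (hx : x ∈ interior Q) (hy : y ∈ interior Q)
    {t s : ℝ} (hxt : dualNorm F x (t • c + gradient F x) ≤ beta)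
    (hys : dualNorm F y (s • c + gradient F y) ≤ beta) (hts : t ≤ s) :
    t + gamma / dualNorm F x c ≤ s ∨
      gamma / dualNorm F x c / 2 ≤ gamma / dualNorm F y c := by
  by_cases h : t + gamma / dualNorm F x c ≤ s
  · exact Or.inl h
  · right
    push Not at h
    have px := hB.dualNorm_pos hx hc
    have py := hB.dualNorm_pos hy hc
    have h1 : |s - t| * dualNorm F x c ≤ gamma := by
      rw [abs_of_nonneg (by linarith), ← le_div_iff₀ px]
      linarith
    have h2 := hB.dualNorm_le_two_mul hx hy hxt hys h1
    rw [div_div]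
    exact div_le_div_of_nonneg_left (by unfold gamma; norm_num) py (by linarith)

/-- With a small step factor, the first Newton decrement of a trial is at most `0.36`. -/
theorem mainRule_small {c : Vec n} (hc : c ≠ 0) (hν : 1 ≤ ν) {s : ℝ} {y : Vec n} {m : ℕ}
    (hy : y ∈ interior Q) (h : dualNorm F y (s • c + gradient F y) ≤ beta)
    (hm : 1.27 * (1 + 9 * Real.sqrt ν) ≤ 2 ^ m) :
    dualNorm F y (mainRule F c (kap m) s y • c + gradient F y) ≤ 0.36 := by
  unfold mainRule
  have hp := hB.dualNorm_pos hy hc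
  have h1 := hB.decrement_le_add hy c s (max (kap m * s) (s + gamma / dualNorm F y c))
  have h2 := hB.abs_mul_dualNorm_le hy h
  have h3 := kap_sub_one_le (ten_le_one_add_nine_sqrt hν) hm
  have h4 := one_lt_kap m
  have hγ : 0 < gamma := by unfold gamma; norm_num
  have h5 : |max (kap m * s) (s + gamma / dualNorm F y c) - s| * dualNorm F y c ≤ 2.24 / 9 := by
    rw [abs_of_nonneg (by
      have := le_max_right (kap m * s) (s + gamma / dualNorm F y c)
      have : 0 < gamma / dualNorm F y c := by positivity
      linarith), ← le_div_iff₀ hp, sub_le_iff_le_add, max_le_iff]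
    constructor
    · rw [← sub_le_iff_le_add, le_div_iff₀ hp]
      have h6 : s * dualNorm F y c ≤ |s| * dualNorm F y c :=
        mul_le_mul_of_nonneg_right (le_abs_self s) hp.le
      have h7 : s * dualNorm F y c ≤ (1 + 9 * Real.sqrt ν) / 9 := by
        unfold beta at h2; linarith
      calc (kap m * s - s) * dualNorm F y c = (kap m - 1) * (s * dualNorm F y c) := by ring
        _ ≤ (kap m - 1) * ((1 + 9 * Real.sqrt ν) / 9) := by
          apply mul_le_mul_of_nonneg_left h7; linarith
        _ ≤ _ := by linarith
    · rw [add_comm]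
      gcongr
      unfold gamma; norm_num
  unfold beta at h
  linarith

/-- Two successful trials of the adaptive main scheme cover one short step. -/
theorem main_two_trials {c x₀ y₀ : Vec n} (hc : c ≠ 0) (hν : 1 ≤ ν) (hx₀ : x₀ ∈ interior Q)
    (h₀ : dualNorm F x₀ (gradient F x₀) ≤ beta) {a i k : ℕ} {s : ℝ} {y : Vec n} {m : ℕ}
    (h : AcceptedAt Q F c (mainRule F c) 0 y₀ k s y m)
    (hs : (shortMain F c x₀ i).1 ≤ s) (hk : k ≤ a + 8 * m)
    (hm : (2 : ℝ) ^ m ≤ 4 * (1.27 * (1 + 9 * Real.sqrt ν))) :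
    ∃ k' s' y' m', AcceptedAt Q F c
        (mainRule F c) 0 y₀ k' s' y' m' ∧
      (shortMain F c x₀ (i + 1)).1 ≤ s' ∧ k' ≤ a + 22 + 8 * m' ∧
      (2 : ℝ) ^ m' ≤ 4 * (1.27 * (1 + 9 * Real.sqrt ν)) ∧
      (k' : ℝ) ≤ a + 30 + 8 * (Real.log (1.27 * (1 + 9 * Real.sqrt ν)) / Real.log 2) := by
  have hW := ten_le_one_add_nine_sqrt hν
  obtain ⟨k₁, m₁, y₁, p₁, h1, -, -, hk1, hm1, -⟩ := hB.successful_trial (next := mainRule F c)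
    (B := 1.27 * (1 + 9 * Real.sqrt ν)) (by linarith)
    (fun s y m hy hs hm => hB.mainRule_small hc hν hy hs hm) h hk hm
  obtain ⟨k₂, m₂, y₂, p₂, h2, -, -, hk2, hm2, hk2'⟩ := hB.successful_trial (next := mainRule F c)
    (B := 1.27 * (1 + 9 * Real.sqrt ν)) (by linarith)
    (fun s y m hy hs hm => hB.mainRule_small hc hν hy hs hm) h1 hk1 hm1
  refine ⟨k₂, _, y₂, m₂, h2, ?_, by omega, hm2, by push_cast at hk2'; linarith⟩
  obtain ⟨hxi, hci⟩ := hB.shortMain_center (c := c) hx₀ h₀ i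
  have hstep : (shortMain F c x₀ (i + 1)).1 =
      (shortMain F c x₀ i).1 + gamma / dualNorm F (shortMain F c x₀ i).2 c := rfl
  rw [hstep]
  have e1 : s + gamma / dualNorm F y c ≤ mainRule F c (kap p₁) s y := le_max_right _ _
  set s₁ := mainRule F c (kap p₁) s y
  have e2 : s₁ + gamma / dualNorm F y₁ c ≤ mainRule F c (kap p₂) s₁ y₁ := le_max_right _ _
  have g1 : 0 < gamma / dualNorm F y c :=
    div_pos (by unfold gamma; norm_num) (hB.dualNorm_pos h.mem hc)
  have g2 : 0 < gamma / dualNorm F y₁ c :=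
    div_pos (by unfold gamma; norm_num) (hB.dualNorm_pos h1.mem hc)
  refine le_trans ?_ e2
  rcases hB.half_step hc hxi h.mem hci h.accepted hs with f1 | f1
  · linarith
  rcases hB.half_step hc hxi h1.mem hci h1.accepted (by linarith) with f2 | f2 <;> linarith

/-- `2 (p + 1)` successful trials cover `p + 1` short steps. The last bound does not contain the
exponent `m'`: it charges `8 m` only at the last trial. -/
theorem main_many_trials {c x₀ y₀ : Vec n} (hc : c ≠ 0) (hν : 1 ≤ ν) (hx₀ : x₀ ∈ interior Q)
    (h₀ : dualNorm F x₀ (gradient F x₀) ≤ beta) {a i k : ℕ} {s : ℝ} {y : Vec n} {m : ℕ}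
    (h : AcceptedAt Q F c (mainRule F c) 0 y₀ k s y m)
    (hs : (shortMain F c x₀ i).1 ≤ s) (hk : k ≤ a + 8 * m)
    (hm : (2 : ℝ) ^ m ≤ 4 * (1.27 * (1 + 9 * Real.sqrt ν))) (p : ℕ) :
    ∃ k' s' y' m', AcceptedAt Q F c
        (mainRule F c) 0 y₀ k' s' y' m' ∧
      (shortMain F c x₀ (i + (p + 1))).1 ≤ s' ∧ k' ≤ a + 22 * (p + 1) + 8 * m' ∧
      (2 : ℝ) ^ m' ≤ 4 * (1.27 * (1 + 9 * Real.sqrt ν)) ∧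
      (k' : ℝ) ≤ a + 22 * p + 30 +
        8 * (Real.log (1.27 * (1 + 9 * Real.sqrt ν)) / Real.log 2) := by
  induction p with
  | zero => simpa using hB.main_two_trials hc hν hx₀ h₀ h hs hk hm
  | succ p ih =>
    obtain ⟨k₁, s₁, y₁, m₁, h1, hs1, hk1, hm1, -⟩ := ih
    obtain ⟨k₂, s₂, y₂, m₂, h2, hs2, hk2, hm2, hk2'⟩ :=
      hB.main_two_trials hc hν hx₀ h₀ h1 hs1 hk1 hm1
    exact ⟨k₂, s₂, y₂, m₂, h2, hs2, by omega, hm2, by push_cast at hk2' ⊢; linarith⟩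

/-- At `t = 0` the step factor `κ` has no effect, so the first step is a short step. -/
theorem main_first_trial {c y₀ : Vec n} (hc : c ≠ 0) (hy₀ : y₀ ∈ interior Q)
    (h₀ : dualNorm F y₀ (gradient F y₀) ≤ beta) :
    ∃ y, AcceptedAt Q F c (mainRule F c) 0 y₀ 1
      (gamma / dualNorm F y₀ c) y 0 := by
  have hp := hB.dualNorm_pos hy₀ hc
  have hγ : 0 < gamma := by unfold gamma; norm_num
  have hstart : AcceptedAt Q F c (mainRule F c) 0 y₀ 0
      0 y₀ 0 := acceptedAt_zero hy₀ (by simpa using h₀)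
  have hnext : mainRule F c (kap 0) 0 y₀ = gamma / dualNorm F y₀ c := by
    rw [mainRule, mul_zero, zero_add, max_eq_right (by positivity)]
  have hdec : dualNorm F y₀ ((gamma / dualNorm F y₀ c) • c + gradient F y₀) ≤ 1 / 4 := by
    have h1 := hB.decrement_le_add hy₀ c 0 (gamma / dualNorm F y₀ c)
    rw [sub_zero, abs_of_pos (by positivity), div_mul_cancel₀ _ hp.ne', zero_smul, zero_add] at h1
    unfold beta at h₀
    unfold gamma at h1
    unfold gamma
    linarith
  rcases hB.trial hstart with ⟨j, y', m', hacc, -, -, hj2, hj0, -⟩ | ⟨-, hlt⟩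
  · rw [hnext] at hacc hj0
    have hj := hj0 hdec
    subst hj
    have := hj2 (by norm_num)
    subst this
    exact ⟨y', hacc⟩
  · rw [hnext] at hlt
    linarith

/-- Main phases from a common starting point: the first steps agree, and `2 (N - 1)` further
successful trials cover the other short steps. -/
theorem adaptiveMain_reach {c x₀ : Vec n} (hc : c ≠ 0) (hν : 1 ≤ ν) (hx₀ : x₀ ∈ interior Q)
    (h₀ : dualNorm F x₀ (gradient F x₀) ≤ beta) {N : ℕ} (hN : 1 ≤ N) :
    ∃ k, (shortMain F c x₀ N).1 ≤ (adaptiveMain Q F c x₀ k).t ∧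
      Accepted F c (adaptiveMain Q F c x₀ k) ∧ (k : ℝ) ≤ adaptiveFactor ν * N := by
  have hW := ten_le_one_add_nine_sqrt hν
  have hL := le_log_one_add_nine_sqrt hν
  have hlog := mul_log_div_log_two_le (a := 1.27) (by norm_num) hW
  obtain ⟨y, hy⟩ := hB.main_first_trial hc hx₀ h₀
  have hs : (shortMain F c x₀ 1).1 ≤ gamma / dualNorm F x₀ c := by
    change 0 + gamma / dualNorm F x₀ c ≤ _
    rw [zero_add]
  unfold adaptiveFactor
  obtain ⟨p, rfl⟩ : ∃ p, N = 1 + p := ⟨N - 1, by omega⟩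
  cases p with
  | zero =>
    obtain ⟨e1, e2⟩ := accepted_of_acceptedAt hy
    refine ⟨1, by rw [e1]; exact hs, e2, ?_⟩
    push_cast
    linarith
  | succ p =>
    obtain ⟨k, s, y', m, h1, hs1, -, -, hk⟩ := hB.main_many_trials hc hν hx₀ h₀ hy hs
      (a := 1) (by norm_num) (by rw [pow_zero]; linarith) p
    obtain ⟨e1, e2⟩ := accepted_of_acceptedAt h1
    refine ⟨k, by rw [e1]; exact hs1, e2, ?_⟩
    push_cast at hk ⊢
    have hp : (0 : ℝ) ≤ p := Nat.cast_nonneg p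
    nlinarith [mul_nonneg hp (sub_nonneg.2 hL)]

/-- Main phases from different starting points, when both spend one more step before. The first
adaptive success need not reach the first short step, so one more success is used; the additional
step on both sides, in the complete algorithms the step to `x̄`, pays for it. -/
theorem adaptiveMain_reach_other {c x₀ y₀ : Vec n} (hc : c ≠ 0) (hν : 1 ≤ ν)
    (hx₀ : x₀ ∈ interior Q) (h₀ : dualNorm F x₀ (gradient F x₀) ≤ beta)
    (hy₀ : y₀ ∈ interior Q) (h₀' : dualNorm F y₀ (gradient F y₀) ≤ beta) {N : ℕ} (hN : 1 ≤ N) :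
    ∃ k, (shortMain F c x₀ N).1 ≤ (adaptiveMain Q F c y₀ k).t ∧
      Accepted F c (adaptiveMain Q F c y₀ k) ∧ (k : ℝ) + 1 ≤ adaptiveFactor ν * (N + 1) := by
  have hW := ten_le_one_add_nine_sqrt hν
  have hL := le_log_one_add_nine_sqrt hν
  have hlog := mul_log_div_log_two_le (a := 1.27) (by norm_num) hW
  obtain ⟨y, hy⟩ := hB.main_first_trial hc hy₀ h₀'
  obtain ⟨k₂, m₂, y₂, p₂, h2, -, -, hk2, hm2, hk2'⟩ := hB.successful_trial (a := 1)
    (next := mainRule F c) (B := 1.27 * (1 + 9 * Real.sqrt ν)) (by linarith)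
    (fun s y m hy hs hm => hB.mainRule_small hc hν hy hs hm) hy (by norm_num)
    (by rw [pow_zero]; linarith)
  have hs2 : (shortMain F c x₀ 1).1 ≤
      mainRule F c (kap p₂) (gamma / dualNorm F y₀ c) y := by
    refine le_trans ?_ (le_max_right _ _)
    have g0 : 0 < gamma / dualNorm F y₀ c :=
      div_pos (by unfold gamma; norm_num) (hB.dualNorm_pos hy₀ hc)
    have g1 : 0 < gamma / dualNorm F y c :=
      div_pos (by unfold gamma; norm_num) (hB.dualNorm_pos hy.mem hc)
    have hz : ∀ x : Vec n, dualNorm F x (gradient F x) ≤ beta →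
        dualNorm F x ((0 : ℝ) • c + gradient F x) ≤ beta := fun x hx => by simpa using hx
    change 0 + gamma / dualNorm F x₀ c ≤ _
    rcases hB.half_step hc hx₀ hy₀ (hz _ h₀) (hz _ h₀') le_rfl with f1 | f1
    · linarith
    rcases hB.half_step hc hx₀ hy.mem (hz _ h₀) hy.accepted g0.le with f2 | f2 <;> linarith
  unfold adaptiveFactor
  obtain ⟨p, rfl⟩ : ∃ p, N = 1 + p := ⟨N - 1, by omega⟩
  cases p with
  | zero =>
    obtain ⟨e1, e2⟩ := accepted_of_acceptedAt h2
    refine ⟨k₂, by rw [e1]; exact hs2, e2, ?_⟩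
    push_cast at hk2' ⊢
    linarith
  | succ p =>
    obtain ⟨k, s, y', m, h1, hs1, -, -, hk⟩ := hB.main_many_trials hc hν hx₀ h₀ h2 hs2
      (a := 12) (by omega) hm2 p
    obtain ⟨e1, e2⟩ := accepted_of_acceptedAt h1
    refine ⟨k, by rw [e1]; exact hs1, e2, ?_⟩
    push_cast at hk ⊢
    have hp : (0 : ℝ) ≤ p := Nat.cast_nonneg p
    nlinarith [mul_nonneg hp (sub_nonneg.2 hL)]

end BoundedBarrier
end Barrier

namespace Barrier

variable {n : ℕ}

/-! ### The auxiliary phase up to the last short step -/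

/-- The rule of the adaptive auxiliary scheme for the new barrier parameter at an accepted pair. -/
noncomputable def auxRule (F : Vec n → ℝ) (G : Vec n) (κ t : ℝ) (x : Vec n) : ℝ :=
  min (t / κ) (t - gamma / dualNorm F x G)

theorem auxStop_iff {F : Vec n → ℝ} {x : Vec n} :
    AuxStop F x ↔ dualNorm F x (gradient F x) ≤ 1 / 4 := by
  have h : Real.sqrt beta = 1 / 3 := by
    rw [beta, show (1 / 9 : ℝ) = (1 / 3) ^ 2 by norm_num, Real.sqrt_sq (by norm_num)]
  rw [AuxStop, h]
  norm_num

theorem gamma_pos : 0 < gamma := by unfold gamma; norm_num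

/-- The parameter `s` is positive as long as the auxiliary scheme has not stopped before `k`. -/
def PositiveUnlessStopped (Q : Set (Vec n)) (F : Vec n → ℝ) (G x₀ : Vec n) (k : ℕ) (s : ℝ) :
    Prop :=
  (∀ j < k, ¬ AuxStop F (adaptiveRun Q F G (auxRule F G) 1 x₀ j).x) → 0 < s

theorem auxRule_le_sub (F : Vec n → ℝ) (G : Vec n) (κ t : ℝ) (x : Vec n) :
    auxRule F G κ t x ≤ t - gamma / dualNorm F x G := min_le_right _ _

theorem auxRule_le_div (F : Vec n → ℝ) (G : Vec n) (κ t : ℝ) (x : Vec n) :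
    auxRule F G κ t x ≤ t / κ := min_le_left _ _

theorem AcceptedAt.not_auxStop {Q : Set (Vec n)} {F : Vec n → ℝ} {G x₀ : Vec n} {k : ℕ} {s : ℝ}
    {y : Vec n} {m : ℕ}
    (h : AcceptedAt Q F G (auxRule F G) 1 x₀ k s y m)
    (hns : ¬ AuxStop F (adaptiveRun Q F G (auxRule F G) 1 x₀ k).x) : ¬ AuxStop F y := by
  rwa [h.x_eq] at hns

theorem acceptedAt_aux_zero {Q : Set (Vec n)} {F : Vec n → ℝ} {x₀ : Vec n} (hx₀ : x₀ ∈ interior Q) :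
    AcceptedAt Q F (-gradient F x₀) (auxRule F (-gradient F x₀)) 1 x₀ 0 1 x₀ 0 :=
  acceptedAt_zero hx₀ (by
    rw [one_smul, neg_add_cancel, dualNorm_zero]; unfold beta; norm_num)

namespace BoundedBarrier

variable {Q : Set (Vec n)} {F : Vec n → ℝ} {ν : ℝ} (hB : BoundedBarrier Q F ν)
include hB

theorem gradient_le_decrement_add {x : Vec n} (hx : x ∈ interior Q) (G : Vec n) (t : ℝ) :
    dualNorm F x (gradient F x) ≤
      dualNorm F x (t • G + gradient F x) + |t| * dualNorm F x G := by
  have := hB.decrement_le_add hx G t 0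
  rwa [zero_smul, zero_add, zero_sub, abs_neg] at this

/-- As long as the stopping rule fails, the short step `γ / ‖G‖*` is less than `t`; so the parameter
of the auxiliary phase stays positive. -/
theorem gamma_lt_of_not_auxStop {x : Vec n} (hx : x ∈ interior Q) {G : Vec n} {t : ℝ} (ht : 0 < t)
    (h : dualNorm F x (t • G + gradient F x) ≤ beta) (hs : ¬ AuxStop F x) :
    gamma < t * dualNorm F x G := by
  rw [auxStop_iff, not_le] at hs
  have := hB.gradient_le_decrement_add hx G t
  rw [abs_of_pos ht] at this
  unfold beta at h
  unfold gamma
  linarith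

theorem shortAux_center {x₀ : Vec n} (hx₀ : x₀ ∈ interior Q) (k : ℕ) :
    (shortAux F x₀ k).2 ∈ interior Q ∧
      dualNorm F (shortAux F x₀ k).2 ((shortAux F x₀ k).1 • (-gradient F x₀) +
        gradient F (shortAux F x₀ k).2) ≤ beta := by
  refine hB.shortRun_center (fun t x hx => ?_) hx₀ ?_ k
  · rw [sub_sub_cancel_left, abs_neg]
    rcases eq_or_ne (-gradient F x₀) 0 with h0 | hG
    · rw [h0, dualNorm_zero, mul_zero]; exact gamma_pos.le
    · have := hB.dualNorm_pos hx hG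
      rw [abs_of_nonneg (div_pos gamma_pos this).le, div_mul_cancel₀ _ this.ne']
  · rw [one_smul, neg_add_cancel, dualNorm_zero]
    unfold beta; norm_num

theorem shortAux_pos {x₀ : Vec n} (hx₀ : x₀ ∈ interior Q) {k : ℕ}
    (h : ∀ j < k, ¬ AuxStop F (shortAux F x₀ j).2) : 0 < (shortAux F x₀ k).1 := by
  induction k with
  | zero => exact one_pos
  | succ k ih =>
    have ht := ih fun j hj => h j (by omega)
    obtain ⟨hm, hc⟩ := hB.shortAux_center hx₀ k
    have h1 := hB.gamma_lt_of_not_auxStop hm ht hc (h k (by omega))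
    have hp : 0 < dualNorm F (shortAux F x₀ k).2 (-gradient F x₀) :=
      pos_of_mul_pos_right (gamma_pos.trans h1) ht.le
    change 0 < (shortAux F x₀ k).1 - gamma / dualNorm F (shortAux F x₀ k).2 (-gradient F x₀)
    rw [sub_pos, div_lt_iff₀ hp]
    exact h1

theorem auxRule_decrement_le {G : Vec n} {s A : ℝ} {y : Vec n} {m : ℕ} (hy : y ∈ interior Q)
    (h : dualNorm F y (s • G + gradient F y) ≤ beta) (hA : s * dualNorm F y G ≤ A)
    (hAm : (1 - (kap m)⁻¹) * A ≤ 2.24 / 9) :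
    dualNorm F y (auxRule F G (kap m) s y • G + gradient F y) ≤ 0.36 := by
  have h1 := hB.decrement_le_add hy G s (auxRule F G (kap m) s y)
  have h5 : |auxRule F G (kap m) s y - s| * dualNorm F y G ≤ 2.24 / 9 := by
    rcases eq_or_lt_of_le (dualNorm_nonneg F y G) with h0 | hp
    · rw [← h0, mul_zero]; norm_num
    have hle := auxRule_le_sub F G (kap m) s y
    have hg : 0 < gamma / dualNorm F y G := div_pos gamma_pos hp
    rw [abs_sub_comm, abs_of_nonneg (by linarith), ← le_div_iff₀ hp, sub_le_comm,
      auxRule, le_min_iff]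
    constructor
    · rw [sub_le_comm, le_div_iff₀ hp]
      have hk : (kap m)⁻¹ ≤ 1 := inv_le_one_of_one_le₀ (one_lt_kap m).le
      calc (s - s / kap m) * dualNorm F y G = (1 - (kap m)⁻¹) * (s * dualNorm F y G) := by
            rw [div_eq_mul_inv]; ring
        _ ≤ (1 - (kap m)⁻¹) * A := mul_le_mul_of_nonneg_left hA (by linarith)
        _ ≤ _ := hAm
    · gcongr
      unfold gamma; norm_num
  unfold beta at h
  linarith

/-- With a small step factor, the first Newton decrement of a trial is at most `0.36`. -/
theorem auxRule_small {G : Vec n} (hν : 1 ≤ ν) {s : ℝ} {y : Vec n} {m : ℕ}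
    (hy : y ∈ interior Q) (h : dualNorm F y (s • G + gradient F y) ≤ beta)
    (hm : 1.035 * (1 + 9 * Real.sqrt ν) ≤ 2 ^ m) :
    dualNorm F y (auxRule F G (kap m) s y • G + gradient F y) ≤ 0.36 := by
  have h2 := hB.abs_mul_dualNorm_le hy h
  have h3 := one_sub_inv_kap_le (ten_le_one_add_nine_sqrt hν) hm
  refine hB.auxRule_decrement_le hy h (A := (1 + 9 * Real.sqrt ν) / 9) ?_ (by linarith)
  have h6 : s * dualNorm F y G ≤ |s| * dualNorm F y G :=
    mul_le_mul_of_nonneg_right (le_abs_self s) (dualNorm_nonneg _ _ _)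
  unfold beta at h2
  linarith

/-- `half_step` for a decreasing parameter. -/
theorem half_step_down {G x y : Vec n} (hG : G ≠ 0) (hx : x ∈ interior Q) (hy : y ∈ interior Q)
    {t s : ℝ} (hxt : dualNorm F x (t • G + gradient F x) ≤ beta)
    (hys : dualNorm F y (s • G + gradient F y) ≤ beta) (hts : s ≤ t) :
    s ≤ t - gamma / dualNorm F x G ∨
      gamma / dualNorm F x G / 2 ≤ gamma / dualNorm F y G := by
  have hneg : ∀ v : Vec n, dualNorm F v (-G) = dualNorm F v G := by
    intro v
    rw [← neg_one_smul ℝ, dualNorm_smul]; simp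
  have h := hB.half_step (neg_ne_zero.2 hG) hx hy (t := -t) (s := -s) (by simpa using hxt)
    (by simpa using hys) (by linarith)
  rw [hneg, hneg] at h
  exact h.imp (fun h => by linarith) id

theorem auxRule_pos {G : Vec n} {s : ℝ} {y : Vec n} (m : ℕ) (hy : y ∈ interior Q)
    (h : dualNorm F y (s • G + gradient F y) ≤ beta) (hs : 0 < s) (hns : ¬ AuxStop F y) :
    0 < auxRule F G (kap m) s y := by
  have h1 := hB.gamma_lt_of_not_auxStop hy hs h hns
  have hp : 0 < dualNorm F y G := pos_of_mul_pos_right (gamma_pos.trans h1) hs.le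
  refine lt_min (div_pos hs (kap_pos m)) ?_
  rw [sub_pos, div_lt_iff₀ hp]
  exact h1

theorem positive_next {G x₀ : Vec n} {k k' : ℕ} {s : ℝ} {y : Vec n} {m p : ℕ}
    (h : AcceptedAt Q F G (auxRule F G) 1 x₀ k s y m)
    (hpos : PositiveUnlessStopped Q F G x₀ k s) (hk : k < k') :
    PositiveUnlessStopped Q F G x₀ k' (auxRule F G (kap p) s y) := by
  intro hns
  exact hB.auxRule_pos p h.mem h.accepted (hpos fun j hj => hns j (hj.trans hk))
    (h.not_auxStop (hns k hk))

/-- Two successful trials of the adaptive auxiliary scheme cover one short step. -/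
theorem aux_two_trials {x₀ : Vec n} (hG : -gradient F x₀ ≠ 0) (hν : 1 ≤ ν) (hx₀ : x₀ ∈ interior Q)
    {a i k : ℕ} {s : ℝ} {y : Vec n} {m : ℕ}
    (h : AcceptedAt Q F (-gradient F x₀) (auxRule F (-gradient F x₀)) 1 x₀ k s y m)
    (hpos : PositiveUnlessStopped Q F (-gradient F x₀) x₀ k s)
    (hs : s ≤ (shortAux F x₀ i).1) (hk : k ≤ a + 8 * m)
    (hm : (2 : ℝ) ^ m ≤ 4 * (1.035 * (1 + 9 * Real.sqrt ν))) :
    ∃ k' s' y' m', AcceptedAt Q F (-gradient F x₀) (auxRule F (-gradient F x₀)) 1 x₀ k' s' y' m' ∧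
      PositiveUnlessStopped Q F (-gradient F x₀) x₀ k' s' ∧
      s' ≤ (shortAux F x₀ (i + 1)).1 ∧ k' ≤ a + 22 + 8 * m' ∧
      (2 : ℝ) ^ m' ≤ 4 * (1.035 * (1 + 9 * Real.sqrt ν)) ∧
      (k' : ℝ) ≤ a + 30 + 8 * (Real.log (1.035 * (1 + 9 * Real.sqrt ν)) / Real.log 2) := by
  have hW := ten_le_one_add_nine_sqrt hν
  obtain ⟨hxi, hci⟩ := hB.shortAux_center hx₀ i
  have hstep : (shortAux F x₀ (i + 1)).1 = (shortAux F x₀ i).1 -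
      gamma / dualNorm F (shortAux F x₀ i).2 (-gradient F x₀) := rfl
  rw [hstep]
  set G := -gradient F x₀
  obtain ⟨k₁, m₁, y₁, p₁, h1, hlt1, -, hk1, hm1, -⟩ := hB.successful_trial (next := auxRule F G)
    (B := 1.035 * (1 + 9 * Real.sqrt ν)) (by linarith)
    (fun s y m hy hs hm => hB.auxRule_small hν hy hs hm) h hk hm
  obtain ⟨k₂, m₂, y₂, p₂, h2, hlt2, -, hk2, hm2, hk2'⟩ := hB.successful_trial (next := auxRule F G)
    (B := 1.035 * (1 + 9 * Real.sqrt ν)) (by linarith)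
    (fun s y m hy hs hm => hB.auxRule_small hν hy hs hm) h1 hk1 hm1
  refine ⟨k₂, _, y₂, m₂, h2, hB.positive_next h1 (hB.positive_next h hpos hlt1) hlt2, ?_, by omega,
    hm2, by push_cast at hk2'; linarith⟩
  have e1 := auxRule_le_sub F G (kap p₁) s y
  set s₁ := auxRule F G (kap p₁) s y
  have e2 := auxRule_le_sub F G (kap p₂) s₁ y₁
  have g1 : 0 < gamma / dualNorm F y G := div_pos gamma_pos (hB.dualNorm_pos h.mem hG)
  have g2 : 0 < gamma / dualNorm F y₁ G := div_pos gamma_pos (hB.dualNorm_pos h1.mem hG)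
  refine e2.trans ?_
  rcases hB.half_step_down hG hxi h.mem hci h.accepted hs with f1 | f1
  · linarith
  rcases hB.half_step_down hG hxi h1.mem hci h1.accepted (by linarith) with f2 | f2 <;> linarith

/-- `2 p + 1` successful trials cover `p + 1` short steps: both methods start at `x₀`, and the first
adaptive step is at least as long as the short one. -/
theorem aux_many_trials {x₀ : Vec n} (hG : -gradient F x₀ ≠ 0) (hν : 1 ≤ ν)
    (hx₀ : x₀ ∈ interior Q) (p : ℕ) :
    ∃ k s y m, AcceptedAt Q F (-gradient F x₀) (auxRule F (-gradient F x₀)) 1 x₀ k s y m ∧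
      PositiveUnlessStopped Q F (-gradient F x₀) x₀ k s ∧
      s ≤ (shortAux F x₀ (p + 1)).1 ∧ k ≤ 11 + 22 * p + 8 * m ∧
      (2 : ℝ) ^ m ≤ 4 * (1.035 * (1 + 9 * Real.sqrt ν)) ∧
      (k : ℝ) ≤ 22 * p + 19 + 8 * (Real.log (1.035 * (1 + 9 * Real.sqrt ν)) / Real.log 2) := by
  have hW := ten_le_one_add_nine_sqrt hν
  induction p with
  | zero =>
    obtain ⟨k₁, m₁, y₁, p₁, h1, hlt1, -, hk1, hm1, hk1'⟩ := hB.successful_trial (a := 0)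
      (next := auxRule F (-gradient F x₀)) (B := 1.035 * (1 + 9 * Real.sqrt ν)) (by linarith)
      (fun s y m hy hs hm => hB.auxRule_small hν hy hs hm) (acceptedAt_aux_zero hx₀) le_rfl
      (by rw [pow_zero]; linarith)
    refine ⟨k₁, _, y₁, m₁, h1,
      hB.positive_next (acceptedAt_aux_zero hx₀) (fun _ => one_pos) hlt1,
      auxRule_le_sub _ _ _ _ _, by omega, hm1, by push_cast at hk1' ⊢; linarith⟩
  | succ p ih =>
    obtain ⟨k₁, s₁, y₁, m₁, h1, hp1, hs1, hk1, hm1, -⟩ := ih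
    obtain ⟨k₂, s₂, y₂, m₂, h2, hp2, hs2, hk2, hm2, hk2'⟩ :=
      hB.aux_two_trials hG hν hx₀ h1 hp1 hs1 hk1 hm1
    exact ⟨k₂, s₂, y₂, m₂, h2, hp2, hs2, by omega, hm2, by push_cast at hk2' ⊢; linarith⟩

end BoundedBarrier

/-! ### The end of the auxiliary phase -/

/-- The last iterate `X` of the short-step auxiliary scheme, with its parameter `T`. -/
structure AuxTarget (Q : Set (Vec n)) (F : Vec n → ℝ) (G X : Vec n) (T : ℝ) : Prop where
  mem : X ∈ interior Q
  pos : 0 < T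
  auxStop : AuxStop F X
  center : dualNorm F X (T • G + gradient F X) ≤ beta

theorem le_inv_kap_one : 0.3162 ≤ (kap 1)⁻¹ := by
  have h1 := kap_succ_sq 0
  rw [kap_zero] at h1
  have h2 := kap_pos 1
  rw [le_inv_comm₀ (by norm_num) h2]
  norm_num at h1 ⊢
  nlinarith

theorem le_inv_kap_two : 0.562 ≤ (kap 2)⁻¹ := by
  have h1 := kap_succ_sq 1
  have h2 := kap_pos 2
  have h3 : kap 1 ≤ 0.3162⁻¹ := (le_inv_comm₀ (by norm_num) (kap_pos 1)).1 le_inv_kap_one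
  rw [le_inv_comm₀ (by norm_num) h2]
  norm_num at h1 h3 ⊢
  nlinarith

theorem two_le_kap_one : 2 ≤ kap 1 := by
  have h1 := kap_succ_sq 0
  rw [kap_zero] at h1
  have h2 := kap_pos 1
  norm_num at h1
  nlinarith

theorem inv_kap_mono {m m' : ℕ} (h : m ≤ m') : (kap m)⁻¹ ≤ (kap m')⁻¹ :=
  inv_anti₀ (kap_pos m') (kap_anti h)

namespace BoundedBarrier

variable {Q : Set (Vec n)} {F : Vec n → ℝ} {ν : ℝ} (hB : BoundedBarrier Q F ν)
include hB

/-- For `s ≤ θ T`, `s ‖G‖*_y` at an approximate center `y` is bounded in terms of `T ‖G‖*_X`: the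
decrement of `X` for the parameter `ϑ T`, `ϑ ≤ 1`, is at most `ϑ/9 + (1 - ϑ)/4`. -/
theorem mul_dualNorm_le_of_auxTarget {G X y : Vec n} {T s θ P : ℝ} (hX : AuxTarget Q F G X T)
    (hy : y ∈ interior Q) (h : dualNorm F y (s • G + gradient F y) ≤ beta) (hs : 0 < s)
    (hsθ : s ≤ θ * T) (hθ : θ ≤ 1) (hP : T * dualNorm F X G ≤ P) :
    s * dualNorm F y G ≤ P * (8 / 7) * (θ * (27 + 5 * θ) / (18 + 10 * θ)) := by
  obtain ⟨ϑ, hϑ⟩ : ∃ ϑ, s = ϑ * T := ⟨s / T, (div_mul_cancel₀ _ hX.pos.ne').symm⟩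
  have hϑθ : ϑ ≤ θ := by
    rw [hϑ] at hsθ; exact le_of_mul_le_mul_right hsθ hX.pos
  have hϑ0 : 0 < ϑ := by
    rw [hϑ] at hs; exact pos_of_mul_pos_left hs hX.pos.le
  have hdec : dualNorm F X (s • G + gradient F X) ≤ 1 / 4 - 5 / 36 * ϑ := by
    have h1 := hB.dualNorm_add_le hX.mem (ϑ • (T • G + gradient F X)) ((1 - ϑ) • gradient F X)
    rw [dualNorm_smul, dualNorm_smul, abs_of_pos hϑ0, abs_of_nonneg (by linarith),
      show ϑ • (T • G + gradient F X) + (1 - ϑ) • gradient F X =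
        s • G + gradient F X by rw [hϑ]; module] at h1
    have h2 := auxStop_iff.1 hX.auxStop
    have h3 := hX.center
    unfold beta at h3
    nlinarith
  have h1 := hB.dualNorm_le_of_decrement hX.mem hy (a := 1 / 4 - 5 / 36 * ϑ) (b := 1 / 9) hdec
    (by unfold beta at h; exact h) (by linarith) (by norm_num) G
  have e1 : (1 - (1 / 4 - 5 / 36 * ϑ)) / (1 - 2 * (1 / 4 - 5 / 36 * ϑ)) *
      ((1 - 1 / 9) / (1 - 2 * (1 / 9))) = 8 / 7 * ((27 + 5 * ϑ) / (18 + 10 * ϑ)) := by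
    rw [show 1 - (1 / 4 - 5 / 36 * ϑ) = (27 + 5 * ϑ) / 36 by ring,
      show 1 - 2 * (1 / 4 - 5 / 36 * ϑ) = (18 + 10 * ϑ) / 36 by ring,
      div_div_div_cancel_right₀ (by norm_num)]
    norm_num [mul_comm]
  rw [e1] at h1
  have hf : ϑ * ((27 + 5 * ϑ) / (18 + 10 * ϑ)) ≤ θ * (27 + 5 * θ) / (18 + 10 * θ) := by
    rw [← mul_div_assoc, div_le_div_iff₀ (by positivity) (by linarith)]
    nlinarith [mul_nonneg (sub_nonneg.2 hϑθ) hϑ0.le,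
      mul_nonneg (sub_nonneg.2 hϑθ) (hϑ0.le.trans hϑθ),
      mul_nonneg (mul_nonneg (sub_nonneg.2 hϑθ) hϑ0.le) (hϑ0.le.trans hϑθ)]
  have hf0 : 0 ≤ ϑ * ((27 + 5 * ϑ) / (18 + 10 * ϑ)) := by positivity
  have hTX : 0 ≤ T * dualNorm F X G := mul_nonneg hX.pos.le (dualNorm_nonneg _ _ _)
  calc s * dualNorm F y G ≤ s * (8 / 7 * ((27 + 5 * ϑ) / (18 + 10 * ϑ)) * dualNorm F X G) := by
        gcongr
    _ = T * dualNorm F X G * (8 / 7) * (ϑ * ((27 + 5 * ϑ) / (18 + 10 * ϑ))) := by rw [hϑ]; ring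
    _ ≤ P * (8 / 7) * (θ * (27 + 5 * θ) / (18 + 10 * θ)) :=
        mul_le_mul (by gcongr) hf hf0 (mul_nonneg (hTX.trans hP) (by norm_num))

theorem auxTarget_mul_dualNorm_le {G X : Vec n} {T : ℝ} (hX : AuxTarget Q F G X T) :
    T * dualNorm F X G ≤ 13 / 36 := by
  have h1 := hB.dualNorm_add_le hX.mem (T • G + gradient F X) ((-1 : ℝ) • gradient F X)
  rw [dualNorm_smul, show T • G + gradient F X + (-1 : ℝ) • gradient F X = T • G by module,
    dualNorm_smul, abs_of_pos hX.pos] at h1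
  simp only [abs_neg, abs_one, one_mul] at h1
  have h2 := auxStop_iff.1 hX.auxStop
  have h3 := hX.center
  unfold beta at h3
  linarith

/-- A trial with a small first Newton decrement, from an accepted pair that is not yet final. -/
theorem aux_fast_trial {G x₀ : Vec n} {k : ℕ} {s : ℝ} {y : Vec n} {m : ℕ} {A : ℝ}
    (h : AcceptedAt Q F G (auxRule F G) 1 x₀ k s y m) (hs : 0 < s) (hns : ¬ AuxStop F y)
    (hA : s * dualNorm F y G ≤ A) (hAm : (1 - (kap m)⁻¹) * A ≤ 2.24 / 9) :
    ∃ k' s' y', AcceptedAt Q F G (auxRule F G) 1 x₀ k' s' y' (m - 1) ∧ k' ≤ k + 3 ∧ 0 < s' ∧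
      s' ≤ s * (1 - gamma / A) ∧ s' ≤ s / kap m ∧ s' ≤ s - gamma / dualNorm F y G := by
  have hdec := hB.auxRule_decrement_le h.mem h.accepted hA hAm
  have hγ := hB.gamma_lt_of_not_auxStop h.mem hs h.accepted hns
  have hp : 0 < dualNorm F y G := pos_of_mul_pos_right (gamma_pos.trans hγ) hs.le
  rcases hB.trial h with ⟨j, y', m', hacc, -, -, hj2, -, hfast⟩ | ⟨-, hlt⟩
  · have hj := hfast hdec
    rw [hj2 hj] at hacc
    refine ⟨_, _, y', hacc, by omega, hB.auxRule_pos m h.mem h.accepted hs hns, ?_,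
      auxRule_le_div _ _ _ _ _, auxRule_le_sub _ _ _ _ _⟩
    refine (auxRule_le_sub _ _ _ _ _).trans ?_
    have hA0 : 0 < A := (gamma_pos.trans hγ).trans_le hA
    have : s * (gamma / A) ≤ gamma / dualNorm F y G := by
      rw [← mul_div_assoc, div_le_div_iff₀ hA0 hp]
      nlinarith [mul_le_mul_of_nonneg_left hA gamma_pos.le]
    linarith
  · linarith

/-- Once `s ≤ T / 2`, one fast trial brings `s ‖G‖*` below `γ`, whatever the step factor. -/
theorem aux_end_half {G x₀ X : Vec n} {T : ℝ} (hX : AuxTarget Q F G X T) {k : ℕ} {s : ℝ}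
    {y : Vec n} {m : ℕ} (h : AcceptedAt Q F G (auxRule F G) 1 x₀ k s y m) (hs : 0 < s)
    (hsT : s ≤ 0.5 * T) :
    ∃ j ≤ k + 3, AuxStop F (adaptiveRun Q F G (auxRule F G) 1 x₀ j).x := by
  by_contra hno
  push Not at hno
  have hP := hB.auxTarget_mul_dualNorm_le hX
  have hA := hB.mul_dualNorm_le_of_auxTarget hX h.mem h.accepted hs hsT (by norm_num) hP
  have hk : 0.1 ≤ (kap m)⁻¹ := by
    have := inv_kap_mono (Nat.zero_le m)
    rw [kap_zero] at this
    norm_num at this ⊢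
    linarith
  obtain ⟨k', s', y', h', hk', hs', hle, -, -⟩ := hB.aux_fast_trial h hs
    (h.not_auxStop (hno k (by omega))) (A := 0.265) (hA.trans (by norm_num)) (by linarith)
  have hA' := hB.mul_dualNorm_le_of_auxTarget hX h'.mem h'.accepted hs' (θ := 0.24)
    (by unfold gamma at hle; norm_num at hle ⊢; nlinarith [hX.pos]) (by norm_num) hP
  have := hB.gamma_lt_of_not_auxStop h'.mem hs' h'.accepted (h'.not_auxStop (hno k' hk'))
  unfold gamma at this
  norm_num at hA' this
  linarith

/-- If `s ≤ T` and the step factor is at most `10^{1/4}`, then two fast trials lead to `s ≤ T / 2`: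
the bounds `0.472` and `0.3555` on `s ‖G‖*` make short steps reduce `s` to `0.706 T` and `0.5 T`. -/
theorem aux_end_small_kap {G x₀ X : Vec n} {T : ℝ} (hX : AuxTarget Q F G X T) {k : ℕ} {s : ℝ}
    {y : Vec n} {m : ℕ} (h : AcceptedAt Q F G (auxRule F G) 1 x₀ k s y m) (hs : 0 < s)
    (hsT : s ≤ T) (hm : 2 ≤ m) :
    ∃ j ≤ k + 9, AuxStop F (adaptiveRun Q F G (auxRule F G) 1 x₀ j).x := by
  by_contra hno
  push Not at hno
  have hP := hB.auxTarget_mul_dualNorm_le hX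
  have hA := hB.mul_dualNorm_le_of_auxTarget hX h.mem h.accepted hs (θ := 1) (by linarith) le_rfl hP
  have hk := le_inv_kap_two.trans (inv_kap_mono hm)
  obtain ⟨k₁, s₁, y₁, h1, hk1, hs1, hle1, -, -⟩ := hB.aux_fast_trial h hs
    (h.not_auxStop (hno k (by omega))) (A := 0.472) (hA.trans (by norm_num)) (by linarith)
  have hs1T : s₁ ≤ 0.706 * T := by
    unfold gamma at hle1; norm_num at hle1 ⊢; linarith
  have hA1 := hB.mul_dualNorm_le_of_auxTarget hX h1.mem h1.accepted hs1 hs1T (by norm_num) hP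
  have hk := le_inv_kap_one.trans (inv_kap_mono (show 1 ≤ m - 1 by omega))
  obtain ⟨k₂, s₂, y₂, h2, hk2, hs2, hle2, -, -⟩ := hB.aux_fast_trial h1 hs1
    (h1.not_auxStop (hno k₁ (by omega))) (A := 0.3555) (hA1.trans (by norm_num)) (by linarith)
  obtain ⟨j, hj, hfin⟩ := hB.aux_end_half hX h2 hs2
    (by unfold gamma at hle2; norm_num at hle2 hs1T ⊢; linarith [hX.pos])
  exact hno j (by omega) hfin

/-- If `s ≤ T` and the step factor is at least `10^{1/2}`, then a success more than halves `s`, and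
a rejection makes the factor small. -/
theorem aux_end_large_kap {G x₀ X : Vec n} {T : ℝ} (hX : AuxTarget Q F G X T) {k : ℕ} {s : ℝ}
    {y : Vec n} {m : ℕ} (h : AcceptedAt Q F G (auxRule F G) 1 x₀ k s y m) (hs : 0 < s)
    (hsT : s ≤ T) (hm : m ≤ 1) :
    ∃ j ≤ k + 25, AuxStop F (adaptiveRun Q F G (auxRule F G) 1 x₀ j).x := by
  by_contra hno
  push Not at hno
  rcases hB.trial h with ⟨j, y', m', hacc, hj, -⟩ | ⟨hacc, -⟩
  · have hs' := hB.auxRule_pos m h.mem h.accepted hs (h.not_auxStop (hno k (by omega)))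
    have hle := auxRule_le_div F G (kap m) s y
    have hk := two_le_kap_one.trans (kap_anti hm)
    have hle2 : s / kap m ≤ s / 2 := div_le_div_of_nonneg_left hs.le (by norm_num) hk
    obtain ⟨i, hi, hfin⟩ := hB.aux_end_half hX hacc hs' (by norm_num; linarith)
    exact hno i (by omega) hfin
  · obtain ⟨i, hi, hfin⟩ := hB.aux_end_small_kap hX hacc hs hsT (by omega)
    exact hno i (by omega) hfin

/-- If the short-step auxiliary scheme stops after one step, then the starting point was so close
to the analytic center that the adaptive one rejects at most its first trial. -/
theorem aux_reach_one {x₀ : Vec n} (hx₀ : x₀ ∈ interior Q) (h0 : ¬ AuxStop F x₀)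
    (h1 : AuxStop F (shortAux F x₀ 1).2) :
    ∃ j ≤ 25, AuxStop F (adaptiveAux Q F x₀ j).x := by
  change ∃ j ≤ 25, AuxStop F
    (adaptiveRun Q F (-gradient F x₀) (auxRule F (-gradient F x₀)) 1 x₀ j).x
  have hT := hB.shortAux_pos hx₀ (k := 1) (fun j hj => by
    rw [Nat.lt_one_iff.1 hj]; exact h0)
  obtain ⟨hXm, hXc⟩ := hB.shortAux_center hx₀ 1
  have hX : AuxTarget Q F (-gradient F x₀) (shortAux F x₀ 1).2 (shortAux F x₀ 1).1 :=
    ⟨hXm, hT, h1, hXc⟩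
  have hTdef : (shortAux F x₀ 1).1 = 1 - gamma / dualNorm F x₀ (-gradient F x₀) := rfl
  have hXdef : (shortAux F x₀ 1).2 =
      x₀ + newtonDir F (-gradient F x₀) (shortAux F x₀ 1).1 x₀ := rfl
  have hδ : 1 / 4 < dualNorm F x₀ (-gradient F x₀) := by
    rw [← neg_one_smul ℝ, dualNorm_smul]
    rw [auxStop_iff] at h0
    simpa using h0
  set G := -gradient F x₀ with hG
  set T := (shortAux F x₀ 1).1
  set X := (shortAux F x₀ 1).2
  set δ := dualNorm F x₀ G
  have hgrad : gradient F x₀ = (-1 : ℝ) • G := by rw [hG]; module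
  have hδγ : gamma / δ * δ = gamma := div_mul_cancel₀ _ (by linarith)
  have hdec : dualNorm F x₀ (T • G + gradient F x₀) = gamma := by
    rw [hgrad, ← add_smul, dualNorm_smul, hTdef,
      show |1 - gamma / δ + -1| = gamma / δ by
        rw [show 1 - gamma / δ + -1 = -(gamma / δ) by ring, abs_neg,
          abs_of_pos (div_pos gamma_pos (by linarith))]]
    exact hδγ
  have hnewton := hB.newton_decrement hx₀ (d := G) (t := T) (by rw [hdec]; unfold gamma; norm_num)
  rw [hdec, ← hXdef] at hnewton
  have hcmp := hB.dualNorm_le_add hx₀ (u := newtonDir F G T x₀)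
    (by rw [hB.lnorm_newtonDir hx₀, hdec]; unfold gamma; norm_num) G
  rw [hB.lnorm_newtonDir hx₀, hdec, ← hXdef] at hcmp
  have hP : T * dualNorm F X G ≤ 0.2761 := by
    have e1 := hB.dualNorm_add_le hXm (T • G + gradient F X) ((-1 : ℝ) • gradient F X)
    rw [dualNorm_smul, show T • G + gradient F X + (-1 : ℝ) • gradient F X = T • G by module,
      dualNorm_smul, abs_of_pos hT] at e1
    simp only [abs_neg, abs_one, one_mul] at e1
    have e2 := auxStop_iff.1 h1
    unfold gamma at hnewton
    norm_num at hnewton e2 ⊢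
    linarith
  have hTδ : T * δ = δ - gamma := by rw [hTdef, sub_mul, one_mul, hδγ]
  have hδ2 : δ ≤ 0.46 := by
    have e1 := mul_le_mul_of_nonneg_left hcmp hT.le
    have e2 : T * (δ * (1 - gamma)) = (δ - gamma) * (1 - gamma) := by rw [← hTδ]; ring
    rw [e2] at e1
    unfold gamma at e1
    norm_num at e1 hP ⊢
    linarith
  by_contra hno
  push Not at hno
  have hstart : AcceptedAt Q F G (auxRule F G) 1 x₀ 0 1 x₀ 0 := acceptedAt_aux_zero hx₀
  rcases hB.trial hstart with ⟨j, y', m', hacc, hj, -⟩ | ⟨hacc, -⟩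
  · have hs' := hB.auxRule_pos 0 hx₀ hstart.accepted one_pos h0
    have hle := auxRule_le_div F G (kap 0) 1 x₀
    rw [kap_zero] at hle
    have hT4 : 0.4 ≤ T := by
      rw [hTdef, le_sub_comm, div_le_iff₀ (by linarith)]
      unfold gamma
      norm_num
      linarith
    obtain ⟨i, hi, hfin⟩ := hB.aux_end_half hX hacc hs' (by
      rw [kap_zero]; norm_num at hle hT4 ⊢; linarith)
    exact hno i (by omega) hfin
  · obtain ⟨k₁, s₁, y₁, h1', hk1, hs1, -, -, hle1⟩ := hB.aux_fast_trial hacc one_pos h0 (A := 0.46)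
      (by rw [one_mul]; exact hδ2) (by have := le_inv_kap_two; norm_num at this ⊢; linarith)
    have hP1 := hB.mul_dualNorm_le_of_auxTarget hX h1'.mem h1'.accepted hs1 (θ := 1) (by linarith)
      le_rfl hP
    obtain ⟨k₂, s₂, y₂, h2', hk2, hs2, -, hle2, -⟩ := hB.aux_fast_trial h1' hs1
      (h1'.not_auxStop (hno k₁ (by omega))) (A := 0.3607) (hP1.trans (by norm_num))
      (by have := le_inv_kap_one; norm_num at this ⊢; linarith)
    have hle3 : s₁ / kap (2 - 1) ≤ s₁ / 2 :=
      div_le_div_of_nonneg_left hs1.le (by norm_num) two_le_kap_one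
    obtain ⟨i, hi, hfin⟩ := hB.aux_end_half hX h2' hs2 (by norm_num; linarith)
    exact hno i (by omega) hfin

/-- The auxiliary phases, from a common starting point. -/
theorem adaptiveAux_reach {x₀ : Vec n} (hν : 1 ≤ ν) (hx₀ : x₀ ∈ interior Q) {N : ℕ}
    (hbefore : ∀ j < N, ¬ AuxStop F (shortAux F x₀ j).2) (hN : AuxStop F (shortAux F x₀ N).2) :
    ∃ k, AuxStop F (adaptiveAux Q F x₀ k).x ∧ (k : ℝ) ≤ adaptiveFactor ν * N := by
  have hW := ten_le_one_add_nine_sqrt hν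
  have hL := le_log_one_add_nine_sqrt hν
  have hlog := mul_log_div_log_two_le (a := 1.035) (by norm_num) hW
  have hT := hB.shortAux_pos hx₀ hbefore
  unfold adaptiveFactor
  rcases Nat.eq_zero_or_pos N with rfl | hN0
  · exact ⟨0, hN, by simp⟩
  have h0 : ¬ AuxStop F x₀ := hbefore 0 hN0
  have hG : -gradient F x₀ ≠ 0 := by
    intro hG
    refine h0 (auxStop_iff.2 ?_)
    rw [neg_eq_zero.1 hG, dualNorm_zero]
    norm_num
  obtain ⟨hXm, hXc⟩ := hB.shortAux_center hx₀ N
  have hX : AuxTarget Q F (-gradient F x₀) (shortAux F x₀ N).2 (shortAux F x₀ N).1 :=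
    ⟨hXm, hT, hN, hXc⟩
  obtain ⟨p, rfl⟩ : ∃ p, N = p + 1 := ⟨N - 1, by omega⟩
  cases p with
  | zero =>
    obtain ⟨j, hj, hfin⟩ := hB.aux_reach_one hx₀ h0 hN
    refine ⟨j, hfin, ?_⟩
    have : (j : ℝ) ≤ 25 := by exact_mod_cast hj
    push_cast
    linarith
  | succ p =>
    obtain ⟨k, s, y, m, h, hpos, hs, hk, -, hk'⟩ := hB.aux_many_trials hG hν hx₀ (p + 1)
    have hp : (0 : ℝ) ≤ p := Nat.cast_nonneg p
    by_cases hfin : ∃ j < k + 1, AuxStop F (adaptiveAux Q F x₀ j).x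
    · obtain ⟨j, hj, hfin⟩ := hfin
      refine ⟨j, hfin, ?_⟩
      have hjk : (j : ℝ) ≤ k := by exact_mod_cast Nat.lt_succ_iff.1 hj
      push_cast at hk' ⊢
      nlinarith [mul_nonneg hp (sub_nonneg.2 hL)]
    push Not at hfin
    have hs0 : 0 < s := hpos fun j hj => hfin j (by omega)
    rcases le_or_gt m 1 with hm | hm
    · obtain ⟨j, hj, hst⟩ := hB.aux_end_large_kap hX h hs0 hs hm
      refine ⟨j, hst, ?_⟩
      have hjk : (j : ℝ) ≤ 22 * p + 66 := by
        have : j ≤ 22 * p + 66 := by omega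
        exact_mod_cast this
      push_cast
      nlinarith [mul_nonneg hp (sub_nonneg.2 hL)]
    · obtain ⟨j, hj, hst⟩ := hB.aux_end_small_kap hX h hs0 hs hm
      refine ⟨j, hst, ?_⟩
      have hjk : (j : ℝ) ≤ k + 9 := by exact_mod_cast hj
      push_cast at hk' ⊢
      nlinarith [mul_nonneg hp (sub_nonneg.2 hL)]

end BoundedBarrier
end Barrier

namespace Barrier

variable {n : ℕ}

/-! ### Complexity of the short-step method -/

/-- The number of steps after which growth by the factor `1 + ρ`, `log (1 + ρ) ≥ 1 / W`, reaches
`A`. -/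
theorem exists_le_pow {W ρ A : ℝ} (hW : 0 < W) (hρ : 0 < ρ) (h : 1 / W ≤ Real.log (1 + ρ))
    (hA : 0 ≤ A) : ∃ k : ℕ, (k : ℝ) ≤ W * Real.posLog A + 1 ∧ A ≤ (1 + ρ) ^ k := by
  have h0 : 0 ≤ W * Real.posLog A := mul_nonneg hW.le Real.posLog_nonneg
  refine ⟨⌈W * Real.posLog A⌉₊, (Nat.ceil_lt_add_one h0).le, ?_⟩
  rcases eq_or_lt_of_le hA with h1 | h1
  · rw [← h1]; positivity
  rw [← Real.log_le_log_iff h1 (by positivity), Real.log_pow]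
  calc Real.log A ≤ Real.posLog A := le_max_right _ _
    _ = W * Real.posLog A * (1 / W) := by field_simp
    _ ≤ ⌈W * Real.posLog A⌉₊ * Real.log (1 + ρ) := by
      gcongr
      exact Nat.le_ceil _

theorem one_div_le_log {W : ℝ} (hW : 10 ≤ W) : 1 / W ≤ Real.log (1 + 1.25 / W) := by
  refine le_trans ?_ (Real.one_sub_inv_le_log_of_pos (by positivity))
  have h3 : 1 - (1 + 1.25 / W)⁻¹ = 1.25 / (W + 1.25) := by
    field_simp
    ring
  rw [h3, div_le_div_iff₀ (by positivity) (by positivity)]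
  linarith

namespace BoundedBarrier

variable {Q : Set (Vec n)} {F : Vec n → ℝ} {ν : ℝ} (hB : BoundedBarrier Q F ν)
include hB

/-- A short step changes the parameter `t` by at least the factor `1 ± γ / (β + √ν)`. -/
theorem mul_le_gamma_div {d x : Vec n} (hd : d ≠ 0) (hx : x ∈ interior Q) {t : ℝ}
    (h : dualNorm F x (t • d + gradient F x) ≤ beta) :
    t * (1.25 / (1 + 9 * Real.sqrt ν)) ≤ gamma / dualNorm F x d := by
  have h1 := hB.abs_mul_dualNorm_le hx h
  have h2 : t * dualNorm F x d ≤ |t| * dualNorm F x d :=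
    mul_le_mul_of_nonneg_right (le_abs_self t) (dualNorm_nonneg _ _ _)
  have hs := Real.sqrt_nonneg ν
  rw [← mul_div_assoc, div_le_div_iff₀ (by positivity) (hB.dualNorm_pos hx hd)]
  unfold beta at h1
  unfold gamma
  linarith

theorem shortMain_growth {c x₀ : Vec n} (hc : c ≠ 0) (hx₀ : x₀ ∈ interior Q)
    (h₀ : dualNorm F x₀ (gradient F x₀) ≤ beta) (k : ℕ) :
    gamma / dualNorm F x₀ c * (1 + 1.25 / (1 + 9 * Real.sqrt ν)) ^ k ≤
      (shortMain F c x₀ (k + 1)).1 := by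
  induction k with
  | zero =>
    change _ ≤ 0 + gamma / dualNorm F x₀ c
    simp
  | succ k ih =>
    obtain ⟨hm, hcen⟩ := hB.shortMain_center (c := c) hx₀ h₀ (k + 1)
    have h1 := hB.mul_le_gamma_div hc hm hcen
    change _ ≤ (shortMain F c x₀ (k + 1)).1 + gamma / dualNorm F (shortMain F c x₀ (k + 1)).2 c
    have hs := Real.sqrt_nonneg ν
    have h2 : 0 < 1 + 1.25 / (1 + 9 * Real.sqrt ν) := by positivity
    rw [pow_succ, ← mul_assoc]
    nlinarith [mul_le_mul_of_nonneg_right ih h2.le]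

/-- The number of short steps until the parameter of the main phase reaches `T`. -/
theorem shortMain_reach {c x₀ : Vec n} (hc : c ≠ 0) (hν : 1 ≤ ν) (hx₀ : x₀ ∈ interior Q)
    (h₀ : dualNorm F x₀ (gradient F x₀) ≤ beta) {T : ℝ} (hT : 0 ≤ T) :
    ∃ k, T ≤ (shortMain F c x₀ k).1 ∧
      (k : ℝ) ≤ (1 + 9 * Real.sqrt ν) * Real.posLog (T * dualNorm F x₀ c / gamma) + 2 := by
  have hW := ten_le_one_add_nine_sqrt hν
  have hp := hB.dualNorm_pos hx₀ hc
  obtain ⟨k, hk, hA⟩ := exists_le_pow (by linarith : 0 < 1 + 9 * Real.sqrt ν)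
    (by positivity) (one_div_le_log hW)
    (div_nonneg (mul_nonneg hT hp.le) gamma_pos.le : 0 ≤ T * dualNorm F x₀ c / gamma)
  refine ⟨k + 1, le_trans ?_ (hB.shortMain_growth hc hx₀ h₀ k), by push_cast; linarith⟩
  have h1 := mul_le_mul_of_nonneg_left hA (div_pos gamma_pos hp).le
  refine le_trans (le_of_eq ?_) h1
  have := gamma_pos.ne'
  field_simp

theorem shortAux_decay {x₀ : Vec n} (hG : -gradient F x₀ ≠ 0) (hx₀ : x₀ ∈ interior Q) {k : ℕ}
    (h : ∀ j < k, ¬ AuxStop F (shortAux F x₀ j).2) :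
    (shortAux F x₀ k).1 * (1 + 1.25 / (1 + 9 * Real.sqrt ν)) ^ k ≤ 1 := by
  induction k with
  | zero => simp [shortAux, shortRun]
  | succ k ih =>
    have ih := ih fun j hj => h j (by omega)
    have ht := hB.shortAux_pos hx₀ (k := k) fun j hj => h j (by omega)
    obtain ⟨hm, hcen⟩ := hB.shortAux_center hx₀ k
    have h1 := hB.mul_le_gamma_div hG hm hcen
    change ((shortAux F x₀ k).1 - gamma / dualNorm F (shortAux F x₀ k).2 (-gradient F x₀)) * _ ≤ 1
    set t := (shortAux F x₀ k).1
    have hs := Real.sqrt_nonneg ν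
    set ρ := 1.25 / (1 + 9 * Real.sqrt ν)
    have hρ : 0 ≤ ρ := by positivity
    have h2 : 0 < (1 + ρ) ^ k := by positivity
    rw [pow_succ]
    have h3 : (t - gamma / dualNorm F (shortAux F x₀ k).2 (-gradient F x₀)) * (1 + ρ) ≤ t := by
      nlinarith [mul_nonneg ht.le (mul_nonneg hρ hρ)]
    nlinarith [mul_le_mul_of_nonneg_right h3 h2.le]

/-- The short-step auxiliary phase stops: the parameter `t` decreases geometrically, and the
stopping rule holds once `t ‖G‖* ≤ γ`. -/
theorem shortAux_reach {x₀ z : Vec n} (hν : 1 ≤ ν) (hx₀ : x₀ ∈ interior Q) (hz : z ∈ interior Q)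
    (hc : gradient F z = 0) :
    ∃ k, AuxStop F (shortAux F x₀ k).2 ∧ (k : ℝ) ≤ (1 + 9 * Real.sqrt ν) *
      Real.posLog (8 * ν * dualNorm F z (gradient F x₀) / gamma) + 1 := by
  have hW := ten_le_one_add_nine_sqrt hν
  have hg := dualNorm_nonneg F z (gradient F x₀)
  have hA0 : 0 ≤ 8 * ν * dualNorm F z (gradient F x₀) / gamma :=
    div_nonneg (by positivity) gamma_pos.le
  obtain ⟨k, hk, hA⟩ := exists_le_pow (by linarith : 0 < 1 + 9 * Real.sqrt ν)
    (by positivity) (one_div_le_log hW) hA0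
  by_cases hG : -gradient F x₀ = 0
  · refine ⟨0, auxStop_iff.2 ?_, ?_⟩
    · change dualNorm F x₀ (gradient F x₀) ≤ _
      rw [neg_eq_zero.1 hG, dualNorm_zero]; norm_num
    · push_cast
      exact add_nonneg (mul_nonneg (by linarith) Real.posLog_nonneg) zero_le_one
  by_contra hno
  push Not at hno
  have hns : ∀ j ≤ k, ¬ AuxStop F (shortAux F x₀ j).2 := by
    intro j hj hst
    have h1 := hno j hst
    have h2 : (j : ℝ) ≤ k := by exact_mod_cast hj
    linarith
  have ht := hB.shortAux_pos hx₀ (k := k) fun j hj => hns j hj.le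
  obtain ⟨hm, hcen⟩ := hB.shortAux_center hx₀ k
  have h1 := hB.gamma_lt_of_not_auxStop hm ht hcen (hns k le_rfl)
  have h2 := hB.shortAux_decay hG hx₀ (k := k) fun j hj => hns j hj.le
  have h3 := hB.dualNorm_le_analyticCenter hm hz hc hν (-gradient F x₀)
  rw [show dualNorm F z (-gradient F x₀) = dualNorm F z (gradient F x₀) by
    rw [← neg_one_smul ℝ, dualNorm_smul]; simp] at h3
  rw [div_le_iff₀ gamma_pos] at hA
  have h4 := mul_le_mul_of_nonneg_left (h3.trans hA) ht.le
  have h5 := mul_le_mul_of_nonneg_right h2 gamma_pos.le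
  linarith

/-! ### The complete algorithms -/

theorem adaptiveRun_mem {d : Vec n} {next : ℝ → ℝ → Vec n → ℝ} {t₀ : ℝ} {x₀ : Vec n}
    (hx₀ : x₀ ∈ interior Q) (k : ℕ) :
    (adaptiveRun Q F d next t₀ x₀ k).x ∈ interior Q ∧
      (adaptiveRun Q F d next t₀ x₀ k).lastX ∈ interior Q := by
  induction k with
  | zero => exact ⟨hx₀, hx₀⟩
  | succ k ih =>
    rw [adaptiveRun, adaptiveStep]
    split_ifs
    · exact ⟨hB.dampedNewton_mem ih.1 _ _, ih.1⟩
    · exact ⟨hB.dampedNewton_mem ih.1 _ _, ih.2⟩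
    · exact ⟨ih.2, ih.2⟩

/-- The output of an auxiliary phase is an approximate analytic center: `√β / (1 + √β) = 1/4`, and a
full Newton step from that decrement leads to `β`. -/
theorem auxFinal_center {x : Vec n} (hx : x ∈ interior Q) (h : AuxStop F x) :
    auxFinal F x ∈ interior Q ∧
      dualNorm F (auxFinal F x) (gradient F (auxFinal F x)) ≤ beta := by
  have h1 := hB.short_step hx (d := 0) (t' := 0) (by simpa using auxStop_iff.1 h)
  have e : x + newtonDir F 0 0 x = auxFinal F x := by
    rw [newtonDir, auxFinal, smul_zero, zero_add, sub_eq_add_neg]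
  rw [e, smul_zero, zero_add] at h1
  exact ⟨h1.1, by unfold beta; exact h1.2⟩

end BoundedBarrier

theorem tolInv_pos {ν ε : ℝ} (hν : 1 ≤ ν) (hε : 0 < ε) : 0 < tolInv ν ε := by
  have := Real.sqrt_nonneg ν
  unfold tolInv beta
  have h1 : (1 : ℝ) - 1 / 9 = 8 / 9 := by norm_num
  rw [h1]
  positivity

theorem tolInv_le {ν ε : ℝ} (hν : 1 ≤ ν) (hε : 0 < ε) : tolInv ν ε ≤ 2 * ν * (1 / ε) := by
  have h1 : Real.sqrt ν ≤ ν := Real.sqrt_le_iff.2 ⟨by linarith, by nlinarith⟩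
  have h2 : 0 < ε⁻¹ := inv_pos.2 hε
  unfold tolInv beta
  rw [one_div ε]
  refine mul_le_mul_of_nonneg_right ?_ h2.le
  have h3 : (1 / 9 + Real.sqrt ν) * (1 / 9) / (1 - 1 / 9) = (1 / 9 + Real.sqrt ν) / 8 := by
    norm_num; ring
  rw [h3]
  linarith

theorem posLog_le_five_of_le {a : ℝ} (h0 : 0 ≤ a) (ha : a ≤ 128) : Real.posLog a ≤ 5 := by
  refine (Real.posLog_le_posLog h0 ha).trans (max_le (by norm_num) ?_)
  rw [show (128 : ℝ) = 2 ^ 7 by norm_num, Real.log_pow]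
  have := Real.log_two_lt_d9
  push_cast
  linarith

theorem posLog_eq_log_of_one_le {ν : ℝ} (hν : 1 ≤ ν) : Real.posLog ν = Real.log ν :=
  Real.posLog_eq_log (by rwa [abs_of_nonneg (by linarith)])

theorem adaptiveFactor_le {ν : ℝ} (hν : 1 ≤ ν) : adaptiveFactor ν ≤ 40 * (1 + Real.log ν) := by
  have h1 : 1 ≤ Real.sqrt ν := Real.one_le_sqrt.2 hν
  have h2 : Real.log (1 + 9 * Real.sqrt ν) ≤ Real.log (10 * Real.sqrt ν) :=
    Real.log_le_log (by linarith) (by linarith)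
  rw [Real.log_mul (by norm_num) (by linarith), Real.log_sqrt (by linarith)] at h2
  have h3 := log_ten_lt
  have h4 := Real.log_nonneg hν
  unfold adaptiveFactor
  linarith

/-- The number of short steps of the complete algorithm, in the form that the bound takes for the
adaptive method. -/
theorem shortSteps_bound_le {ν ε g v N : ℝ} (hν : 1 ≤ ν) (hε : 0 < ε) (hv : 0 ≤ v)
    (hN : N ≤ (1 + 9 * Real.sqrt ν) * Real.posLog (8 * ν * g / gamma) + 1 + 1 +
      ((1 + 9 * Real.sqrt ν) * Real.posLog (tolInv ν ε * (8 * ν * v) / gamma) + 2)) :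
    adaptiveFactor ν * N ≤ 5000 * Real.sqrt ν * (1 + Real.log ν) *
      (1 + Real.log ν + Real.posLog g + Real.posLog v + Real.posLog (1 / ε)) := by
  have hs : 1 ≤ Real.sqrt ν := Real.one_le_sqrt.2 hν
  have hl := Real.log_nonneg hν
  have hf := adaptiveFactor_le hν
  have hf0 : 0 ≤ adaptiveFactor ν := by
    have := le_log_one_add_nine_sqrt hν
    unfold adaptiveFactor
    linarith
  have p1 := Real.posLog_nonneg (x := g)
  have p2 := Real.posLog_nonneg (x := v)
  have p3 := Real.posLog_nonneg (x := 1 / ε)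
  have a1 : Real.posLog (8 * ν * g / gamma) ≤ 5 + Real.log ν + Real.posLog g := by
    rw [show 8 * ν * g / gamma = 57.6 * ν * g by unfold gamma; ring]
    have h1 := Real.posLog_mul (x := 57.6 * ν) (y := g)
    have h2 := Real.posLog_mul (x := 57.6) (y := ν)
    have h3 := posLog_le_five_of_le (a := 57.6) (by norm_num) (by norm_num)
    rw [posLog_eq_log_of_one_le hν] at h2
    linarith
  have a2 : Real.posLog (tolInv ν ε * (8 * ν * v) / gamma) ≤
      5 + 2 * Real.log ν + Real.posLog v + Real.posLog (1 / ε) := by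
    have h0 := (tolInv_pos hν hε).le
    have hle : tolInv ν ε * (8 * ν * v) / gamma ≤ 115.2 * ν * ν * (1 / ε) * v := by
      rw [show tolInv ν ε * (8 * ν * v) / gamma = tolInv ν ε * (57.6 * ν * v) by
        unfold gamma; ring]
      have := mul_le_mul_of_nonneg_right (tolInv_le hν hε)
        (show 0 ≤ 57.6 * ν * v by positivity)
      linarith
    have h1 := Real.posLog_le_posLog (div_nonneg (by positivity) gamma_pos.le) hle
    have h2 := Real.posLog_mul (x := 115.2 * ν * ν * (1 / ε)) (y := v)
    have h3 := Real.posLog_mul (x := 115.2 * ν * ν) (y := 1 / ε)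
    have h4 := Real.posLog_mul (x := 115.2 * ν) (y := ν)
    have h5 := Real.posLog_mul (x := 115.2) (y := ν)
    have h6 := posLog_le_five_of_le (a := 115.2) (by norm_num) (by norm_num)
    rw [posLog_eq_log_of_one_le hν] at h4 h5
    linarith
  set S := 1 + Real.log ν + Real.posLog g + Real.posLog v + Real.posLog (1 / ε) with hS
  have hsum : N ≤ 125 * Real.sqrt ν * S := by
    have b1 := mul_le_mul_of_nonneg_left a1 (show 0 ≤ 1 + 9 * Real.sqrt ν by linarith)
    have b2 := mul_le_mul_of_nonneg_left a2 (show 0 ≤ 1 + 9 * Real.sqrt ν by linarith)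
    have b3 : N ≤ (1 + 9 * Real.sqrt ν) * (10 * S) + 4 := by nlinarith
    have b4 : 1 ≤ S := by rw [hS]; linarith
    nlinarith [mul_nonneg (sub_nonneg.2 hs) (zero_le_one.trans b4)]
  have hS0 : 0 ≤ 125 * Real.sqrt ν * S := by
    have b4 : 0 ≤ S := by rw [hS]; linarith
    positivity
  calc adaptiveFactor ν * N ≤ adaptiveFactor ν * (125 * Real.sqrt ν * S) := by gcongr
    _ ≤ 40 * (1 + Real.log ν) * (125 * Real.sqrt ν * S) := by gcongr
    _ = _ := by ring

end Barrier

theorem theorem2 :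
    ∃ K : ℝ, 0 < K ∧
    ∀ (n : ℕ) (Q : Set (Barrier.Vec n)) (F : Barrier.Vec n → ℝ) (ν : ℝ) (c : Barrier.Vec n)
      (ε : ℝ),
      Convex ℝ Q → Bornology.IsBounded Q → closure (interior Q) = Q → (interior Q).Nonempty →
      Barrier.IsSelfConcordantBarrier Q F ν → c ≠ 0 → 0 < ε →
      -- the main phase, from an approximate analytic center: both methods stop, and the bound
      -- holds whether or not the adaptive method has to stop at an accepted step
      (∀ x₀ ∈ interior Q, Barrier.dualNorm F x₀ (gradient F x₀) ≤ Barrier.beta →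
        (Barrier.shortMainStops F c ν ε x₀).Nonempty ∧
        (Barrier.adaptiveMainAcceptedStops Q F c ν ε x₀).Nonempty ∧
        (Barrier.adaptiveMainSteps Q F c ν ε x₀ : ℝ) ≤
          Barrier.adaptiveFactor ν * (Barrier.shortMainSteps F c ν ε x₀ : ℝ) ∧
        (Barrier.adaptiveMainAcceptedSteps Q F c ν ε x₀ : ℝ) ≤
          Barrier.adaptiveFactor ν * (Barrier.shortMainSteps F c ν ε x₀ : ℝ)) ∧
      (∀ x₀ ∈ interior Q,
        -- the auxiliary phase, from any interior point
        (Barrier.shortAuxStops F x₀).Nonempty ∧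
        (Barrier.adaptiveAuxStops Q F x₀).Nonempty ∧
        (Barrier.adaptiveAuxSteps Q F x₀ : ℝ) ≤
          Barrier.adaptiveFactor ν * (Barrier.shortAuxSteps F x₀ : ℝ) ∧
        -- the complete algorithms, from any interior point
        (Barrier.shortMainStops F c ν ε (Barrier.shortAuxOutput F x₀)).Nonempty ∧
        (Barrier.adaptiveMainAcceptedStops Q F c ν ε
          (Barrier.adaptiveAuxOutput Q F x₀)).Nonempty ∧
        (Barrier.adaptiveTotal Q F c ν ε x₀ : ℝ) ≤
          Barrier.adaptiveFactor ν * (Barrier.shortTotal F c ν ε x₀ : ℝ) ∧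
        (Barrier.adaptiveAcceptedTotal Q F c ν ε x₀ : ℝ) ≤
          Barrier.adaptiveFactor ν * (Barrier.shortTotal F c ν ε x₀ : ℝ) ∧
        -- the complete adaptive algorithm is `Õ(√ν)`; `xF` is the analytic center
        (∀ xF ∈ interior Q, gradient F xF = 0 →
          (Barrier.adaptiveAcceptedTotal Q F c ν ε x₀ : ℝ) ≤
            K * Real.sqrt ν * (1 + Real.log ν) *
              (1 + Real.log ν + Real.posLog (Barrier.dualNorm F xF (gradient F x₀)) +
                Real.posLog (Barrier.dualNorm F xF c) + Real.posLog (1 / ε)))) := by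
  refine ⟨5000, by norm_num, ?_⟩
  intro n Q F ν c ε hconv hbdd _ hne hF hc hε
  have hB : Barrier.BoundedBarrier Q F ν := ⟨hF, hconv, hbdd⟩
  have hν : 1 ≤ ν := hB.one_le_nu hne.some_mem hc
  have htol := Barrier.tolInv_pos hν hε
  -- the short-step main phase stops, and not at once
  have hmainStops : ∀ x₀ ∈ interior Q, Barrier.dualNorm F x₀ (gradient F x₀) ≤ Barrier.beta →
      (Barrier.shortMainStops F c ν ε x₀).Nonempty := by
    intro x₀ hx₀ h₀
    obtain ⟨k, hk, -⟩ := hB.shortMain_reach hc hν hx₀ h₀ htol.le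
    exact ⟨k, hk⟩
  have hmainSteps : ∀ x₀ ∈ interior Q, Barrier.dualNorm F x₀ (gradient F x₀) ≤ Barrier.beta →
      1 ≤ Barrier.shortMainSteps F c ν ε x₀ ∧ Barrier.tolInv ν ε ≤
        (Barrier.shortMain F c x₀ (Barrier.shortMainSteps F c ν ε x₀)).1 := by
    intro x₀ hx₀ h₀
    have hmem : Barrier.tolInv ν ε ≤
        (Barrier.shortMain F c x₀ (Barrier.shortMainSteps F c ν ε x₀)).1 :=
      Nat.sInf_mem (hmainStops x₀ hx₀ h₀)
    refine ⟨Nat.one_le_iff_ne_zero.2 fun h => ?_, hmem⟩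
    rw [h] at hmem
    exact absurd htol (not_lt.2 hmem)
  have hsteps_le : ∀ x₀, (Barrier.adaptiveMainAcceptedStops Q F c ν ε x₀).Nonempty →
      Barrier.adaptiveMainSteps Q F c ν ε x₀ ≤ Barrier.adaptiveMainAcceptedSteps Q F c ν ε x₀ :=
    fun x₀ h => Nat.sInf_le (Nat.sInf_mem h).1
  refine ⟨fun x₀ hx₀ h₀ => ?_, fun x₀ hx₀ => ?_⟩
  · obtain ⟨hN, hreach⟩ := hmainSteps x₀ hx₀ h₀
    obtain ⟨k, hk, hacc, hkN⟩ := hB.adaptiveMain_reach hc hν hx₀ h₀ hN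
    have hmem : k ∈ Barrier.adaptiveMainAcceptedStops Q F c ν ε x₀ := ⟨hreach.trans hk, hacc⟩
    have h1 : (Barrier.adaptiveMainAcceptedSteps Q F c ν ε x₀ : ℝ) ≤ k := by
      exact_mod_cast Nat.sInf_le hmem
    have h2 : (Barrier.adaptiveMainSteps Q F c ν ε x₀ : ℝ) ≤
        Barrier.adaptiveMainAcceptedSteps Q F c ν ε x₀ := by
      exact_mod_cast hsteps_le x₀ ⟨k, hmem⟩
    exact ⟨hmainStops x₀ hx₀ h₀, ⟨k, hmem⟩, by linarith, by linarith⟩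
  · obtain ⟨z, hz, hzc⟩ := hB.exists_center hne 0 0
    rw [smul_zero, zero_add] at hzc
    obtain ⟨k₀, hk₀, -⟩ := hB.shortAux_reach hν hx₀ hz hzc
    have hauxS : (Barrier.shortAuxStops F x₀).Nonempty := ⟨k₀, hk₀⟩
    have hstopS : Barrier.AuxStop F (Barrier.shortAux F x₀ (Barrier.shortAuxSteps F x₀)).2 :=
      Nat.sInf_mem hauxS
    obtain ⟨k₁, hk₁, hk₁N⟩ := hB.adaptiveAux_reach hν hx₀ (N := Barrier.shortAuxSteps F x₀)
      (fun j hj => Nat.notMem_of_lt_sInf hj) hstopS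
    have hauxA : (Barrier.adaptiveAuxStops Q F x₀).Nonempty := ⟨k₁, hk₁⟩
    have hstopA : Barrier.AuxStop F
        (Barrier.adaptiveAux Q F x₀ (Barrier.adaptiveAuxSteps Q F x₀)).x := Nat.sInf_mem hauxA
    have hauxle : (Barrier.adaptiveAuxSteps Q F x₀ : ℝ) ≤ k₁ := by
      exact_mod_cast Nat.sInf_le (show k₁ ∈ Barrier.adaptiveAuxStops Q F x₀ from hk₁)
    have hxS := hB.auxFinal_center (hB.shortAux_center hx₀ _).1 hstopS
    have hxA := hB.auxFinal_center (hB.adaptiveRun_mem hx₀ _).1 hstopA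
    change Barrier.shortAuxOutput F x₀ ∈ _ ∧
      Barrier.dualNorm F (Barrier.shortAuxOutput F x₀) _ ≤ _ at hxS
    change Barrier.adaptiveAuxOutput Q F x₀ ∈ _ ∧
      Barrier.dualNorm F (Barrier.adaptiveAuxOutput Q F x₀) _ ≤ _ at hxA
    obtain ⟨hN, hreach⟩ := hmainSteps _ hxS.1 hxS.2
    obtain ⟨k₂, hk₂, hacc₂, hk₂N⟩ :=
      hB.adaptiveMain_reach_other hc hν hxS.1 hxS.2 hxA.1 hxA.2 hN
    have hmem : k₂ ∈ Barrier.adaptiveMainAcceptedStops Q F c ν ε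
        (Barrier.adaptiveAuxOutput Q F x₀) := ⟨hreach.trans hk₂, hacc₂⟩
    have h1 : (Barrier.adaptiveMainAcceptedSteps Q F c ν ε
        (Barrier.adaptiveAuxOutput Q F x₀) : ℝ) ≤ k₂ := by exact_mod_cast Nat.sInf_le hmem
    have h2 : (Barrier.adaptiveMainSteps Q F c ν ε (Barrier.adaptiveAuxOutput Q F x₀) : ℝ) ≤
        Barrier.adaptiveMainAcceptedSteps Q F c ν ε (Barrier.adaptiveAuxOutput Q F x₀) := by
      exact_mod_cast hsteps_le _ ⟨k₂, hmem⟩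
    have htotal : (Barrier.adaptiveAcceptedTotal Q F c ν ε x₀ : ℝ) ≤
        Barrier.adaptiveFactor ν * (Barrier.shortTotal F c ν ε x₀ : ℝ) := by
      unfold Barrier.adaptiveAcceptedTotal Barrier.shortTotal
      push_cast
      linarith
    refine ⟨hauxS, hauxA, by linarith, hmainStops _ hxS.1 hxS.2, ⟨k₂, hmem⟩, ?_, htotal, ?_⟩
    · refine le_trans ?_ htotal
      unfold Barrier.adaptiveTotal Barrier.adaptiveAcceptedTotal
      push_cast
      linarith
    · intro xF hxF hgrad
      refine htotal.trans (Barrier.shortSteps_bound_le hν hε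
        (Barrier.dualNorm_nonneg _ _ _) ?_)
      obtain ⟨i, hi, hiN⟩ := hB.shortAux_reach hν hx₀ hxF hgrad
      obtain ⟨j, hj, hjN⟩ := hB.shortMain_reach hc hν hxS.1 hxS.2 htol.le
      have e1 : (Barrier.shortAuxSteps F x₀ : ℝ) ≤ i := by
        exact_mod_cast Nat.sInf_le (show i ∈ Barrier.shortAuxStops F x₀ from hi)
      have e2 : (Barrier.shortMainSteps F c ν ε (Barrier.shortAuxOutput F x₀) : ℝ) ≤ j := by
        exact_mod_cast Nat.sInf_le
          (show j ∈ Barrier.shortMainStops F c ν ε (Barrier.shortAuxOutput F x₀) from hj)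
      have e3 := hB.dualNorm_le_analyticCenter hxS.1 hxF hgrad hν c
      have e4 : Real.posLog (Barrier.tolInv ν ε *
            Barrier.dualNorm F (Barrier.shortAuxOutput F x₀) c / Barrier.gamma) ≤
          Real.posLog (Barrier.tolInv ν ε * (8 * ν * Barrier.dualNorm F xF c) /
            Barrier.gamma) := by
        refine Real.posLog_le_posLog (div_nonneg
          (mul_nonneg htol.le (Barrier.dualNorm_nonneg _ _ _)) Barrier.gamma_pos.le) ?_
        exact div_le_div_of_nonneg_right (mul_le_mul_of_nonneg_left e3 htol.le)
          Barrier.gamma_pos.le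
      have e5 := mul_le_mul_of_nonneg_left e4
        (show 0 ≤ 1 + 9 * Real.sqrt ν by have := Real.sqrt_nonneg ν; linarith)
      unfold Barrier.shortTotal
      push_cast
      linarith
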